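/- Let $m\ge 0$ and let $(\mathbb S^2,\sigma)$ be the standard unit sphere with gradient $\tilde\nabla$, Laplacian $\tilde\Delta$ and inner product $\langle\cdot,\cdot\rangle=\sigma$. Near future null infinity use the coordinates $(\mathbf y,s,\bar v)$ with $\mathbf y\in\mathbb S^2$, $s=1/r$, $\bar v=t-r_*$, in which the Schwarzschild metric of mass $m$ is $g=-(1-2ms)\,d\bar v^2+2s^{-2}\,d\bar v\,ds+s^{-2}\sigma$. Let $U\subset\mathbb S^2$ be open, $s_0>0$, $2ms_0\le 1$, and let the graph $\bar v=-P(\mathbf y,s)$ over $U\times(0,s_0)$ be a spacelike surface whose mean curvature $H$ with respect to the future directed unit normal (one third of the trace of the second fundamental form; a future hyperboloid in Minkowski space has $H>0$) is positive. Put $$L=-\bigl(2P_s+s^2(1-2ms)P_s^2+|\tilde\nabla P|^2\bigr).$$ Assume that $P$ and $H$ are of class $C^4$ on $U\times[0,s_0)$, up to $s=0$ (so $H$ also denotes the extension to $s=0$), and let $H_0=H|_{s=0}$. Write $\phi=\mathcal O(s^k)$ if $s^{-k}\phi$ extends continuously to $U\times[0,s_0)$. All derivatives in $s$ below are taken at $s=0$,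 and $P$ also denotes its boundary value $P|_{s=0}$. (a) At each point of $U\times\{0\}$, $L=0$, or $H_0\neq 0$ and $L=H_0^{-2}$. (b) Assume $L=H_0^{-2}>0$ on $U\times\{0\}$. Then: (i) $P_s=-\frac12\bigl(H_0^{-2}+|\tilde\nabla P|^2\bigr)$ at $s=0$. (ii) $H=H_0+\mathcal O(s^2)$ if and only if, at $s=0$, $$L_s=-H_0^{-2}\bigl(\tilde\Delta P+H_0^{-1}\langle\tilde\nabla H_0,\tilde\nabla P\rangle\bigr),$$ and this formula is equivalent, at each point, to $$P_{ss}=\tfrac12H_0^{-2}\tilde\Delta P+\tfrac12\langle\tilde\nabla|\tilde\nabla P|^2,\tilde\nabla P\rangle-\tfrac12H_0^{-3}\langle\tilde\nabla H_0,\tilde\nabla P\rangle.$$ (iii) If $H=H_0+\mathcal O(s^2)$, then $H=H_0+\mathcal O(s^3)$ if and only if, at $s=0$, $$L_{ss}=-\tfrac92H_0^{2}L_s^2-4(L_s\tilde\Delta P+L\tilde\Delta P_s)+2\langle\tilde\nabla L_s,\tilde\nabla P\rangle+2\langle\tilde\nabla(H_0^{-2}),\tilde\nabla P_s\rangle+4H_0^{-2}P_s,$$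 and this formula is equivalent, at each point, to $$P_{sss}=\tfrac94H_0^{2}L_s^2+2(L_s\tilde\Delta P+H_0^{-2}\tilde\Delta P_s)-\langle\tilde\nabla L_s,\tilde\nabla P\rangle-\langle\tilde\nabla(H_0^{-2}),\tilde\nabla P_s\rangle-2H_0^{-2}P_s-\langle\tilde\nabla P_{ss},\tilde\nabla P\rangle-\langle\tilde\nabla P_s,\tilde\nabla P_s\rangle-P_s^2.$$ (c) Assume $L=H_0^{-2}>0$ on $U\times\{0\}$ and $H=H_0+\mathcal O(s^3)$. Then on $U\times\{0\}$ the compatibility condition $$\begin{aligned}0=&-2H_0^{-3}H_{sss}+\tfrac92H_0^{-1}\langle\tilde\nabla H_0,\tilde\nabla P\rangle L_{ss}+\tfrac52L_{ss}\tilde\Delta P+\tfrac34H_0^4L_s^3-4L_s\tilde\Delta P_s-2H_0^{-2}\tilde\Delta P_{ss}\\&+6L_sP_s+\langle\tilde\nabla L_{ss},\tilde\nabla P\rangle+2\langle\tilde\nabla L_s,\tilde\nabla P_s\rangle+\langle\tilde\nabla(H_0^{-2}),\tilde\nabla P_{ss}\rangle\end{aligned}$$ holds; here $P_s,L_s,P_{ss},L_{ss}$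 are given by the formulas in (b), so that this is a condition on $P|_{s=0}$ and $H$. (d) For each $k\ge 0$ there is an expression, depending only on $k$ and $m$ and built from constants and symbols by sums, products, inner products of gradients and Laplacians on $\mathbb S^2$, such that whenever $P$ and $H$ as above are smooth up to $s=0$ and $L=H_0^{-2}>0$ on $U\times\{0\}$, $\partial_s^kP|_{s=0}$ is given on $U$ by this expression evaluated at the functions $P|_{s=0}$, $\partial_s^jH|_{s=0}$ ($0\le j\le k-1$), $H_0^{-1}$ (if $k\ge1$), and $P_{ssss}|_{s=0}$ (only if $k\ge 4$). -/

import Mathlib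

open scoped Manifold ContDiff

noncomputable section

namespace NullInfinity

/-! ### The unit sphere -/

/-- Euclidean three-space. -/
abbrev E3 : Type := EuclideanSpace ℝ (Fin 3)

/-- The standard unit sphere in Euclidean three-space. -/
abbrev S2 : Type := Metric.sphere (0 : E3) 1

/-- The radial projection `x ↦ x / |x|` onto the unit sphere (with an irrelevant value at `0`). -/
def radial (x : E3) : S2 :=
  if hx : x = 0 then ⟨EuclideanSpace.single 0 1, by simp⟩
  else ⟨‖x‖⁻¹ • x, by simp [norm_smul, hx]⟩

/-- `⟨∇f, ∇g⟩` for the round metric of the sphere. At a point of the sphere the intrinsic gradient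
of `f` is the Euclidean gradient of the extension of `f` that is constant along rays. -/
def gradInner (f g : S2 → ℝ) (y : S2) : ℝ :=
  inner ℝ (gradient (f ∘ radial) (y : E3)) (gradient (g ∘ radial) (y : E3))

/-- The Laplacian of the round metric of the sphere. At a point of the sphere it is the Euclidean
Laplacian of the extension of `f` that is constant along rays. -/
def sphereLap (f : S2 → ℝ) (y : S2) : ℝ :=
  Laplacian.laplacian (f ∘ radial) (y : E3)

/-! ### Level sets in a Lorentzian metric

A metric on (an open subset of) four-dimensional coordinate space is given by the matrix of its
components. -/

/-- The partial derivative in the `a`-th coordinate direction. -/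
def pd (a : Fin 4) (φ : (Fin 4 → ℝ) → ℝ) (z : Fin 4 → ℝ) : ℝ :=
  fderiv ℝ φ z (Pi.single a 1)

/-- The Christoffel symbol `Γ^c_{ab}` of the Levi-Civita connection of `g`. -/
def christoffel (g : (Fin 4 → ℝ) → Matrix (Fin 4) (Fin 4) ℝ) (c a b : Fin 4) (z : Fin 4 → ℝ) : ℝ :=
  (1 / 2) * ∑ d, (g z)⁻¹ c d *
    (pd a (fun w => g w b d) z + pd b (fun w => g w a d) z - pd d (fun w => g w a b) z)

/-- `g(∇F, ∇F) = g^{ab} F_a F_b`. -/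
def gradSq (g : (Fin 4 → ℝ) → Matrix (Fin 4) (Fin 4) ℝ) (F : (Fin 4 → ℝ) → ℝ)
    (z : Fin 4 → ℝ) : ℝ :=
  ∑ a, ∑ b, (g z)⁻¹ a b * pd a F z * pd b F z

/-- The covector `N_b` of the unit normal `N = -∇F / |∇F|` of the level sets of `F`, where
`|∇F| = √(-g(∇F, ∇F))`. -/
def conormal (g : (Fin 4 → ℝ) → Matrix (Fin 4) (Fin 4) ℝ) (F : (Fin 4 → ℝ) → ℝ)
    (b : Fin 4) (z : Fin 4 → ℝ) : ℝ :=
  -pd b F z / Real.sqrt (-gradSq g F z)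

/-- The unit normal `N^a` of the level sets of `F`. -/
def unitNormal (g : (Fin 4 → ℝ) → Matrix (Fin 4) (Fin 4) ℝ) (F : (Fin 4 → ℝ) → ℝ)
    (a : Fin 4) (z : Fin 4 → ℝ) : ℝ :=
  ∑ b, (g z)⁻¹ a b * conormal g F b z

/-- `∇_a N_b`. On vectors tangent to a level set of `F` this bilinear form is the second fundamental
form `A(X, Y) = g(∇_X N, Y)` of that level set. -/
def secondForm (g : (Fin 4 → ℝ) → Matrix (Fin 4) (Fin 4) ℝ) (F : (Fin 4 → ℝ) → ℝ)
    (a b : Fin 4) (z : Fin 4 → ℝ) : ℝ :=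
  pd a (conormal g F b) z - ∑ c, christoffel g c a b z * conormal g F c z

/-- The mean curvature with respect to `N`: one third of the trace of the second fundamental form
over the tangent space of the level set (`g^{ab} + N^a N^b` is the inverse induced metric). -/
def levelMeanCurvature (g : (Fin 4 → ℝ) → Matrix (Fin 4) (Fin 4) ℝ) (F : (Fin 4 → ℝ) → ℝ)
    (z : Fin 4 → ℝ) : ℝ :=
  (1 / 3) * ∑ a, ∑ b,
    ((g z)⁻¹ a b + unitNormal g F a z * unitNormal g F b z) * secondForm g F a b z

/-! ### Schwarzschild spacetime in retarded coordinates

The coordinates are `z = (v, x)` with `v = t - r_*` the retarded null coordinate and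
`x = r y ∈ ℝ³`, `r = |x|`, `y ∈ S²`. -/

/-- The space part `x` of the point `z = (v, x)`. -/
def space (z : Fin 4 → ℝ) : E3 := WithLp.toLp 2 fun i => z i.succ

/-- The components of `dr`. -/
def drForm (z : Fin 4 → ℝ) (a : Fin 4) : ℝ :=
  if a = 0 then 0 else z a / ‖space z‖

/-- The Schwarzschild metric `-(1 - 2m/r) dv² - 2 dv dr + r² σ`, where `r² σ = |dx|² - dr²`.
With `s = 1/r` it reads `-(1 - 2ms) dv² + 2 s⁻² dv ds + s⁻² σ`. -/
def schwarzschild (m : ℝ) (z : Fin 4 → ℝ) : Matrix (Fin 4) (Fin 4) ℝ := fun a b =>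
  -(1 - 2 * m / ‖space z‖) * (if a = 0 ∧ b = 0 then 1 else 0)
    - ((if a = 0 then drForm z b else 0) + (if b = 0 then drForm z a else 0))
    + ((if a = b ∧ a ≠ 0 then 1 else 0) - drForm z a * drForm z b)

/-- `F = v + P(y, s)`. The surface is the zero set of `F`, that is the graph `v = -P(y, s)`. -/
def graphFun (P : S2 → ℝ → ℝ) (z : Fin 4 → ℝ) : ℝ :=
  z 0 + P (radial (space z)) ‖space z‖⁻¹

/-- The point of the surface over `(y, s)`: `v = -P(y, s)`, `x = y / s`. -/
def graphPoint (P : S2 → ℝ → ℝ) (y : S2) (s : ℝ) : Fin 4 → ℝ :=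
  Fin.cons (-P y s) fun i => s⁻¹ * (y : E3) i

/-- The surface `v = -P(y, s)` is spacelike at the point over `(y, s)`: its normal is timelike. -/
def SpacelikeAt (m : ℝ) (P : S2 → ℝ → ℝ) (y : S2) (s : ℝ) : Prop :=
  gradSq (schwarzschild m) (graphFun P) (graphPoint P y s) < 0

/-- The mean curvature of the surface `v = -P(y, s)` in the Schwarzschild metric, at the point over
`(y, s)`. The normal `N = -∇F / |∇F|` is the future directed one, since
`g(N, ∂_v) = -1 / |∇F| < 0` and `∂_v = ∂_t` is future directed. -/
def graphMeanCurvature (m : ℝ) (P : S2 → ℝ → ℝ) (y : S2) (s : ℝ) : ℝ :=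
  levelMeanCurvature (schwarzschild m) (graphFun P) (graphPoint P y s)

/-! ### Functions of `(y, s)` near `s = 0` -/

/-- The function `φ(y, s)` is of class `C^n` on `U × [0, s₀)`, up to `s = 0`. -/
def RegularUpTo (n : ℕ∞ω) (U : Set S2) (s₀ : ℝ) (φ : S2 → ℝ → ℝ) : Prop :=
  ContMDiffOn ((𝓡 2).prod 𝓘(ℝ, ℝ)) 𝓘(ℝ, ℝ) n (fun p : S2 × ℝ => φ p.1 p.2) (U ×ˢ Set.Ico 0 s₀)

/-- The function `∂_s^k φ` on the sphere at `s = 0` (one-sided derivatives). -/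
def bdry (k : ℕ) (φ : S2 → ℝ → ℝ) (y : S2) : ℝ :=
  iteratedDerivWithin k (φ y) (Set.Ici 0) 0

/-- `φ = O(s^k)` on `U × (0, s₀)`: the function `s^{-k} φ` extends continuously to `s = 0`. -/
def OrderS (k : ℕ) (U : Set S2) (s₀ : ℝ) (φ : S2 → ℝ → ℝ) : Prop :=
  ∃ ψ : S2 → ℝ → ℝ,
    ContinuousOn (fun p : S2 × ℝ => ψ p.1 p.2) (U ×ˢ Set.Ico 0 s₀) ∧
      ∀ y ∈ U, ∀ s ∈ Set.Ioo 0 s₀, φ y s = s ^ k * ψ y s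

/-- `L = -⟨∇F, ∇F⟩ = -(2 P_s + s² (1 - 2ms) P_s² + |∇P|²)` in the unphysical metric
`s² g = σ + 2 dv ds - s² (1 - 2ms) dv²`; it makes sense up to `s = 0`. -/
def Lfun (m : ℝ) (P : S2 → ℝ → ℝ) (y : S2) (s : ℝ) : ℝ :=
  -(2 * derivWithin (P y) (Set.Ici 0) s
    + s ^ 2 * (1 - 2 * m * s) * derivWithin (P y) (Set.Ici 0) s ^ 2
    + gradInner (fun y' => P y' s) (fun y' => P y' s) y)

/-- The graph of `P` over `U × (0, s₀)` is a spacelike surface of positive mean curvature `H` in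
Schwarzschild spacetime of mass `m`, and `P` and `H` are of class `C^n` up to `s = 0`. -/
structure IsSpacelikeGraph (n : ℕ∞ω) (m : ℝ) (U : Set S2) (s₀ : ℝ) (P H : S2 → ℝ → ℝ) :
    Prop where
  regularP : RegularUpTo n U s₀ P
  regularH : RegularUpTo n U s₀ H
  spacelike : ∀ y ∈ U, ∀ s ∈ Set.Ioo 0 s₀, SpacelikeAt m P y s
  meanCurvature : ∀ y ∈ U, ∀ s ∈ Set.Ioo 0 s₀, graphMeanCurvature m P y s = H y s
  positive : ∀ y ∈ U, ∀ s ∈ Set.Ioo 0 s₀, 0 < H y s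

/-! ### The formulas at `s = 0` -/

/-- The function `H₀⁻²` on the sphere, where `H₀` is the value of `H` at `s = 0`. -/
def invSqH (H : S2 → ℝ → ℝ) (y : S2) : ℝ := (bdry 0 H y ^ 2)⁻¹

/-- `∂_s^k L` at `s = 0`. -/
def bdryL (k : ℕ) (m : ℝ) (P : S2 → ℝ → ℝ) : S2 → ℝ := bdry k (Lfun m P)

/-- `L_s = -H₀⁻² (ΔP + H₀⁻¹ ⟨∇H₀, ∇P⟩)` at `(y, 0)`. -/
def FormulaLs (m : ℝ) (P H : S2 → ℝ → ℝ) (y : S2) : Prop :=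
  bdryL 1 m P y =
    -invSqH H y * (sphereLap (bdry 0 P) y
      + (bdry 0 H y)⁻¹ * gradInner (bdry 0 H) (bdry 0 P) y)

/-- `P_ss = ½ H₀⁻² ΔP + ½ ⟨∇|∇P|², ∇P⟩ - ½ H₀⁻³ ⟨∇H₀, ∇P⟩` at `(y, 0)`. -/
def FormulaPss (P H : S2 → ℝ → ℝ) (y : S2) : Prop :=
  bdry 2 P y =
    1 / 2 * invSqH H y * sphereLap (bdry 0 P) y
      + 1 / 2 * gradInner (fun y' => gradInner (bdry 0 P) (bdry 0 P) y') (bdry 0 P) y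
      - 1 / 2 * (bdry 0 H y ^ 3)⁻¹ * gradInner (bdry 0 H) (bdry 0 P) y

/-- `L_ss = -(9/2) H₀² L_s² - 4 (L_s ΔP + L ΔP_s) + 2 ⟨∇L_s, ∇P⟩ + 2 ⟨∇H₀⁻², ∇P_s⟩ + 4 H₀⁻² P_s`
at `(y, 0)`. -/
def FormulaLss (m : ℝ) (P H : S2 → ℝ → ℝ) (y : S2) : Prop :=
  bdryL 2 m P y =
    -(9 / 2) * bdry 0 H y ^ 2 * bdryL 1 m P y ^ 2
      - 4 * (bdryL 1 m P y * sphereLap (bdry 0 P) y + bdryL 0 m P y * sphereLap (bdry 1 P) y)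
      + 2 * gradInner (bdryL 1 m P) (bdry 0 P) y
      + 2 * gradInner (invSqH H) (bdry 1 P) y
      + 4 * invSqH H y * bdry 1 P y

/-- `P_sss = (9/4) H₀² L_s² + 2 (L_s ΔP + H₀⁻² ΔP_s) - ⟨∇L_s, ∇P⟩ - ⟨∇H₀⁻², ∇P_s⟩ - 2 H₀⁻² P_s
- ⟨∇P_ss, ∇P⟩ - ⟨∇P_s, ∇P_s⟩ - P_s²` at `(y, 0)`. -/
def FormulaPsss (m : ℝ) (P H : S2 → ℝ → ℝ) (y : S2) : Prop :=
  bdry 3 P y =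
    9 / 4 * bdry 0 H y ^ 2 * bdryL 1 m P y ^ 2
      + 2 * (bdryL 1 m P y * sphereLap (bdry 0 P) y + invSqH H y * sphereLap (bdry 1 P) y)
      - gradInner (bdryL 1 m P) (bdry 0 P) y
      - gradInner (invSqH H) (bdry 1 P) y
      - 2 * invSqH H y * bdry 1 P y
      - gradInner (bdry 2 P) (bdry 0 P) y
      - gradInner (bdry 1 P) (bdry 1 P) y
      - bdry 1 P y ^ 2

/-- The compatibility condition at `(y, 0)`:
`0 = -2 H₀⁻³ H_sss + (9/2) H₀⁻¹ ⟨∇H₀, ∇P⟩ L_ss + (5/2) L_ss ΔP + (3/4) H₀⁴ L_s³ - 4 L_s ΔP_s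
- 2 H₀⁻² ΔP_ss + 6 L_s P_s + ⟨∇L_ss, ∇P⟩ + 2 ⟨∇L_s, ∇P_s⟩ + ⟨∇H₀⁻², ∇P_ss⟩`. -/
def Compatibility (m : ℝ) (P H : S2 → ℝ → ℝ) (y : S2) : Prop :=
  0 = -2 * (bdry 0 H y ^ 3)⁻¹ * bdry 3 H y
    + 9 / 2 * (bdry 0 H y)⁻¹ * gradInner (bdry 0 H) (bdry 0 P) y * bdryL 2 m P y
    + 5 / 2 * bdryL 2 m P y * sphereLap (bdry 0 P) y
    + 3 / 4 * bdry 0 H y ^ 4 * bdryL 1 m P y ^ 3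
    - 4 * bdryL 1 m P y * sphereLap (bdry 1 P) y
    - 2 * invSqH H y * sphereLap (bdry 2 P) y
    + 6 * bdryL 1 m P y * bdry 1 P y
    + gradInner (bdryL 2 m P) (bdry 0 P) y
    + 2 * gradInner (bdryL 1 m P) (bdry 1 P) y
    + gradInner (invSqH H) (bdry 2 P) y

/-! ### Universal differential expressions on the sphere -/

/-- Polynomial differential expressions on the sphere, in the symbols `ι`: built from constants and
symbols by sums, products, inner products of gradients, and Laplacians. -/
inductive DiffExpr (ι : Type) : Type
  | const (c : ℝ) : DiffExpr ι
  | sym (i : ι) : DiffExpr ι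
  | add (e₁ e₂ : DiffExpr ι) : DiffExpr ι
  | mul (e₁ e₂ : DiffExpr ι) : DiffExpr ι
  | gradInner (e₁ e₂ : DiffExpr ι) : DiffExpr ι
  | lap (e : DiffExpr ι) : DiffExpr ι

/-- The function on the sphere denoted by an expression, given the functions that its symbols
denote. -/
def DiffExpr.eval {ι : Type} (d : ι → S2 → ℝ) : DiffExpr ι → S2 → ℝ
  | .const c => fun _ => c
  | .sym i => d i
  | .add e₁ e₂ => fun y => e₁.eval d y + e₂.eval d y
  | .mul e₁ e₂ => fun y => e₁.eval d y * e₂.eval d y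
  | .gradInner e₁ e₂ => fun y => NullInfinity.gradInner (e₁.eval d) (e₂.eval d) y
  | .lap e => fun y => sphereLap (e.eval d) y

/-- The symbols allowed in an expression for `∂_s^k P` at `s = 0`: the boundary value of `P`, the
fourth derivative `P_ssss` (only if `k ≥ 4`), the derivatives `∂_s^j H` with `j ≤ k - 1`, and the
reciprocal of `H₀` (only if `k ≥ 1`), all at `s = 0`. -/
inductive BdrySym (k : ℕ) : Type
  | value : BdrySym k
  | fourth (hk : 4 ≤ k) : BdrySym k
  | derH (j : Fin k) : BdrySym k
  | invH (hk : 1 ≤ k) : BdrySym k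

/-- The functions on the sphere that the symbols denote. -/
def bdryData (k : ℕ) (P H : S2 → ℝ → ℝ) : BdrySym k → S2 → ℝ
  | .value => bdry 0 P
  | .fourth _ => bdry 4 P
  | .derH j => bdry j H
  | .invH _ => fun y => (bdry 0 H y)⁻¹

end NullInfinity

end

open NullInfinity

/-!
The surface is a level set of `F = v + P`, and its mean curvature is a divergence: in the
coordinates `(v, x)` of Schwarzschild spacetime the volume density is constant, so three times the
mean curvature is the coordinate divergence of the unit normal
(`levelMeanCurvature_eq_divergence`). Written in `(y, s)`, the equation of prescribed mean curvature
becomes, after multiplication by `L √L`, an equation all of whose terms extend to `s = 0`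
(`meanCurvature_equation`):

  `3 H L √L = 3 L A + ½ s L_s A - s L A_s - s L ΔP + ½ s ⟨∇L, ∇P⟩`, `A = 1 + s² (1 - 2ms) P_s`.

Everything follows by comparison of Taylor coefficients in `s` at `s = 0`
(`coeff_meanCurvature_equation`), together with the definition of `L` in terms of `P`
(`coeff_jet_Lfun`) and `√L √L = L`. At order zero the equation reads `H₀ L √L = L`, which gives the
alternative for the boundary value of `L`. At orders one, two and three it gives the formulas for
`L_s` and `L_ss`, up to multiples of `H_s` and `H_ss`, and the compatibility condition
(`boundary_relations`). By Taylor's formula, `H - H₀` has order `s²` or `s³` exactly when `H_s`, or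
`H_s` and `H_ss`, vanish at `s = 0` (`OrderS.bdry_eq_zero`, `orderS_of_bdry_eq_zero`).

At order `k` the coefficient of `s^k` in `L` occurs with the factor `(3 - k) / 2`
(`SmoothData.indicial_relation`). So for `k ≠ 3` it is determined by coefficients of lower order and
by `∂_s^j H` with `j ≤ k`, and then so is `∂_s^(k+1) P`; at `k = 3` the factor vanishes, and
`P_ssss` is free. This recursion produces the universal expressions (`expressible_bdry_P`).

Functions on the sphere are differentiated through their extensions constant along rays: with the
Cartesian components `ang i f` of the gradient, `⟨∇f, ∇g⟩ = ∑ ang i f * ang i g` and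
`Δf = ∑ ang i (ang i f)`, and these components commute with `∂_s` up to `s = 0` (`Reg.dS_dX`).
-/

noncomputable section

namespace NullInfinity

open Set Filter Topology Asymptotics
open scoped PowerSeries

/-! ### Calculus on the sphere through extensions constant along rays -/

theorem radial_of_ne {x : E3} (hx : x ≠ 0) : (radial x : E3) = ‖x‖⁻¹ • x := by
  simp [radial, hx]

theorem coe_ne_zero (y : S2) : (y : E3) ≠ 0 := by
  have h := y.2
  intro h0
  simp [h0] at h

theorem norm_coe (y : S2) : ‖(y : E3)‖ = 1 := by simp

theorem radial_coe (y : S2) : radial (y : E3) = y := by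
  apply Subtype.ext
  rw [radial_of_ne (coe_ne_zero y), norm_coe]
  simp

theorem radial_smul (y : S2) {r : ℝ} (hr : 0 < r) : radial (r • (y : E3)) = y := by
  apply Subtype.ext
  rw [radial_of_ne (smul_ne_zero hr.ne' (coe_ne_zero y)), norm_smul, norm_coe, smul_smul]
  simp [abs_of_pos hr, hr.ne']

theorem contMDiffAt_radial {n : ℕ∞ω} {x : E3} (hx : x ≠ 0) :
    ContMDiffAt 𝓘(ℝ, E3) (𝓡 2) n radial x := by
  have : Fact (Module.finrank ℝ E3 = 2 + 1) := ⟨by simp⟩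
  -- Smoothness of a map into the sphere is available for maps on manifolds; here the open
  -- submanifold `x ≠ 0`.
  let V : TopologicalSpace.Opens E3 := ⟨{x | x ≠ 0}, isOpen_ne⟩
  have h : ContMDiff 𝓘(ℝ, E3) 𝓘(ℝ, E3) n (fun x : V => ‖(x : E3)‖⁻¹ • (x : E3)) := by
    intro x
    have hx0 : (x : E3) ≠ 0 := x.2
    refine (contMDiffAt_subtype_iff (f := fun x : E3 => ‖x‖⁻¹ • x)).2 ?_
    refine ContDiffAt.contMDiffAt ?_
    exact ((contDiffAt_norm ℝ hx0).inv (by simpa using hx0)).smul contDiffAt_id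
  have h2 := h.codRestrict_sphere (n := 2) (fun x => by
    have hx0 : (x : E3) ≠ 0 := x.2
    simp [norm_smul, hx0])
  have h3 := h2 ⟨x, hx⟩
  refine (contMDiffAt_subtype_iff (U := V) (x := ⟨x, hx⟩)).1 (h3.congr_of_eventuallyEq ?_)
  filter_upwards with z
  apply Subtype.ext
  simpa using radial_of_ne z.2

theorem continuousAt_radial {x : E3} (hx : x ≠ 0) : ContinuousAt radial x :=
  (contMDiffAt_radial (n := 0) hx).continuousAt

theorem contDiffAt_coe_radial {n : ℕ∞ω} {x : E3} (hx : x ≠ 0) :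
    ContDiffAt ℝ n (fun x => (radial x : E3)) x := by
  have h : ContDiffAt ℝ n (fun x : E3 => ‖x‖⁻¹ • x) x :=
    ((contDiffAt_norm ℝ hx).inv (by simpa using hx)).smul contDiffAt_id
  refine h.congr_of_eventuallyEq ?_
  filter_upwards [isOpen_ne.mem_nhds hx] with z hz using radial_of_ne hz

/-- The open cone over a subset of the sphere. -/
def cone (U : Set S2) : Set E3 := {x | x ≠ 0 ∧ radial x ∈ U}

theorem isOpen_cone {U : Set S2} (hU : IsOpen U) : IsOpen (cone U) := by
  rw [isOpen_iff_mem_nhds]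
  rintro x ⟨hx, hxU⟩
  filter_upwards [isOpen_ne.mem_nhds hx, continuousAt_radial hx (hU.mem_nhds hxU)] with z h1 h2
    using ⟨h1, h2⟩

theorem coe_mem_cone {U : Set S2} {y : S2} (hy : y ∈ U) : (y : E3) ∈ cone U :=
  ⟨coe_ne_zero y, by rwa [radial_coe]⟩

theorem coe_radial_mem_cone {U : Set S2} {x : E3} (hx : x ∈ cone U) : (radial x : E3) ∈ cone U :=
  coe_mem_cone hx.2

/-- The domain of the extension, constant along rays, of a function on `U × [0, s₀)`. -/
def dom (U : Set S2) (s₀ : ℝ) : Set (E3 × ℝ) := cone U ×ˢ Ico 0 s₀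

/-- The extension of a function of `(y, s)` to `E3 × ℝ` that is constant along rays. -/
def lift (φ : S2 → ℝ → ℝ) (p : E3 × ℝ) : ℝ := φ (radial p.1) p.2

/-- The function `φ` has an extension constant along rays that is `C^n` on the cone, up to
`s = 0`. -/
def Reg (n : ℕ∞ω) (U : Set S2) (s₀ : ℝ) (φ : S2 → ℝ → ℝ) : Prop :=
  ContDiffOn ℝ n (lift φ) (dom U s₀)

/-- The derivative in `s` (one-sided at `s = 0`). -/
def dS (φ : S2 → ℝ → ℝ) (y : S2) (s : ℝ) : ℝ := derivWithin (φ y) (Ici 0) s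

/-- The `i`-th Cartesian component of the gradient of a function on the sphere. -/
def ang (i : Fin 3) (f : S2 → ℝ) (y : S2) : ℝ :=
  fderiv ℝ (fun x => f (radial x)) (y : E3) (EuclideanSpace.single i 1)

/-- The `i`-th Cartesian component of the gradient on the sphere, at fixed `s`. -/
def dX (i : Fin 3) (φ : S2 → ℝ → ℝ) (y : S2) (s : ℝ) : ℝ := ang i (fun y' => φ y' s) y

/-- A function of class `C^n` on `U × [0, s₀)` is, through the radial projection, of class `C^n` on
the cone. -/
theorem RegularUpTo.reg {n : ℕ∞ω} {U : Set S2} {s₀ : ℝ} {φ : S2 → ℝ → ℝ}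
    (h : RegularUpTo n U s₀ φ) : Reg n U s₀ φ := by
  have hm : ContMDiffOn 𝓘(ℝ, E3 × ℝ) ((𝓡 2).prod 𝓘(ℝ, ℝ)) n
      (fun p : E3 × ℝ => (radial p.1, p.2)) (dom U s₀) := by
    intro p hp
    refine ContMDiffWithinAt.prodMk ?_ ?_
    · have h1 := contMDiffAt_radial (n := n) hp.1.1
      exact (h1.comp p (contDiff_fst.contMDiff.contMDiffAt)).contMDiffWithinAt
    · exact (contDiff_snd.contMDiff.contMDiffAt).contMDiffWithinAt
  have h2 := ContMDiffOn.comp h hm (fun p hp => ⟨hp.1.2, hp.2⟩)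
  exact contMDiffOn_iff_contDiffOn.1 h2

section
variable {n : ℕ∞ω} {U : Set S2} {s₀ : ℝ} {φ ψ : S2 → ℝ → ℝ}

theorem Reg.of_le {n' : ℕ∞ω} (h : Reg n U s₀ φ) (hn : n' ≤ n) : Reg n' U s₀ φ :=
  ContDiffOn.of_le h hn

theorem uniqueDiffOn_dom (hU : IsOpen U) : UniqueDiffOn ℝ (dom U s₀) :=
  (isOpen_cone hU).uniqueDiffOn.prod (uniqueDiffOn_Ico 0 s₀)

theorem Reg.congr (h : Reg n U s₀ φ) (he : ∀ y ∈ U, ∀ s ∈ Ico 0 s₀, ψ y s = φ y s) :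
    Reg n U s₀ ψ :=
  ContDiffOn.congr h fun _ hp => he _ hp.1.2 _ hp.2

theorem Reg.add (h : Reg n U s₀ φ) (h' : Reg n U s₀ ψ) : Reg n U s₀ (fun y s => φ y s + ψ y s) :=
  ContDiffOn.add h h'

theorem Reg.neg (h : Reg n U s₀ φ) : Reg n U s₀ (fun y s => -φ y s) :=
  ContDiffOn.neg h

theorem Reg.sub (h : Reg n U s₀ φ) (h' : Reg n U s₀ ψ) : Reg n U s₀ (fun y s => φ y s - ψ y s) :=
  ContDiffOn.sub h h'

theorem Reg.mul (h : Reg n U s₀ φ) (h' : Reg n U s₀ ψ) : Reg n U s₀ (fun y s => φ y s * ψ y s) :=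
  ContDiffOn.mul h h'

theorem Reg.sum {ι : Type*} {t : Finset ι} {φ : ι → S2 → ℝ → ℝ} (h : ∀ i ∈ t, Reg n U s₀ (φ i)) :
    Reg n U s₀ (fun y s => ∑ i ∈ t, φ i y s) :=
  ContDiffOn.sum (f := fun i p => lift (φ i) p) h

theorem reg_of_contDiff {f : ℝ → ℝ} (hf : ContDiff ℝ n f) : Reg n U s₀ (fun _ s => f s) :=
  (hf.comp contDiff_snd).contDiffOn

theorem reg_coord (i : Fin 3) : Reg n U s₀ (fun y _ => (y : E3) i) := by
  intro p hp
  have h1 : ContDiffAt ℝ n (fun p : E3 × ℝ => (radial p.1 : E3)) p :=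
    (contDiffAt_coe_radial hp.1.1).comp p contDiffAt_fst
  exact ((contDiffAt_piLp (𝕜 := ℝ) 2).1 h1 i).contDiffWithinAt

theorem nhdsWithin_Ico_eq {s : ℝ} (hs : s ∈ Ico 0 s₀) : 𝓝[Ico 0 s₀] s = 𝓝[Ici 0] s := by
  rw [← Ici_inter_Iio, nhdsWithin_inter_of_mem' (mem_nhdsWithin_of_mem_nhds (Iio_mem_nhds hs.2))]

theorem Reg.hasFDerivWithinAt (h : Reg n U s₀ φ) (hn : 1 ≤ n) {p : E3 × ℝ} (hp : p ∈ dom U s₀) :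
    HasFDerivWithinAt (lift φ) (fderivWithin ℝ (lift φ) (dom U s₀) p) (dom U s₀) p :=
  ((h p hp).differentiableWithinAt (by
    intro h0; rw [h0] at hn; simp at hn)).hasFDerivWithinAt

theorem Reg.hasFDerivAt_slice (hU : IsOpen U) (h : Reg n U s₀ φ) (hn : 1 ≤ n) {x : E3} {s : ℝ}
    (hx : x ∈ cone U) (hs : s ∈ Ico 0 s₀) :
    HasFDerivAt (fun x => φ (radial x) s)
      ((fderivWithin ℝ (lift φ) (dom U s₀) (x, s)).comp (ContinuousLinearMap.inl ℝ E3 ℝ)) x := by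
  have h1 := h.hasFDerivWithinAt hn (p := (x, s)) ⟨hx, hs⟩
  have h2 : HasFDerivWithinAt (fun x : E3 => (x, s)) (ContinuousLinearMap.inl ℝ E3 ℝ) (cone U) x :=
    (hasFDerivAt_prodMk_left x s).hasFDerivWithinAt
  have h3 := h1.comp x h2 (fun z hz => Set.mk_mem_prod hz hs)
  exact h3.hasFDerivAt ((isOpen_cone hU).mem_nhds hx)

theorem Reg.hasDerivWithinAt_slice (h : Reg n U s₀ φ) (hn : 1 ≤ n) {x : E3} {s : ℝ}
    (hx : x ∈ cone U) (hs : s ∈ Ico 0 s₀) :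
    HasDerivWithinAt (φ (radial x)) (fderivWithin ℝ (lift φ) (dom U s₀) (x, s) (0, 1))
      (Ici 0) s := by
  have h1 := h.hasFDerivWithinAt hn (p := (x, s)) ⟨hx, hs⟩
  have h2 : HasDerivWithinAt (fun t : ℝ => (x, t)) ((0 : E3), (1 : ℝ)) (Ico 0 s₀) s :=
    ((hasDerivAt_const s x).prodMk (hasDerivAt_id s)).hasDerivWithinAt
  have h3 := h1.comp_hasDerivWithinAt s h2 (fun z hz => Set.mk_mem_prod hx hz)
  exact h3.mono_of_mem_nhdsWithin (by rw [← nhdsWithin_Ico_eq hs]; exact self_mem_nhdsWithin)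

theorem Reg.hasDerivWithinAt (h : Reg n U s₀ φ) (hn : 1 ≤ n) {y : S2} {s : ℝ}
    (hy : y ∈ U) (hs : s ∈ Ico 0 s₀) : HasDerivWithinAt (φ y) (dS φ y s) (Ici 0) s := by
  have h1 := h.hasDerivWithinAt_slice hn (coe_mem_cone hy) hs
  rw [radial_coe] at h1
  exact h1.differentiableWithinAt.hasDerivWithinAt

theorem Reg.dS_eq (h : Reg n U s₀ φ) (hn : 1 ≤ n) {x : E3} {s : ℝ}
    (hx : x ∈ cone U) (hs : s ∈ Ico 0 s₀) :
    dS φ (radial x) s = fderivWithin ℝ (lift φ) (dom U s₀) (x, s) (0, 1) :=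
  (h.hasDerivWithinAt_slice hn hx hs).derivWithin (uniqueDiffOn_Ici 0 s hs.1)

theorem Reg.dX_eq (hU : IsOpen U) (h : Reg n U s₀ φ) (hn : 1 ≤ n) (i : Fin 3) {y : S2} {s : ℝ}
    (hy : y ∈ U) (hs : s ∈ Ico 0 s₀) :
    dX i φ y s =
      fderivWithin ℝ (lift φ) (dom U s₀) (y, s) (EuclideanSpace.single i 1, 0) := by
  rw [dX, ang, (h.hasFDerivAt_slice hU hn (coe_mem_cone hy) hs).fderiv]
  simp

theorem Reg.reg_dS (hU : IsOpen U) {n m : ℕ∞ω} (h : Reg n U s₀ φ) (hn : m + 1 ≤ n) :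
    Reg m U s₀ (dS φ) := by
  have h1 : ContDiffOn ℝ m (fun p => fderivWithin ℝ (lift φ) (dom U s₀) p (0, 1)) (dom U s₀) :=
    (ContDiffOn.fderivWithin h (uniqueDiffOn_dom hU) hn).clm_apply contDiffOn_const
  exact h1.congr fun p hp => h.dS_eq (le_trans (by simp) hn) hp.1 hp.2

theorem Reg.reg_dX (hU : IsOpen U) {n m : ℕ∞ω} (h : Reg n U s₀ φ) (hn : m + 1 ≤ n) (i : Fin 3) :
    Reg m U s₀ (dX i φ) := by
  have h1 : ContDiffOn ℝ m (fun p => fderivWithin ℝ (lift φ) (dom U s₀) p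
      (EuclideanSpace.single i 1, 0)) (dom U s₀) :=
    (ContDiffOn.fderivWithin h (uniqueDiffOn_dom hU) hn).clm_apply contDiffOn_const
  have h2 : ContDiffOn ℝ m (fun p : E3 × ℝ => ((radial p.1 : E3), p.2)) (dom U s₀) := by
    intro p hp
    exact (((contDiffAt_coe_radial hp.1.1).comp p contDiffAt_fst).prodMk
      contDiffAt_snd).contDiffWithinAt
  refine (h1.comp h2 (fun p hp => ⟨coe_radial_mem_cone hp.1, hp.2⟩)).congr fun p hp => ?_
  exact h.dX_eq hU (le_trans (by simp) hn) i hp.1.2 hp.2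

end

section
variable {n : ℕ∞ω} {U : Set S2} {s₀ : ℝ} {φ ψ : S2 → ℝ → ℝ}

theorem hasFDerivAt_norm {x : E3} (hx : x ≠ 0) :
    HasFDerivAt (fun x : E3 => ‖x‖) (‖x‖⁻¹ • innerSL ℝ x) x := by
  have h3 := (hasStrictFDerivAt_norm_sq x).hasFDerivAt.sqrt (by simpa using hx)
  simp only [Real.sqrt_sq (norm_nonneg _)] at h3
  convert! h3 using 1
  ext v
  simp
  ring

theorem gradInner_eq_sum (f g : S2 → ℝ) (y : S2) :
    gradInner f g y = ∑ i, ang i f y * ang i g y := by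
  have key : ∀ (f : S2 → ℝ) (i : Fin 3), gradient (f ∘ radial) (y : E3) i = ang i f y := by
    intro f i
    have h : inner ℝ (gradient (f ∘ radial) (y : E3)) (EuclideanSpace.single i 1) = ang i f y := by
      simp [gradient, ang, Function.comp_def]
    rw [← h, EuclideanSpace.inner_single_right]
    simp
  rw [gradInner, PiLp.inner_apply]
  refine Finset.sum_congr rfl fun i _ => ?_
  rw [key, key]
  simp [mul_comm]

theorem radial_smul_of_pos (x : E3) {c : ℝ} (hc : 0 < c) : radial (c • x) = radial x := by
  by_cases hx : x = 0
  · simp [hx]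
  · apply Subtype.ext
    rw [radial_of_ne hx, radial_of_ne (smul_ne_zero hc.ne' hx), norm_smul, smul_smul,
      Real.norm_of_nonneg hc.le]
    congr 1
    field_simp

/-- The differential of an extension constant along rays is homogeneous of degree `-1`. -/
theorem fderiv_comp_radial_smul (f : S2 → ℝ) (x : E3) {c : ℝ} (hc : 0 < c) :
    fderiv ℝ (fun x => f (radial x)) x = c • fderiv ℝ (fun x => f (radial x)) (c • x) := by
  conv_lhs => rw [show (fun x : E3 => f (radial x)) = fun x => (fun x => f (radial x)) (c • x) by
    ext x; simp only [radial_smul_of_pos x hc]]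
  exact fderiv_comp_smul (f := fun x : E3 => f (radial x)) c

/-- Euler's identity for the extension constant along rays. -/
theorem sum_coord_mul_ang (f : S2 → ℝ) (y : S2) : ∑ i, (y : E3) i * ang i f y = 0 := by
  -- Without differentiability the differential is zero by convention.
  have h1 : fderiv ℝ (fun x => f (radial x)) (y : E3) (y : E3) = 0 := by
    by_cases hd : DifferentiableAt ℝ (fun x : E3 => f (radial x)) (y : E3)
    · have h2 : HasDerivAt (fun t : ℝ => t • (y : E3)) ((1 : ℝ) • (y : E3)) 1 :=
        (hasDerivAt_id (1 : ℝ)).smul_const (y : E3)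
      have hd' : HasFDerivAt (fun x : E3 => f (radial x))
          (fderiv ℝ (fun x => f (radial x)) (y : E3)) ((1 : ℝ) • (y : E3)) := by
        rw [one_smul]; exact hd.hasFDerivAt
      have h3 := hd'.comp_hasDerivAt (1 : ℝ) h2
      rw [one_smul] at h3
      have h4 : HasDerivAt (fun _ : ℝ => f y) 0 (1 : ℝ) := hasDerivAt_const _ _
      refine h3.unique (h4.congr_of_eventuallyEq ?_)
      filter_upwards [lt_mem_nhds (show (0 : ℝ) < 1 by norm_num)] with t ht
      simp [radial_smul_of_pos _ ht, radial_coe]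
    · rw [fderiv_zero_of_not_differentiableAt hd]; rfl
  have h5 : (y : E3) = ∑ i, (y : E3) i • EuclideanSpace.single i (1 : ℝ) := by
    ext j
    simp [Pi.single_apply]
  have h6 := congrArg (fderiv ℝ (fun x => f (radial x)) (y : E3)) h5
  rw [h1, map_sum] at h6
  rw [h6]
  simp [ang]

theorem sum_coord_sq (y : S2) : ∑ i, (y : E3) i * (y : E3) i = 1 := by
  have h := norm_coe y
  rw [EuclideanSpace.norm_eq, Real.sqrt_eq_one] at h
  simpa [← sq] using h

theorem ang_congr {f g : S2 → ℝ} (hU : IsOpen U) (h : ∀ y ∈ U, f y = g y) (i : Fin 3) {y : S2}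
    (hy : y ∈ U) : ang i f y = ang i g y := by
  have : (fun x => f (radial x)) =ᶠ[𝓝 (y : E3)] fun x => g (radial x) := by
    filter_upwards [(isOpen_cone hU).mem_nhds (coe_mem_cone hy)] with x hx using h _ hx.2
  rw [ang, ang, this.fderiv_eq]

theorem gradInner_congr {f g f' g' : S2 → ℝ} (hU : IsOpen U) (h : ∀ y ∈ U, f y = f' y)
    (h' : ∀ y ∈ U, g y = g' y) {y : S2} (hy : y ∈ U) : gradInner f g y = gradInner f' g' y := by
  simp only [gradInner_eq_sum]
  exact Finset.sum_congr rfl fun i _ => by rw [ang_congr hU h i hy, ang_congr hU h' i hy]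

theorem sphereLap_congr {f g : S2 → ℝ} (hU : IsOpen U) (h : ∀ y ∈ U, f y = g y) {y : S2}
    (hy : y ∈ U) : sphereLap f y = sphereLap g y := by
  have : f ∘ radial =ᶠ[𝓝 (y : E3)] g ∘ radial := by
    filter_upwards [(isOpen_cone hU).mem_nhds (coe_mem_cone hy)] with x hx using h _ hx.2
  exact (InnerProductSpace.laplacian_congr_nhds this).eq_of_nhds

theorem dS_congr (h : ∀ y ∈ U, ∀ s ∈ Ico 0 s₀, φ y s = ψ y s) {y : S2}
    (hy : y ∈ U) {s : ℝ} (hs : s ∈ Ico 0 s₀) : dS φ y s = dS ψ y s := by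
  refine Filter.EventuallyEq.derivWithin_eq ?_ (h y hy s hs)
  rw [← nhdsWithin_Ico_eq hs]
  filter_upwards [self_mem_nhdsWithin] with t ht using h y hy t ht

theorem Reg.contDiffAt_slice (hU : IsOpen U) (h : Reg n U s₀ φ) {x : E3} {s : ℝ}
    (hx : x ∈ cone U) (hs : s ∈ Ico 0 s₀) : ContDiffAt ℝ n (fun x => φ (radial x) s) x := by
  have h1 : ContDiffOn ℝ n (fun x : E3 => (x, s)) (cone U) :=
    (contDiff_id.prodMk contDiff_const).contDiffOn
  exact (ContDiffOn.comp h h1 (fun z hz => Set.mk_mem_prod hz hs)).contDiffAt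
    ((isOpen_cone hU).mem_nhds hx)

/-- The Laplacian of the sphere is the sum of the squares of the Cartesian components of the
gradient. -/
theorem sphereLap_eq_sum {f : S2 → ℝ} {y : S2}
    (hf : ContDiffAt ℝ 2 (fun x => f (radial x)) (y : E3)) :
    sphereLap f y = ∑ i, ang i (ang i f) y := by
  set F : E3 → ℝ := fun x => f (radial x) with hF
  have hd : DifferentiableAt ℝ (fderiv ℝ F) (y : E3) :=
    (hf.fderiv_right (m := 1) (by norm_num)).differentiableAt (by simp)
  -- `ang i f` is constant along rays and `∂_i F` is homogeneous of degree `-1`.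
  have hnear : ∀ i : Fin 3, (fun x => ang i f (radial x)) =ᶠ[𝓝 (y : E3)]
      fun x => ‖x‖ * fderiv ℝ F x (EuclideanSpace.single i 1) := by
    intro i
    filter_upwards [isOpen_ne.mem_nhds (coe_ne_zero y)] with x hx
    have hx' : 0 < ‖x‖ := norm_pos_iff.2 hx
    rw [ang, fderiv_comp_radial_smul f x (inv_pos.2 hx'), radial_of_ne hx]
    simp only [smul_apply, smul_eq_mul]
    rw [mul_inv_cancel_left₀ hx'.ne']
  have hang : ∀ i : Fin 3, ang i (ang i f) y =
      (y : E3) i * ang i f y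
        + fderiv ℝ (fderiv ℝ F) (y : E3) (EuclideanSpace.single i 1)
          (EuclideanSpace.single i 1) := by
    intro i
    have h1 : HasFDerivAt (fun x : E3 => fderiv ℝ F x (EuclideanSpace.single i 1)) _ (y : E3) :=
      hd.hasFDerivAt.clm_apply (hasFDerivAt_const _ _)
    have h2 : HasFDerivAt (fun x : E3 => ‖x‖) (innerSL ℝ (y : E3)) (y : E3) := by
      simpa using hasFDerivAt_norm (coe_ne_zero y)
    have h3 : HasFDerivAt (fun x : E3 => ‖x‖ * fderiv ℝ F x (EuclideanSpace.single i 1)) _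
      (y : E3) := h2.mul h1
    rw [ang, (hnear i).fderiv_eq, h3.fderiv]
    simp [ang, hF, EuclideanSpace.inner_single_right]
    ring
  rw [sphereLap, InnerProductSpace.laplacian_eq_iteratedFDeriv_orthonormalBasis _
    (EuclideanSpace.basisFun (Fin 3) ℝ)]
  simp only [hang, Finset.sum_add_distrib, sum_coord_mul_ang, zero_add]
  refine Finset.sum_congr rfl fun i _ => ?_
  rw [iteratedFDeriv_two_apply]
  simp [hF, Function.comp_def]

theorem gradInner_slice_eq (φ ψ : S2 → ℝ → ℝ) (y : S2) (s : ℝ) :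
    gradInner (fun y' => φ y' s) (fun y' => ψ y' s) y
      = ∑ i, dX i φ y s * dX i ψ y s :=
  gradInner_eq_sum _ _ _

theorem Reg.sphereLap_eq (hU : IsOpen U) (h : Reg n U s₀ φ) (hn : 2 ≤ n) {y : S2} (hy : y ∈ U)
    {s : ℝ} (hs : s ∈ Ico 0 s₀) :
    sphereLap (fun y' => φ y' s) y = ∑ i, dX i (dX i φ) y s :=
  sphereLap_eq_sum ((h.of_le hn).contDiffAt_slice hU (coe_mem_cone hy) hs)

theorem dom_subset_closure_interior (hU : IsOpen U) :
    dom U s₀ ⊆ closure (interior (dom U s₀)) := by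
  rintro ⟨x, s⟩ ⟨hx, hs⟩
  rw [dom, interior_prod_eq, closure_prod_eq, interior_Ico, (isOpen_cone hU).interior_eq,
    closure_Ioo (ne_of_lt (lt_of_le_of_lt hs.1 hs.2))]
  exact ⟨subset_closure hx, Ico_subset_Icc_self hs⟩

/-- The derivative in `s` commutes with the angular derivatives, up to `s = 0`. -/
theorem Reg.dS_dX (hU : IsOpen U) (h : Reg n U s₀ φ) (hn : 2 ≤ n) (i : Fin 3) {y : S2}
    (hy : y ∈ U) {s : ℝ} (hs : s ∈ Ico 0 s₀) :
    dS (dX i φ) y s = dX i (dS φ) y s := by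
  have h2 : Reg 2 U s₀ φ := h.of_le hn
  have hp : ((y : E3), s) ∈ dom U s₀ := ⟨coe_mem_cone hy, hs⟩
  have hsymm := (h2 _ hp).isSymmSndFDerivWithinAt (by simp) (uniqueDiffOn_dom hU)
    (dom_subset_closure_interior hU hp) hp
  have hd : DifferentiableWithinAt ℝ (fderivWithin ℝ (lift φ) (dom U s₀)) (dom U s₀) ((y : E3), s) :=
    (ContDiffOn.fderivWithin (m := 1) h2 (uniqueDiffOn_dom hU) (by norm_num)
      _ hp).differentiableWithinAt (by simp)
  have hfd := hd.hasFDerivWithinAt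
  set B := fderivWithin ℝ (fderivWithin ℝ (lift φ) (dom U s₀)) (dom U s₀) ((y : E3), s) with hB
  have e1 : dS (dX i φ) y s
      = B (0, 1) (EuclideanSpace.single i 1, 0) := by
    have h3 : HasDerivWithinAt (fun t : ℝ => ((y : E3), t)) ((0 : E3), (1 : ℝ)) (Ico 0 s₀) s :=
      ((hasDerivAt_const s (y : E3)).prodMk (hasDerivAt_id s)).hasDerivWithinAt
    have h4 := hfd.comp_hasDerivWithinAt s h3 (fun z hz => Set.mk_mem_prod (coe_mem_cone hy) hz)
    have h5 := h4.clm_apply (hasDerivWithinAt_const s (Ico 0 s₀)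
      ((EuclideanSpace.single i (1 : ℝ) : E3), (0 : ℝ)))
    have h6 : HasDerivWithinAt (dX i φ y)
        (B (0, 1) (EuclideanSpace.single i 1, 0)) (Ico 0 s₀) s := by
      refine HasDerivWithinAt.congr (by simpa using h5) (fun t ht => ?_) ?_
      · exact h2.dX_eq hU (by norm_num) i hy ht
      · exact h2.dX_eq hU (by norm_num) i hy hs
    refine (h6.mono_of_mem_nhdsWithin ?_).derivWithin (uniqueDiffOn_Ici 0 s hs.1)
    rw [← nhdsWithin_Ico_eq hs]; exact self_mem_nhdsWithin
  have e2 : dX i (dS φ) y s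
      = B (EuclideanSpace.single i 1, 0) (0, 1) := by
    have h3 : HasFDerivWithinAt (fun x : E3 => (x, s)) (ContinuousLinearMap.inl ℝ E3 ℝ) (cone U)
        (y : E3) := (hasFDerivAt_prodMk_left (y : E3) s).hasFDerivWithinAt
    have h4 := hfd.comp (y : E3) h3 (fun z hz => Set.mk_mem_prod hz hs)
    have h5 := h4.clm_apply (hasFDerivWithinAt_const ((0 : E3), (1 : ℝ)) (y : E3) (cone U))
    have h6 := (h5.congr (f₁ := fun x => dS φ (radial x) s)
      (fun x hx => h2.dS_eq (by norm_num) hx hs)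
      (h2.dS_eq (by norm_num) (coe_mem_cone hy) hs)).hasFDerivAt
        ((isOpen_cone hU).mem_nhds (coe_mem_cone hy))
    rw [dX, ang, h6.fderiv]
    simp
  rw [e1, e2, hsymm.eq]

/-! ### Derivatives at `s = 0` -/

theorem iterate_dS (k : ℕ) (φ : S2 → ℝ → ℝ) (y : S2) :
    (dS^[k] φ) y = iteratedDerivWithin k (φ y) (Ici 0) := by
  induction k with
  | zero => ext s; simp
  | succ k ih =>
    rw [Function.iterate_succ_apply', iteratedDerivWithin_succ, ← ih]
    rfl

theorem bdry_eq (k : ℕ) (φ : S2 → ℝ → ℝ) (y : S2) : bdry k φ y = (dS^[k] φ) y 0 := by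
  rw [iterate_dS, bdry]

theorem bdry_zero (φ : S2 → ℝ → ℝ) (y : S2) : bdry 0 φ y = φ y 0 := by
  rw [bdry_eq]; rfl

theorem bdry_succ (k : ℕ) (φ : S2 → ℝ → ℝ) (y : S2) : bdry (k + 1) φ y = bdry k (dS φ) y := by
  rw [bdry_eq, bdry_eq, Function.iterate_succ_apply]

theorem Reg.reg_iterate_dS (hU : IsOpen U) {m : ℕ∞ω} (k : ℕ) (h : Reg n U s₀ φ) (hn : m + k ≤ n) :
    Reg m U s₀ (dS^[k] φ) := by
  induction k generalizing m with
  | zero => exact h.of_le (by simpa using hn)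
  | succ k ih =>
    rw [Function.iterate_succ_apply']
    refine (ih (m := m + 1) ?_).reg_dS hU le_rfl
    rw [add_assoc, add_comm 1]
    exact_mod_cast hn

theorem Reg.iterate_dS_dX (hU : IsOpen U) (k : ℕ) (h : Reg n U s₀ φ)
    (hn : (k : ℕ∞ω) + 1 ≤ n) (i : Fin 3) :
    ∀ y ∈ U, ∀ s ∈ Ico 0 s₀, (dS^[k] (dX i φ)) y s
      = dX i (dS^[k] φ) y s := by
  induction k with
  | zero => intro y _ s _; rfl
  | succ k ih =>
    intro y hy s hs
    have hk : (k : ℕ∞ω) + 1 ≤ n := le_trans (by push_cast; exact le_self_add) hn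
    rw [Function.iterate_succ_apply', dS_congr (ih hk) hy hs, Function.iterate_succ_apply']
    refine Reg.dS_dX hU (n := 2) (h.reg_iterate_dS hU k ?_) le_rfl i hy hs
    refine le_trans (le_of_eq ?_) hn
    push_cast
    rw [add_assoc, one_add_one_eq_two, add_comm]

theorem Reg.bdry_dX (hU : IsOpen U) (hs₀ : 0 < s₀) (k : ℕ) (h : Reg n U s₀ φ)
    (hn : (k : ℕ∞ω) + 1 ≤ n) (i : Fin 3) {y : S2} (hy : y ∈ U) :
    bdry k (dX i φ) y = ang i (bdry k φ) y := by
  rw [bdry_eq, h.iterate_dS_dX hU k hn i y hy 0 ⟨le_rfl, hs₀⟩, dX]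
  congr 1
  ext y'
  rw [bdry_eq]

end

/-! ### The mean curvature as a divergence -/

section

theorem pd_congr {f g : (Fin 4 → ℝ) → ℝ} {z : Fin 4 → ℝ} (h : f =ᶠ[𝓝 z] g) (a : Fin 4) :
    pd a f z = pd a g z := by
  rw [pd, pd, h.fderiv_eq]

theorem pd_const (a : Fin 4) (c : ℝ) (z : Fin 4 → ℝ) : pd a (fun _ => c) z = 0 := by
  simp [pd]

theorem pd_mul {f g : (Fin 4 → ℝ) → ℝ} {z : Fin 4 → ℝ} (hf : DifferentiableAt ℝ f z)
    (hg : DifferentiableAt ℝ g z) (a : Fin 4) :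
    pd a (fun w => f w * g w) z = pd a f z * g z + f z * pd a g z := by
  rw [pd, fderiv_fun_mul hf hg]
  simp [pd]
  ring

theorem pd_sum {ι : Type*} {t : Finset ι} {f : ι → (Fin 4 → ℝ) → ℝ} {z : Fin 4 → ℝ}
    (hf : ∀ i ∈ t, DifferentiableAt ℝ (f i) z) (a : Fin 4) :
    pd a (fun w => ∑ i ∈ t, f i w) z = ∑ i ∈ t, pd a (f i) z := by
  rw [pd, fderiv_fun_sum hf]
  simp [pd]

theorem pd_sub {f g : (Fin 4 → ℝ) → ℝ} {z : Fin 4 → ℝ} (hf : DifferentiableAt ℝ f z)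
    (hg : DifferentiableAt ℝ g z) (a : Fin 4) :
    pd a (fun w => f w - g w) z = pd a f z - pd a g z := by
  rw [pd, fderiv_fun_sub hf hg]
  simp [pd]

theorem pd_div_sqrt {f q : (Fin 4 → ℝ) → ℝ} {z : Fin 4 → ℝ} (hf : DifferentiableAt ℝ f z)
    (hq : DifferentiableAt ℝ q z) (h0 : 0 < q z) (a : Fin 4) :
    pd a (fun w => f w / Real.sqrt (q w)) z
      = pd a f z / Real.sqrt (q z) - f z * pd a q z / (2 * Real.sqrt (q z) ^ 3) := by
  have hs : 0 < Real.sqrt (q z) := Real.sqrt_pos.2 h0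
  have h1 := hq.hasFDerivAt.sqrt h0.ne'
  have h2 := hf.hasFDerivAt.mul ((hasDerivAt_inv hs.ne').comp_hasFDerivAt z h1)
  have h3 : HasFDerivAt (fun w => f w / Real.sqrt (q w)) _ z :=
    h2.congr_of_eventuallyEq (Eventually.of_forall fun w => div_eq_mul_inv _ _)
  rw [pd, h3.fderiv]
  simp [pd]
  field_simp
  ring

variable {g G : (Fin 4 → ℝ) → Matrix (Fin 4) (Fin 4) ℝ} {F : (Fin 4 → ℝ) → ℝ} {z : Fin 4 → ℝ}

/-- The algebra behind the divergence formula: `G` is the inverse metric, `M d` and `DG d` are the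
`d`-th partial derivatives of the metric and of the inverse metric, `n` and `N` are the normal
covector and vector, and `dn a b = ∂_a n_b`. -/
theorem trace_secondForm_algebra (G : Matrix (Fin 4) (Fin 4) ℝ)
    (M DG : Fin 4 → Matrix (Fin 4) (Fin 4) ℝ) (n N : Fin 4 → ℝ) (dn : Fin 4 → Fin 4 → ℝ)
    (hG : ∀ a b, G a b = G b a)
    (hDG : ∀ d, DG d = -(G * M d * G)) (hN : ∀ a, N a = ∑ b, G a b * n b)
    (hnorm : ∀ d, ∑ a, ∑ b, (DG d a b * n a * n b + G a b * dn d a * n b + G a b * n a * dn d b)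
      = 0)
    (htr : ∀ d, ∑ a, ∑ b, G a b * M d a b = 0) :
    ∑ a, ∑ b, (G a b + N a * N b) *
        (dn a b - ∑ c, (1 / 2 * ∑ d, G c d * (M a b d + M b a d - M d a b)) * n c)
      = ∑ a, ∑ b, (DG a a b * n b + G a b * dn a b) := by
  -- The Christoffel term with its upper index lowered.
  have hΓ : ∀ a b, ∑ c, (1 / 2 * ∑ d, G c d * (M a b d + M b a d - M d a b)) * n c
      = 1 / 2 * ∑ d, N d * (M a b d + M b a d - M d a b) := by
    intro a b
    simp only [hN, Finset.mul_sum, Finset.sum_mul]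
    rw [Finset.sum_comm]
    refine Finset.sum_congr rfl fun d _ => Finset.sum_congr rfl fun c _ => ?_
    rw [hG d c]; ring
  have hDGn : ∀ d a, ∑ b, DG d a b * n b = -∑ c, ∑ e, G a c * M d c e * N e := by
    intro d a
    rw [hDG]
    simp only [Matrix.neg_apply, Matrix.mul_apply, hN, Finset.mul_sum, Finset.sum_mul, neg_mul,
      Finset.sum_neg_distrib]
    congr 1
    rw [Finset.sum_comm_cycle]
    refine Finset.sum_congr rfl fun c _ => ?_
    rw [Finset.sum_comm]
    exact Finset.sum_congr rfl fun e _ => Finset.sum_congr rfl fun b _ => by ring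
  -- Differentiation of `G^{ab} n_a n_b = -1`.
  have hnN : ∀ d, 2 * ∑ a, N a * dn d a = ∑ a, ∑ b, N a * N b * M d a b := by
    intro d
    have h := hnorm d
    simp only [Finset.sum_add_distrib] at h
    have h1 : ∑ a, ∑ b, DG d a b * n a * n b = -∑ a, ∑ b, N a * N b * M d a b := by
      have : ∀ a, ∑ b, DG d a b * n a * n b = n a * ∑ b, DG d a b * n b := by
        intro a; rw [Finset.mul_sum]; exact Finset.sum_congr rfl fun b _ => by ring
      simp only [this, hDGn, mul_neg, Finset.sum_neg_distrib]
      congr 1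
      have h4 : ∀ a, n a * ∑ c, ∑ e, G a c * M d c e * N e
          = ∑ c, ∑ e, G c a * n a * N e * M d c e := by
        intro a
        simp only [Finset.mul_sum]
        refine Finset.sum_congr rfl fun c _ => Finset.sum_congr rfl fun e _ => ?_
        rw [hG a c]; ring
      simp only [h4]
      rw [Finset.sum_comm]
      refine Finset.sum_congr rfl fun c _ => ?_
      rw [Finset.sum_comm]
      refine Finset.sum_congr rfl fun e _ => ?_
      rw [hN c]
      simp only [Finset.sum_mul]
    have h2 : ∑ a, ∑ b, G a b * dn d a * n b = ∑ a, N a * dn d a := by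
      refine Finset.sum_congr rfl fun a _ => ?_
      rw [hN, Finset.sum_mul]
      exact Finset.sum_congr rfl fun b _ => by ring
    have h3 : ∑ a, ∑ b, G a b * n a * dn d b = ∑ a, N a * dn d a := by
      rw [Finset.sum_comm]
      refine Finset.sum_congr rfl fun a _ => ?_
      rw [hN, Finset.sum_mul]
      exact Finset.sum_congr rfl fun b _ => by rw [hG a b]
    rw [h1, h2, h3] at h
    linarith
  -- `N^a N^b ∇_a n_b = 0`.
  have hNNdn : 2 * ∑ a, ∑ b, N a * N b * dn a b
      = ∑ a, ∑ b, ∑ c, N a * N b * N c * M a b c := by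
    rw [Finset.mul_sum]
    refine Finset.sum_congr rfl fun a _ => ?_
    have h := congrArg (N a * ·) (hnN a)
    simp only [Finset.mul_sum] at h ⊢
    convert h using 2 with b _ b _
    · ring
    · exact Finset.sum_congr rfl fun c _ => by ring
  have hNNΓ : ∑ a, ∑ b, N a * N b * ∑ d, N d * (M a b d + M b a d - M d a b)
      = ∑ a, ∑ b, ∑ c, N a * N b * N c * M a b c := by
    simp only [Fin.sum_univ_four]; ring
  have hGΓ : ∑ a, ∑ b, G a b * ∑ d, N d * (M a b d + M b a d - M d a b)
      = 2 * ∑ a, ∑ b, ∑ d, G a b * M a b d * N d := by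
    have h1 : ∑ a, ∑ b, G a b * ∑ d, N d * (M a b d + M b a d - M d a b)
        = ∑ a, ∑ b, ∑ d, G a b * M a b d * N d + ∑ a, ∑ b, ∑ d, G b a * M b a d * N d
          - ∑ a, ∑ b, ∑ d, N d * (G a b * M d a b) := by
      simp only [← Finset.sum_add_distrib, ← Finset.sum_sub_distrib, Finset.mul_sum]
      refine Finset.sum_congr rfl fun a _ => Finset.sum_congr rfl fun b _ =>
        Finset.sum_congr rfl fun d _ => ?_
      rw [hG b a]; ring
    have h2 : ∑ a, ∑ b, ∑ d, N d * (G a b * M d a b) = 0 := by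
      rw [Finset.sum_comm_cycle]
      refine Finset.sum_eq_zero fun d _ => ?_
      simp only [← Finset.mul_sum]
      rw [htr, mul_zero]
    have h3 : ∑ a, ∑ b, ∑ d, G b a * M b a d * N d = ∑ a, ∑ b, ∑ d, G a b * M a b d * N d :=
      Finset.sum_comm
    rw [h1, h2, h3]; ring
  have hL : ∑ a, ∑ b, (G a b + N a * N b) *
        (dn a b - ∑ c, (1 / 2 * ∑ d, G c d * (M a b d + M b a d - M d a b)) * n c)
      = ∑ a, ∑ b, G a b * dn a b + ∑ a, ∑ b, N a * N b * dn a b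
        - 1 / 2 * ∑ a, ∑ b, G a b * ∑ d, N d * (M a b d + M b a d - M d a b)
        - 1 / 2 * ∑ a, ∑ b, N a * N b * ∑ d, N d * (M a b d + M b a d - M d a b) := by
    simp only [hΓ]
    rw [Finset.mul_sum, Finset.mul_sum]
    rw [← Finset.sum_add_distrib, ← Finset.sum_sub_distrib, ← Finset.sum_sub_distrib]
    refine Finset.sum_congr rfl fun a _ => ?_
    rw [Finset.mul_sum, Finset.mul_sum]
    simp only [← Finset.sum_add_distrib, ← Finset.sum_sub_distrib]
    refine Finset.sum_congr rfl fun b _ => ?_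
    ring
  rw [hL, hNNΓ, hGΓ, ← hNNdn]
  simp only [Finset.sum_add_distrib, hDGn, Finset.sum_neg_distrib]
  ring

/-- If `G` is the inverse metric and the trace of `G ∂_d g` vanishes, that is, if the volume density
is constant, then three times the mean curvature of a spacelike level set is the coordinate
divergence of its unit normal. -/
theorem levelMeanCurvature_eq_divergence
    (hinv : ∀ᶠ w in 𝓝 z, g w * G w = 1)
    (hGsymm : ∀ a b, G z a b = G z b a)
    (hg : ∀ a b, DifferentiableAt ℝ (fun w => g w a b) z)
    (hG : ∀ a b, DifferentiableAt ℝ (fun w => G w a b) z)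
    (hn : ∀ b, DifferentiableAt ℝ (conormal g F b) z)
    (hnorm : ∀ᶠ w in 𝓝 z, ∑ a, ∑ b, G w a b * conormal g F a w * conormal g F b w = -1)
    (htr : ∀ d, ∑ a, ∑ b, G z a b * pd d (fun w => g w a b) z = 0) :
    levelMeanCurvature g F z
      = 1 / 3 * ∑ a, pd a (fun w => ∑ b, G w a b * conormal g F b w) z := by
  have hinvz : (g z)⁻¹ = G z := Matrix.inv_eq_right_inv hinv.self_of_nhds
  have hDG : ∀ d, Matrix.of (fun a b => pd d (fun w => G w a b) z)
      = -(G z * Matrix.of (fun a b => pd d (fun w => g w a b) z) * G z) := by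
    intro d
    have h1 : Matrix.of (fun a b => pd d (fun w => g w a b) z) * G z
        + g z * Matrix.of (fun a b => pd d (fun w => G w a b) z) = 0 := by
      ext a b
      have h2 : (fun w => ∑ c, g w a c * G w c b) =ᶠ[𝓝 z]
          fun _ => (1 : Matrix (Fin 4) (Fin 4) ℝ) a b := by
        filter_upwards [hinv] with w hw
        rw [← hw, Matrix.mul_apply]
      have h3 := pd_congr h2 d
      rw [pd_const, pd_sum fun c _ => (hg a c).fun_mul (hG c b)] at h3
      simp only [pd_mul (hg a _) (hG _ b)] at h3
      rw [Finset.sum_add_distrib] at h3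
      simpa [Matrix.mul_apply] using h3
    have h4 : G z * g z = 1 := mul_eq_one_comm.1 hinv.self_of_nhds
    have h5 := congrArg (G z * ·) h1
    simp only [mul_add, mul_zero, ← mul_assoc, h4, one_mul] at h5
    exact eq_neg_of_add_eq_zero_right h5
  have hdnorm : ∀ d, ∑ a, ∑ b, (pd d (fun w => G w a b) z * conormal g F a z * conormal g F b z
      + G z a b * pd d (conormal g F a) z * conormal g F b z
      + G z a b * conormal g F a z * pd d (conormal g F b) z) = 0 := by
    intro d
    have h := pd_congr (g := fun _ => (-1 : ℝ)) hnorm d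
    rw [pd_const, pd_sum fun a _ => DifferentiableAt.fun_sum fun b _ =>
      ((hG a b).fun_mul (hn a)).fun_mul (hn b)] at h
    rw [← h]
    refine Finset.sum_congr rfl fun a _ => ?_
    rw [pd_sum fun b _ => ((hG a b).fun_mul (hn a)).fun_mul (hn b)]
    refine Finset.sum_congr rfl fun b _ => ?_
    rw [pd_mul ((hG a b).fun_mul (hn a)) (hn b), pd_mul (hG a b) (hn a)]
    ring
  have main := trace_secondForm_algebra (G z)
    (fun d => Matrix.of (fun a b => pd d (fun w => g w a b) z))
    (fun d => Matrix.of (fun a b => pd d (fun w => G w a b) z))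
    (fun b => conormal g F b z) (fun a => unitNormal g F a z)
    (fun a b => pd a (conormal g F b) z) hGsymm hDG
    (fun a => by rw [unitNormal, hinvz]) hdnorm htr
  rw [levelMeanCurvature]
  simp only [secondForm, christoffel, hinvz]
  simp only [Matrix.of_apply] at main
  rw [main]
  congr 1
  refine Finset.sum_congr rfl fun a _ => ?_
  rw [pd_sum fun b _ => (hG a b).fun_mul (hn b)]
  refine Finset.sum_congr rfl fun b _ => ?_
  rw [pd_mul (hG a b) (hn b)]

end

/-! ### Partial derivatives in the coordinates `(v, x)` -/

section
variable {n : ℕ∞ω} {U : Set S2} {s₀ : ℝ} {φ ψ : S2 → ℝ → ℝ}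

/-- The function on spacetime, independent of `v`, that a function of `(y, s)` defines. -/
def hat (φ : S2 → ℝ → ℝ) (z : Fin 4 → ℝ) : ℝ := φ (radial (space z)) ‖space z‖⁻¹

/-- The region of spacetime over `U × (0, s₀)`. -/
def region (U : Set S2) (s₀ : ℝ) : Set (Fin 4 → ℝ) :=
  {z | space z ∈ cone U ∧ ‖space z‖⁻¹ < s₀}

/-- The projection `(v, x) ↦ x` as a continuous linear map. -/
def spaceL : (Fin 4 → ℝ) →L[ℝ] E3 :=
  ((EuclideanSpace.equiv (Fin 3) ℝ).symm : (Fin 3 → ℝ) →L[ℝ] E3).comp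
    (ContinuousLinearMap.pi fun i => ContinuousLinearMap.proj i.succ)

theorem spaceL_apply (z : Fin 4 → ℝ) : spaceL z = space z := rfl

theorem continuous_space : Continuous space := spaceL.continuous

theorem space_single_zero (c : ℝ) : space (Pi.single 0 c) = 0 := by
  ext i; simp [space]

theorem space_single_succ (i : Fin 3) (c : ℝ) :
    space (Pi.single i.succ c) = EuclideanSpace.single i c := by
  ext j; simp [space, Pi.single_apply]

theorem inv_norm_mem {z : Fin 4 → ℝ} (hz : z ∈ region U s₀) : ‖space z‖⁻¹ ∈ Ioo 0 s₀ :=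
  ⟨inv_pos.2 (norm_pos_iff.2 hz.1.1), hz.2⟩

theorem isOpen_region (hU : IsOpen U) : IsOpen (region U s₀) := by
  rw [isOpen_iff_mem_nhds]
  rintro z ⟨h1, h2⟩
  have hc : ContinuousAt (fun z => ‖space z‖⁻¹) z :=
    (continuous_space.norm.continuousAt).inv₀ (norm_ne_zero_iff.2 h1.1)
  filter_upwards [continuous_space.continuousAt ((isOpen_cone hU).mem_nhds h1),
    hc (Iio_mem_nhds h2)] with w h3 h4 using ⟨h3, h4⟩

/-- The differential of `hat φ`: in spherical coordinates `∂_r = -s² ∂_s`, and angular derivatives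
at the radius `1 / s` are `s` times those on the unit sphere. -/
theorem Reg.hasFDerivAt_hat (hU : IsOpen U) (h : Reg n U s₀ φ) (hn : 1 ≤ n) {z : Fin 4 → ℝ}
    (hz : z ∈ region U s₀) :
    ∃ A : (Fin 4 → ℝ) →L[ℝ] ℝ, HasFDerivAt (hat φ) A z ∧ A (Pi.single 0 1) = 0 ∧
      ∀ i : Fin 3, A (Pi.single i.succ 1) =
        ‖space z‖⁻¹ * dX i φ (radial (space z)) ‖space z‖⁻¹
          - ‖space z‖⁻¹ ^ 2 * (radial (space z) : E3) i
            * dS φ (radial (space z)) ‖space z‖⁻¹ := by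
  set x := space z with hx
  have hx0 : x ≠ 0 := hz.1.1
  have hr : 0 < ‖x‖ := norm_pos_iff.2 hx0
  have hs : ‖x‖⁻¹ ∈ Ico 0 s₀ := Ioo_subset_Ico_self (inv_norm_mem hz)
  have hdom : dom U s₀ ∈ 𝓝 (x, ‖x‖⁻¹) :=
    prod_mem_nhds ((isOpen_cone hU).mem_nhds hz.1) (Ico_mem_nhds (inv_pos.2 hr) hz.2)
  have h1 := (h.hasFDerivWithinAt hn (p := (x, ‖x‖⁻¹)) ⟨hz.1, hs⟩).hasFDerivAt hdom
  set B := fderivWithin ℝ (lift φ) (dom U s₀) (x, ‖x‖⁻¹) with hB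
  have hsp : HasFDerivAt space spaceL z := spaceL.hasFDerivAt
  have hnorm := hasFDerivAt_norm hx0
  have hinv : HasFDerivAt (fun z => ‖space z‖⁻¹) _ z :=
    (hasDerivAt_inv hr.ne').comp_hasFDerivAt z (hnorm.comp z hsp)
  have hpair := hsp.prodMk hinv
  have hcomp : HasFDerivAt (lift φ ∘ fun w => (space w, ‖space w‖⁻¹)) _ z :=
    HasFDerivAt.comp z (by exact h1) hpair
  refine ⟨_, hcomp, ?_, fun i => ?_⟩
  · have h0 : B (0, 0) = 0 := map_zero B
    simp [spaceL_apply, space_single_zero, h0]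
  · have e1 : B (EuclideanSpace.single i 1, 0)
        = ‖x‖⁻¹ * dX i φ (radial x) ‖x‖⁻¹ := by
      have h4 := (h.hasFDerivAt_slice hU hn hz.1 hs).fderiv
      have h5 : fderiv ℝ (fun x => φ (radial x) ‖space z‖⁻¹) x (EuclideanSpace.single i 1)
          = B (EuclideanSpace.single i 1, 0) := by
        rw [← hx] at h4
        rw [h4]; simp [hB]
      rw [← h5, fderiv_comp_radial_smul (fun y => φ y ‖space z‖⁻¹) x (inv_pos.2 hr),
        ← radial_of_ne hx0]
      rfl
    have e2 : B (0, 1) = dS φ (radial x) ‖x‖⁻¹ := (h.dS_eq hn hz.1 hs).symm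
    have e3 : ∀ c : ℝ, B (EuclideanSpace.single i 1, c)
        = B (EuclideanSpace.single i 1, 0) + c * B (0, 1) := by
      intro c
      rw [← smul_eq_mul, ← map_smul, ← map_add]
      simp
    simp only [ContinuousLinearMap.comp_apply, ContinuousLinearMap.prod_apply, spaceL_apply,
      space_single_succ]
    rw [e3, e1, e2]
    have hyi : (radial x : E3) i = ‖x‖⁻¹ * x i := by rw [radial_of_ne hx0]; simp
    rw [hyi]
    simp [EuclideanSpace.inner_single_right, spaceL_apply, space_single_succ]
    ring

theorem Reg.differentiableAt_hat (hU : IsOpen U) (h : Reg n U s₀ φ) (hn : 1 ≤ n) {z : Fin 4 → ℝ}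
    (hz : z ∈ region U s₀) : DifferentiableAt ℝ (hat φ) z :=
  (h.hasFDerivAt_hat hU hn hz).choose_spec.1.differentiableAt

theorem Reg.pd_hat_zero (hU : IsOpen U) (h : Reg n U s₀ φ) (hn : 1 ≤ n) {z : Fin 4 → ℝ}
    (hz : z ∈ region U s₀) : pd 0 (hat φ) z = 0 := by
  obtain ⟨A, hA, h0, -⟩ := h.hasFDerivAt_hat hU hn hz
  rw [pd, hA.fderiv, h0]

theorem Reg.pd_hat_succ (hU : IsOpen U) (h : Reg n U s₀ φ) (hn : 1 ≤ n) {z : Fin 4 → ℝ}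
    (hz : z ∈ region U s₀) (i : Fin 3) :
    pd i.succ (hat φ) z = hat (fun y s => s * dX i φ y s
      - s ^ 2 * (y : E3) i * dS φ y s) z := by
  obtain ⟨A, hA, -, h1⟩ := h.hasFDerivAt_hat hU hn hz
  rw [pd, hA.fderiv, h1, hat]

/-! ### Rules for the angular derivatives and the derivative in `s` -/

theorem Reg.differentiableAt_slice (hU : IsOpen U) (h : Reg n U s₀ φ) (hn : 1 ≤ n) {y : S2}
    (hy : y ∈ U) {s : ℝ} (hs : s ∈ Ico 0 s₀) :
    DifferentiableAt ℝ (fun x => φ (radial x) s) (y : E3) :=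
  (h.hasFDerivAt_slice hU hn (coe_mem_cone hy) hs).differentiableAt

theorem ang_mul {f g : S2 → ℝ} {y : S2} (hf : DifferentiableAt ℝ (fun x => f (radial x)) (y : E3))
    (hg : DifferentiableAt ℝ (fun x => g (radial x)) (y : E3)) (i : Fin 3) :
    ang i (fun y => f y * g y) y = ang i f y * g y + f y * ang i g y := by
  rw [ang, fderiv_fun_mul hf hg]
  simp [ang, radial_coe]
  ring

theorem ang_sub {f g : S2 → ℝ} {y : S2} (hf : DifferentiableAt ℝ (fun x => f (radial x)) (y : E3))
    (hg : DifferentiableAt ℝ (fun x => g (radial x)) (y : E3)) (i : Fin 3) :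
    ang i (fun y => f y - g y) y = ang i f y - ang i g y := by
  rw [ang, fderiv_fun_sub hf hg]
  simp [ang]

theorem ang_const (c : ℝ) (i : Fin 3) (y : S2) : ang i (fun _ => c) y = 0 := by
  simp [ang]

theorem ang_const_mul (c : ℝ) {f : S2 → ℝ} {y : S2}
    (hf : DifferentiableAt ℝ (fun x => f (radial x)) (y : E3)) (i : Fin 3) :
    ang i (fun y => c * f y) y = c * ang i f y := by
  rw [ang_mul (f := fun _ => c) (differentiableAt_const c) hf, ang_const]; ring

theorem differentiableAt_coord (i : Fin 3) (y : S2) :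
    DifferentiableAt ℝ (fun x => (radial x : E3) i) (y : E3) :=
  have h : DifferentiableAt ℝ (fun x => (radial x : E3)) (y : E3) :=
    (contDiffAt_coe_radial (n := 1) (coe_ne_zero y)).differentiableAt (by simp)
  (EuclideanSpace.proj i : E3 →L[ℝ] ℝ).differentiableAt.comp (y : E3) h

/-- The divergence of the position vector along the sphere is its dimension. -/
theorem sum_ang_coord (y : S2) : ∑ i, ang i (fun y => (y : E3) i) y = 2 := by
  have key : ∀ i : Fin 3, ang i (fun y => (y : E3) i) y = 1 - (y : E3) i * (y : E3) i := by
    intro i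
    have hnorm : HasFDerivAt (fun x : E3 => ‖x‖) (innerSL ℝ (y : E3)) (y : E3) := by
      simpa using hasFDerivAt_norm (coe_ne_zero y)
    have hinv : HasFDerivAt (fun x : E3 => ‖x‖⁻¹) _ (y : E3) :=
      (hasDerivAt_inv (by simp)).comp_hasFDerivAt (y : E3) hnorm
    let p : E3 →L[ℝ] ℝ := EuclideanSpace.proj i
    have hcoord : HasFDerivAt (fun x : E3 => x i) p (y : E3) := p.hasFDerivAt
    have he : (fun x : E3 => (radial x : E3) i) =ᶠ[𝓝 (y : E3)] fun x => ‖x‖⁻¹ * x i := by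
      filter_upwards [isOpen_ne.mem_nhds (coe_ne_zero y)] with x hx
      rw [radial_of_ne hx]; simp
    have hm := (hinv.fun_mul hcoord).congr_of_eventuallyEq he
    rw [ang, hm.fderiv]
    simp [EuclideanSpace.inner_single_right, p]
    ring
  simp only [key, Finset.sum_sub_distrib, sum_coord_sq]
  norm_num

end

/-! ### The mean curvature of a graph in Schwarzschild spacetime -/

section
variable {m : ℝ} {U : Set S2} {s₀ : ℝ} {P : S2 → ℝ → ℝ}

/-- The components of `dr`, as functions of `(y, s)`. -/
def rForm : Fin 4 → S2 → ℝ → ℝ := Fin.cases (fun _ _ => 0) (fun i y _ => (y : E3) i)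

/-- The components of the Schwarzschild metric, as functions of `(y, s)`. -/
def metricS (m : ℝ) (a b : Fin 4) (y : S2) (s : ℝ) : ℝ :=
  -(1 - 2 * m * s) * (if a = 0 ∧ b = 0 then 1 else 0)
    - ((if a = 0 then rForm b y s else 0) + (if b = 0 then rForm a y s else 0))
    + ((if a = b ∧ a ≠ 0 then 1 else 0) - rForm a y s * rForm b y s)

/-- The components of the inverse of the Schwarzschild metric, as functions of `(y, s)`. -/
def invMetricS (m : ℝ) (a b : Fin 4) (y : S2) (s : ℝ) : ℝ :=
  (if a = b ∧ a ≠ 0 then 1 else 0)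
    - ((if a = 0 then rForm b y s else 0) + (if b = 0 then rForm a y s else 0))
    - 2 * m * s * (rForm a y s * rForm b y s)

/-- The components of `d(v + P)`, as functions of `(y, s)`. -/
def graphForm (P : S2 → ℝ → ℝ) : Fin 4 → S2 → ℝ → ℝ :=
  Fin.cases (fun _ _ => 1) (fun i y s => s * dX i P y s - s ^ 2 * (y : E3) i * dS P y s)

/-- The component `1 + s² (1 - 2ms) P_s` of the unphysical gradient of `v + P` along `∂_s`. -/
def gradS (m : ℝ) (P : S2 → ℝ → ℝ) (y : S2) (s : ℝ) : ℝ :=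
  1 + s ^ 2 * (1 - 2 * m * s) * dS P y s

theorem reg_rForm {n : ℕ∞ω} (a : Fin 4) : Reg n U s₀ (rForm a) := by
  cases a using Fin.cases with
  | zero => exact reg_of_contDiff contDiff_const
  | succ i => exact reg_coord i

theorem reg_metricS {n : ℕ∞ω} (a b : Fin 4) : Reg n U s₀ (metricS m a b) := by
  have h1 : Reg n U s₀ (fun _ s => -(1 - 2 * m * s) * (if a = 0 ∧ b = 0 then 1 else 0)) :=
    reg_of_contDiff (by fun_prop)
  have h2 : ∀ (p : Prop) [Decidable p] (c : Fin 4),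
      Reg n U s₀ (fun y s => if p then rForm c y s else 0) := by
    intro p _ c
    split_ifs
    · exact reg_rForm c
    · exact reg_of_contDiff contDiff_const
  exact (h1.sub ((h2 _ b).add (h2 _ a))).add
    ((reg_of_contDiff contDiff_const).sub ((reg_rForm a).mul (reg_rForm b)))

theorem reg_invMetricS {n : ℕ∞ω} (a b : Fin 4) : Reg n U s₀ (invMetricS m a b) := by
  have h1 : Reg n U s₀ (fun _ s => 2 * m * s) := reg_of_contDiff (by fun_prop)
  have h2 : ∀ (p : Prop) [Decidable p] (c : Fin 4),
      Reg n U s₀ (fun y s => if p then rForm c y s else 0) := by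
    intro p _ c
    split_ifs
    · exact reg_rForm c
    · exact reg_of_contDiff contDiff_const
  exact ((reg_of_contDiff contDiff_const).sub ((h2 _ b).add (h2 _ a))).sub
    (h1.mul ((reg_rForm a).mul (reg_rForm b)))

theorem schwarzschild_eq_hat {z : Fin 4 → ℝ} (hz : space z ≠ 0) (a b : Fin 4) :
    schwarzschild m z a b = hat (metricS m a b) z := by
  have h : ∀ a, drForm z a = hat (rForm a) z := by
    intro a
    cases a using Fin.cases with
    | zero => simp [drForm, hat, rForm]
    | succ i =>
      simp [drForm, hat, rForm, radial_of_ne hz, div_eq_inv_mul]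
      left; rfl
  simp only [schwarzschild, h, hat, metricS, div_eq_mul_inv]

theorem invMetricS_symm (a b : Fin 4) (y : S2) (s : ℝ) :
    invMetricS m a b y s = invMetricS m b a y s := by
  simp only [invMetricS]
  have : (a = b ∧ a ≠ 0) ↔ (b = a ∧ b ≠ 0) := by
    constructor <;> (rintro ⟨rfl, h⟩; exact ⟨rfl, h⟩)
  simp only [this]
  ring

theorem rForm_zero (y : S2) (s : ℝ) : rForm 0 y s = 0 := rfl

theorem rForm_succ (i : Fin 3) (y : S2) (s : ℝ) : rForm i.succ y s = (y : E3) i := rfl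

theorem metricS_zero_zero (y : S2) (s : ℝ) : metricS m 0 0 y s = -(1 - 2 * m * s) := by
  simp [metricS, rForm_zero]

theorem metricS_zero_succ (i : Fin 3) (y : S2) (s : ℝ) :
    metricS m 0 i.succ y s = -(y : E3) i := by
  simp [metricS, rForm_zero, rForm_succ, Fin.succ_ne_zero, (Fin.succ_ne_zero _).symm]

theorem metricS_succ_zero (i : Fin 3) (y : S2) (s : ℝ) :
    metricS m i.succ 0 y s = -(y : E3) i := by
  simp [metricS, rForm_zero, rForm_succ, Fin.succ_ne_zero]

theorem metricS_succ_succ (i j : Fin 3) (y : S2) (s : ℝ) :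
    metricS m i.succ j.succ y s = (if i = j then 1 else 0) - (y : E3) i * (y : E3) j := by
  simp [metricS, rForm_succ, Fin.succ_ne_zero]

theorem invMetricS_zero_zero (y : S2) (s : ℝ) : invMetricS m 0 0 y s = 0 := by
  simp [invMetricS, rForm_zero]

theorem invMetricS_zero_succ (i : Fin 3) (y : S2) (s : ℝ) :
    invMetricS m 0 i.succ y s = -(y : E3) i := by
  simp [invMetricS, rForm_zero, rForm_succ, Fin.succ_ne_zero, (Fin.succ_ne_zero _).symm]

theorem invMetricS_succ_zero (i : Fin 3) (y : S2) (s : ℝ) :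
    invMetricS m i.succ 0 y s = -(y : E3) i := by
  simp [invMetricS, rForm_zero, rForm_succ, Fin.succ_ne_zero]

theorem invMetricS_succ_succ (i j : Fin 3) (y : S2) (s : ℝ) :
    invMetricS m i.succ j.succ y s
      = (if i = j then 1 else 0) - 2 * m * s * ((y : E3) i * (y : E3) j) := by
  simp [invMetricS, rForm_succ, Fin.succ_ne_zero]

theorem metricS_mul_invMetricS (y : S2) (s : ℝ) :
    (Matrix.of fun a b => metricS m a b y s) * (Matrix.of fun a b => invMetricS m a b y s) = 1 := by
  have hn := sum_coord_sq y
  ext a b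
  rw [Matrix.mul_apply, Fin.sum_univ_succ]
  cases a using Fin.cases with
  | zero =>
    cases b using Fin.cases with
    | zero =>
      simp [metricS_zero_zero, metricS_zero_succ, invMetricS_zero_zero, invMetricS_succ_zero, hn]
    | succ j =>
      simp [metricS_zero_zero, metricS_zero_succ, invMetricS_zero_succ, invMetricS_succ_succ,
        mul_sub, (Fin.succ_ne_zero _).symm]
      have h : ∀ x : Fin 3, (y : E3) x * (2 * m * s * ((y : E3) x * (y : E3) j))
        = 2 * m * s * (y : E3) j * ((y : E3) x * (y : E3) x) := fun x => by ring
      simp only [h, Finset.sum_add_distrib, ← Finset.mul_sum, hn]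
      simp
      ring
  | succ i =>
    cases b using Fin.cases with
    | zero =>
      simp [metricS_succ_zero, metricS_succ_succ, invMetricS_zero_zero, invMetricS_succ_zero,
        sub_mul, Fin.succ_ne_zero]
      simp only [mul_assoc, ← Finset.mul_sum, hn]
      ring
    | succ j =>
      simp [metricS_succ_zero, metricS_succ_succ, invMetricS_zero_succ, invMetricS_succ_succ,
        sub_mul, mul_sub, Matrix.one_apply]
      have h : ∀ x : Fin 3, (y : E3) i * (y : E3) x * (2 * m * s * ((y : E3) x * (y : E3) j))
        = 2 * m * s * (y : E3) i * (y : E3) j * ((y : E3) x * (y : E3) x) := fun x => by ring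
      simp only [h, ← Finset.mul_sum, hn]
      ring

/-- The volume density of the Schwarzschild metric in the coordinates `(v, x)` is constant: in
`g^{ab} ∂_d g_{ab}` every term contains `∂_d |y|² = 0`. -/
theorem trace_invMetricS_pd (hU : IsOpen U) {z : Fin 4 → ℝ} (hz : z ∈ region U s₀) (d : Fin 4) :
    ∑ a, ∑ b, hat (invMetricS m a b) z * pd d (hat (metricS m a b)) z = 0 := by
  set y := radial (space z) with hy
  set s := ‖space z‖⁻¹ with hs
  have hc : ∀ i : Fin 3, DifferentiableAt ℝ (hat fun y _ => (y : E3) i) z := fun i =>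
    (reg_coord (n := 1) i).differentiableAt_hat hU le_rfl hz
  set D : Fin 3 → ℝ := fun i => pd d (hat fun y _ => (y : E3) i) z with hD
  have horth : ∑ i, (y : E3) i * D i = 0 := by
    have h1 : (fun w => ∑ i, hat (fun y _ => (y : E3) i) w * hat (fun y _ => (y : E3) i) w)
        = fun _ => 1 := by
      ext w
      simp only [hat, sum_coord_sq]
    have h2 := congrArg (fun f => pd d f z) h1
    simp only [pd_const] at h2
    rw [pd_sum fun i _ => (hc i).fun_mul (hc i)] at h2
    simp only [pd_mul (hc _) (hc _)] at h2
    have h3 : ∀ i, pd d (hat fun y _ => (y : E3) i) z * hat (fun y _ => (y : E3) i) z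
        + hat (fun y _ => (y : E3) i) z * pd d (hat fun y _ => (y : E3) i) z
        = 2 * ((y : E3) i * D i) := by
      intro i
      simp only [hD, hat, ← hy]
      ring
    simp only [h3, ← Finset.mul_sum] at h2
    linarith
  have h0 : ∀ i : Fin 3, pd d (hat (metricS m 0 i.succ)) z = -D i := by
    intro i
    have : hat (metricS m 0 i.succ) = fun w => (-1) * hat (fun y _ => (y : E3) i) w := by
      ext w; simp [hat, metricS_zero_succ]
    rw [this, pd_mul (differentiableAt_const _) (hc i), pd_const]
    simp [hD]
  have h0' : ∀ i : Fin 3, pd d (hat (metricS m i.succ 0)) z = -D i := by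
    intro i
    have : hat (metricS m i.succ 0) = fun w => (-1) * hat (fun y _ => (y : E3) i) w := by
      ext w; simp [hat, metricS_succ_zero]
    rw [this, pd_mul (differentiableAt_const _) (hc i), pd_const]
    simp [hD]
  have h1 : ∀ i j : Fin 3, pd d (hat (metricS m i.succ j.succ)) z
      = -(D i * (y : E3) j + (y : E3) i * D j) := by
    intro i j
    have : hat (metricS m i.succ j.succ) = fun w => (if i = j then 1 else 0)
        - hat (fun y _ => (y : E3) i) w * hat (fun y _ => (y : E3) j) w := by
      ext w; simp [hat, metricS_succ_succ]
    rw [this, pd_sub (differentiableAt_const _) ((hc i).fun_mul (hc j)), pd_const,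
      pd_mul (hc i) (hc j)]
    simp [hD, hat, hy]
  simp only [Fin.sum_univ_succ (n := 3), h0, h0', h1]
  simp only [hat, ← hy, ← hs, invMetricS_zero_zero, invMetricS_zero_succ, invMetricS_succ_zero,
    invMetricS_succ_succ]
  rw [Fin.sum_univ_three] at horth
  simp only [Fin.sum_univ_three]
  simp
  linear_combination 4 * m * s * ((y : E3) 0 ^ 2 + (y : E3) 1 ^ 2 + (y : E3) 2 ^ 2) * horth

end

section
variable {m : ℝ} {U : Set S2} {s₀ : ℝ} {P : S2 → ℝ → ℝ}

theorem Lfun_eq (m : ℝ) (P : S2 → ℝ → ℝ) (y : S2) (s : ℝ) :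
    Lfun m P y s = -(2 * dS P y s + s ^ 2 * (1 - 2 * m * s) * dS P y s ^ 2
      + ∑ i, dX i P y s * dX i P y s) := by
  rw [Lfun, gradInner_slice_eq]; rfl

theorem Reg.reg_Lfun (hU : IsOpen U) {n k : ℕ∞ω} (hP : Reg n U s₀ P) (hn : k + 1 ≤ n) :
    Reg k U s₀ (Lfun m P) := by
  have h1 := hP.reg_dS hU hn
  have h2 : Reg k U s₀ (fun _ s => (2 : ℝ)) := reg_of_contDiff contDiff_const
  have h3 : Reg k U s₀ (fun _ s => s ^ 2 * (1 - 2 * m * s)) := reg_of_contDiff (by fun_prop)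
  refine ((((h2.mul h1).add (h3.mul (h1.mul h1))).add (Reg.sum (t := Finset.univ)
    fun i _ => (hP.reg_dX hU hn i).mul (hP.reg_dX hU hn i))).neg).congr fun y _ s _ => ?_
  rw [Lfun_eq]; ring

theorem Reg.reg_gradS (hU : IsOpen U) {n k : ℕ∞ω} (hP : Reg n U s₀ P) (hn : k + 1 ≤ n) :
    Reg k U s₀ (gradS m P) := by
  have h3 : Reg k U s₀ (fun _ s => s ^ 2 * (1 - 2 * m * s)) := reg_of_contDiff (by fun_prop)
  exact (reg_of_contDiff contDiff_const).add (h3.mul (hP.reg_dS hU hn))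

theorem Reg.reg_graphForm (hU : IsOpen U) {n k : ℕ∞ω} (hP : Reg n U s₀ P) (hn : k + 1 ≤ n)
    (a : Fin 4) : Reg k U s₀ (graphForm P a) := by
  cases a using Fin.cases with
  | zero => exact reg_of_contDiff contDiff_const
  | succ i =>
    have h1 : Reg k U s₀ (fun _ s => s) := reg_of_contDiff contDiff_id
    have h2 : Reg k U s₀ (fun _ s => s ^ 2) := reg_of_contDiff (by fun_prop)
    exact (h1.mul (hP.reg_dX hU hn i)).sub ((h2.mul (reg_coord i)).mul (hP.reg_dS hU hn))

theorem sum_coord_mul_graphForm (y : S2) (s : ℝ) :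
    ∑ i : Fin 3, (y : E3) i * graphForm P i.succ y s = -s ^ 2 * dS P y s := by
  have h : ∀ i : Fin 3, (y : E3) i * graphForm P i.succ y s
      = s * ((y : E3) i * dX i P y s) - s ^ 2 * dS P y s * ((y : E3) i * (y : E3) i) := by
    intro i; simp only [graphForm, Fin.cases_succ]; ring
  simp only [h, Finset.sum_sub_distrib, ← Finset.mul_sum, sum_coord_sq, dX, sum_coord_mul_ang]
  ring

theorem sum_invMetricS_mul_graphForm_zero (y : S2) (s : ℝ) :
    ∑ b, invMetricS m 0 b y s * graphForm P b y s = s ^ 2 * dS P y s := by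
  rw [Fin.sum_univ_succ]
  simp only [invMetricS_zero_zero, invMetricS_zero_succ, neg_mul, Finset.sum_neg_distrib,
    sum_coord_mul_graphForm]
  ring

theorem sum_invMetricS_mul_graphForm_succ (i : Fin 3) (y : S2) (s : ℝ) :
    ∑ b, invMetricS m i.succ b y s * graphForm P b y s
      = s * dX i P y s - (y : E3) i * gradS m P y s := by
  rw [Fin.sum_univ_succ]
  have h : ∀ j : Fin 3, invMetricS m i.succ j.succ y s * graphForm P j.succ y s
      = (if i = j then graphForm P j.succ y s else 0)
        - 2 * m * s * (y : E3) i * ((y : E3) j * graphForm P j.succ y s) := by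
    intro j
    rw [invMetricS_succ_succ]
    split_ifs <;> ring
  simp only [h, Finset.sum_sub_distrib, ← Finset.mul_sum, sum_coord_mul_graphForm,
    invMetricS_succ_zero, Finset.sum_ite_eq, Finset.mem_univ, if_true]
  simp only [graphForm, Fin.cases_zero, Fin.cases_succ, gradS]
  ring

/-- The norm of `d(v + P)` is `-s² L`. -/
theorem sum_invMetricS_graphForm_graphForm (y : S2) (s : ℝ) :
    ∑ a, ∑ b, invMetricS m a b y s * graphForm P a y s * graphForm P b y s
      = -(s ^ 2 * Lfun m P y s) := by
  have h : ∀ a, ∑ b, invMetricS m a b y s * graphForm P a y s * graphForm P b y s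
      = graphForm P a y s * ∑ b, invMetricS m a b y s * graphForm P b y s := by
    intro a
    rw [Finset.mul_sum]
    exact Finset.sum_congr rfl fun b _ => by ring
  simp only [h]
  rw [Fin.sum_univ_succ, sum_invMetricS_mul_graphForm_zero]
  have h2 : ∀ i : Fin 3, graphForm P i.succ y s * (s * dX i P y s - (y : E3) i * gradS m P y s)
      = s ^ 2 * (dX i P y s * dX i P y s) - s ^ 3 * dS P y s * ((y : E3) i * ang i (fun y' => P y' s) y)
        - gradS m P y s * ((y : E3) i * graphForm P i.succ y s) := by
    intro i
    simp only [graphForm, Fin.cases_succ, dX]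
    ring
  simp only [sum_invMetricS_mul_graphForm_succ, h2, Finset.sum_sub_distrib, ← Finset.mul_sum,
    sum_coord_mul_graphForm, sum_coord_mul_ang]
  rw [Lfun_eq]
  simp only [graphForm, Fin.cases_zero, gradS]
  ring

theorem pd_coord_zero (a : Fin 4) (z : Fin 4 → ℝ) :
    pd a (fun w => w 0) z = if a = 0 then 1 else 0 := by
  have : HasFDerivAt (fun w : Fin 4 → ℝ => w 0) (ContinuousLinearMap.proj (R := ℝ) (0 : Fin 4)) z :=
    (ContinuousLinearMap.proj (R := ℝ) (φ := fun _ : Fin 4 => ℝ) 0).hasFDerivAt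
  rw [pd, this.fderiv]
  simp [Pi.single_apply, eq_comm]

theorem pd_graphFun (hU : IsOpen U) (hP : Reg 1 U s₀ P) {z : Fin 4 → ℝ} (hz : z ∈ region U s₀)
    (a : Fin 4) : pd a (graphFun P) z = hat (graphForm P a) z := by
  have h1 : DifferentiableAt ℝ (fun w : Fin 4 → ℝ => w 0) z := by fun_prop
  have h2 : pd a (graphFun P) z = pd a (fun w => w 0) z + pd a (hat P) z := by
    have : graphFun P = fun w => w 0 + hat P w := rfl
    rw [this, pd, fderiv_fun_add h1 (hP.differentiableAt_hat hU le_rfl hz)]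
    rfl
  rw [h2, pd_coord_zero]
  cases a using Fin.cases with
  | zero => rw [hP.pd_hat_zero hU le_rfl hz]; simp [hat, graphForm]
  | succ i => rw [hP.pd_hat_succ hU le_rfl hz]; simp [hat, graphForm, Fin.succ_ne_zero]

theorem inv_schwarzschild {z : Fin 4 → ℝ} (hz : space z ≠ 0) :
    (schwarzschild m z)⁻¹ = Matrix.of fun a b => hat (invMetricS m a b) z := by
  apply Matrix.inv_eq_right_inv
  have : schwarzschild m z = Matrix.of fun a b => hat (metricS m a b) z := by
    ext a b; exact schwarzschild_eq_hat hz a b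
  rw [this]
  exact metricS_mul_invMetricS _ _

theorem gradSq_eq (hU : IsOpen U) (hP : Reg 1 U s₀ P) {z : Fin 4 → ℝ} (hz : z ∈ region U s₀) :
    gradSq (schwarzschild m) (graphFun P) z = -hat (fun y s => s ^ 2 * Lfun m P y s) z := by
  rw [gradSq, inv_schwarzschild hz.1.1]
  simp only [pd_graphFun hU hP hz]
  exact sum_invMetricS_graphForm_graphForm _ _

theorem conormal_eq (hU : IsOpen U) (hP : Reg 1 U s₀ P) {z : Fin 4 → ℝ} (hz : z ∈ region U s₀)
    (b : Fin 4) : conormal (schwarzschild m) (graphFun P) b z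
      = -hat (graphForm P b) z / Real.sqrt (hat (fun y s => s ^ 2 * Lfun m P y s) z) := by
  rw [conormal, gradSq_eq hU hP hz, pd_graphFun hU hP hz, neg_neg]

theorem space_graphPoint (P : S2 → ℝ → ℝ) (y : S2) (s : ℝ) :
    space (graphPoint P y s) = s⁻¹ • (y : E3) := by
  ext i; simp [space, graphPoint]

theorem norm_space_graphPoint (P : S2 → ℝ → ℝ) (y : S2) {s : ℝ} (hs : 0 < s) :
    ‖space (graphPoint P y s)‖⁻¹ = s := by
  rw [space_graphPoint, norm_smul, norm_coe]
  simp [abs_of_pos hs]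

theorem radial_graphPoint (P : S2 → ℝ → ℝ) (y : S2) {s : ℝ} (hs : 0 < s) :
    radial (space (graphPoint P y s)) = y := by
  rw [space_graphPoint, radial_smul y (inv_pos.2 hs)]

theorem hat_graphPoint (φ P : S2 → ℝ → ℝ) (y : S2) {s : ℝ} (hs : 0 < s) :
    hat φ (graphPoint P y s) = φ y s := by
  rw [hat, norm_space_graphPoint P y hs, radial_graphPoint P y hs]

theorem graphPoint_mem_region {y : S2} (hy : y ∈ U) {s : ℝ} (hs : s ∈ Ioo 0 s₀) :
    graphPoint P y s ∈ region U s₀ := by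
  refine ⟨⟨?_, ?_⟩, ?_⟩
  · rw [space_graphPoint]
    exact smul_ne_zero (inv_pos.2 hs.1).ne' (coe_ne_zero y)
  · rwa [radial_graphPoint P y hs.1]
  · rw [norm_space_graphPoint P y hs.1]; exact hs.2

theorem Lfun_pos (hU : IsOpen U) (hP : Reg 1 U s₀ P) {y : S2} (hy : y ∈ U) {s : ℝ}
    (hs : s ∈ Ioo 0 s₀) (h : SpacelikeAt m P y s) : 0 < Lfun m P y s := by
  rw [SpacelikeAt, gradSq_eq hU hP (graphPoint_mem_region hy hs), hat_graphPoint _ _ _ hs.1] at h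
  have h2 : 0 < s ^ 2 * Lfun m P y s := by linarith
  exact (mul_pos_iff_of_pos_left (pow_pos hs.1 2)).1 h2

/-- The mean curvature as a divergence in `x`: the unit normal does not depend on `v`, and its
space components are `((1 + s² (1 - 2ms) P_s) y - s ∇P) / (s √L)`. -/
theorem graphMeanCurvature_eq_divergence (hU : IsOpen U) (hP : Reg 2 U s₀ P)
    (hL : ∀ y ∈ U, ∀ s ∈ Ioo 0 s₀, 0 < Lfun m P y s) {y : S2} (hy : y ∈ U) {s : ℝ}
    (hs : s ∈ Ioo 0 s₀) :
    3 * graphMeanCurvature m P y s = ∑ i : Fin 3, pd i.succ (fun w =>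
      hat (fun y s => (y : E3) i * gradS m P y s - s * dX i P y s) w
        / Real.sqrt (hat (fun y s => s ^ 2 * Lfun m P y s) w)) (graphPoint P y s) := by
  set z := graphPoint P y s with hz0
  have hz : z ∈ region U s₀ := graphPoint_mem_region hy hs
  have hP1 : Reg 1 U s₀ P := hP.of_le (by norm_num)
  have hev : ∀ᶠ w in 𝓝 z, w ∈ region U s₀ := (isOpen_region hU).mem_nhds hz
  have hQ : Reg 1 U s₀ (fun y s => s ^ 2 * Lfun m P y s) :=
    (reg_of_contDiff (by fun_prop)).mul (hP.reg_Lfun hU (by norm_num))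
  have hQd := hQ.differentiableAt_hat hU le_rfl hz
  have hQpos : ∀ w ∈ region U s₀, 0 < hat (fun y s => s ^ 2 * Lfun m P y s) w := fun w hw =>
    mul_pos (pow_pos (inv_norm_mem hw).1 2) (hL _ hw.1.2 _ (inv_norm_mem hw))
  have hdiv := levelMeanCurvature_eq_divergence (g := schwarzschild m)
    (G := fun z => Matrix.of fun a b => hat (invMetricS m a b) z) (F := graphFun P) (z := z)
    (by
      filter_upwards [hev] with w hw
      have : schwarzschild m w = Matrix.of fun a b => hat (metricS m a b) w := by
        ext a b; exact schwarzschild_eq_hat hw.1.1 a b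
      rw [this]
      exact metricS_mul_invMetricS _ _)
    (fun a b => invMetricS_symm _ _ _ _)
    (fun a b => by
      have h1 := (reg_metricS (m := m) (n := 1) a b).differentiableAt_hat hU le_rfl hz
      refine h1.congr_of_eventuallyEq ?_
      filter_upwards [hev] with w hw using schwarzschild_eq_hat hw.1.1 a b)
    (fun a b => (reg_invMetricS (m := m) (n := 1) a b).differentiableAt_hat hU le_rfl hz)
    (fun b => by
      have h1 := (hP.reg_graphForm (k := 1) hU (by norm_num) b).differentiableAt_hat hU le_rfl hz
      have h3 := (hQd.sqrt (hQpos z hz).ne').fun_inv (Real.sqrt_pos.2 (hQpos z hz)).ne'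
      have h2 : DifferentiableAt ℝ (fun w => -hat (graphForm P b) w
          / √(hat (fun y s => s ^ 2 * Lfun m P y s) w)) z := by
        simp only [div_eq_mul_inv]
        exact h1.fun_neg.fun_mul h3
      refine h2.congr_of_eventuallyEq ?_
      filter_upwards [hev] with w hw using conormal_eq hU hP1 hw b)
    (by
      filter_upwards [hev] with w hw
      have h1 := sum_invMetricS_graphForm_graphForm (m := m) (P := P) (radial (space w))
        ‖space w‖⁻¹
      have hq := hQpos w hw
      have hsq := Real.sq_sqrt hq.le
      have hne := (Real.sqrt_pos.2 hq).ne'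
      simp only [conormal_eq hU hP1 hw, Matrix.of_apply]
      have h2 : ∀ a b, hat (invMetricS m a b) w
          * (-hat (graphForm P a) w / √(hat (fun y s => s ^ 2 * Lfun m P y s) w))
          * (-hat (graphForm P b) w / √(hat (fun y s => s ^ 2 * Lfun m P y s) w))
          = (hat (fun y s => s ^ 2 * Lfun m P y s) w)⁻¹ * (hat (invMetricS m a b) w
            * hat (graphForm P a) w * hat (graphForm P b) w) := by
        intro a b
        nth_rewrite 3 [← hsq]
        field_simp
      simp only [h2, ← Finset.mul_sum]
      simp only [hat] at h1 hq ⊢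
      rw [h1, mul_neg, inv_mul_cancel₀ hq.ne'])
    (fun d => by
      rw [← trace_invMetricS_pd (m := m) hU hz d]
      refine Finset.sum_congr rfl fun a _ => Finset.sum_congr rfl fun b _ => ?_
      congr 1
      refine pd_congr ?_ d
      filter_upwards [hev] with w hw using schwarzschild_eq_hat hw.1.1 a b)
  have hN : ∀ a, (fun w => ∑ b, hat (invMetricS m a b) w
        * conormal (schwarzschild m) (graphFun P) b w) =ᶠ[𝓝 z]
      fun w => hat (fun y s => -∑ b, invMetricS m a b y s * graphForm P b y s) w
        / √(hat (fun y s => s ^ 2 * Lfun m P y s) w) := by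
    intro a
    filter_upwards [hev] with w hw
    simp only [conormal_eq hU hP1 hw, hat]
    rw [neg_div, Finset.sum_div, ← Finset.sum_neg_distrib]
    exact Finset.sum_congr rfl fun b _ => by ring
  rw [graphMeanCurvature, hdiv, ← mul_assoc]
  norm_num only
  rw [one_mul]
  simp only [Matrix.of_apply, pd_congr (hN _)]
  rw [Fin.sum_univ_succ]
  -- The normal does not depend on `v`.
  have h0 : pd 0 (fun w => hat (fun y s => -∑ b, invMetricS m 0 b y s * graphForm P b y s) w
        / √(hat (fun y s => s ^ 2 * Lfun m P y s) w)) z = 0 := by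
    have hr : Reg 1 U s₀ (fun y s => -∑ b, invMetricS m 0 b y s * graphForm P b y s) :=
      (Reg.sum fun b _ => (reg_invMetricS 0 b).mul (hP.reg_graphForm hU (by norm_num) b)).neg
    rw [pd_div_sqrt (hr.differentiableAt_hat hU le_rfl hz) hQd (hQpos z hz),
      hr.pd_hat_zero hU le_rfl hz, hQ.pd_hat_zero hU le_rfl hz]
    simp
  rw [h0, zero_add]
  refine Finset.sum_congr rfl fun i _ => ?_
  simp only [sum_invMetricS_mul_graphForm_succ, neg_sub]

end

section
variable {m : ℝ} {U : Set S2} {s₀ : ℝ} {P : S2 → ℝ → ℝ}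

/-- The equation of prescribed mean curvature, multiplied by `L^{3/2}` so that all its terms extend
to `s = 0`. -/
theorem meanCurvature_equation (hU : IsOpen U) (hP : Reg 2 U s₀ P)
    (hL : ∀ y ∈ U, ∀ s ∈ Ioo 0 s₀, 0 < Lfun m P y s) {y : S2} (hy : y ∈ U) {s : ℝ}
    (hs : s ∈ Ioo 0 s₀) :
    3 * graphMeanCurvature m P y s * (Lfun m P y s * √(Lfun m P y s))
      = 3 * Lfun m P y s * gradS m P y s
        + 1 / 2 * (s * (dS (Lfun m P) y s * gradS m P y s))
        - s * (Lfun m P y s * dS (gradS m P) y s)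
        - s * (Lfun m P y s * sphereLap (fun y' => P y' s) y)
        + 1 / 2 * (s * gradInner (fun y' => Lfun m P y' s) (fun y' => P y' s) y) := by
  have hs' : s ∈ Ico 0 s₀ := Ioo_subset_Ico_self hs
  have hz : graphPoint P y s ∈ region U s₀ := graphPoint_mem_region hy hs
  have h1 : Reg 1 U s₀ P := hP.of_le (by norm_num)
  have hLr : Reg 1 U s₀ (Lfun m P) := hP.reg_Lfun hU (by norm_num)
  have hA : Reg 1 U s₀ (gradS m P) := hP.reg_gradS hU (by norm_num)
  have hid : Reg 1 U s₀ (fun _ s => s) := reg_of_contDiff contDiff_id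
  have hDP : ∀ i, Reg 1 U s₀ (dX i P) := fun i => hP.reg_dX hU (by norm_num) i
  have hk : ∀ i : Fin 3, Reg 1 U s₀ (fun y s => (y : E3) i * gradS m P y s - s * dX i P y s) :=
    fun i => ((reg_coord i).mul hA).sub (hid.mul (hDP i))
  have hQ : Reg 1 U s₀ (fun y s => s ^ 2 * Lfun m P y s) :=
    (reg_of_contDiff (by fun_prop)).mul hLr
  have hlpos := hL y hy s hs
  have hdXk : ∀ i : Fin 3, dX i (fun y s => (y : E3) i * gradS m P y s - s * dX i P y s) y s
      = ang i (fun y => (y : E3) i) y * gradS m P y s + (y : E3) i * dX i (gradS m P) y s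
        - s * dX i (dX i P) y s := by
    intro i
    have d1 := hA.differentiableAt_slice hU le_rfl hy hs'
    have d2 := (hDP i).differentiableAt_slice hU le_rfl hy hs'
    rw [dX, ang_sub ((differentiableAt_coord i y).fun_mul d1) (d2.const_mul s),
      ang_mul (differentiableAt_coord i y) d1, ang_const_mul (f := fun y' => dX i P y' s) s d2]
    rfl
  have hdSk : ∀ i : Fin 3, dS (fun y s => (y : E3) i * gradS m P y s - s * dX i P y s) y s
      = (y : E3) i * dS (gradS m P) y s - dX i P y s - s * dX i (dS P) y s := by
    intro i
    have d1 := hA.hasDerivWithinAt le_rfl hy hs'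
    have d2 := (hDP i).hasDerivWithinAt le_rfl hy hs'
    have d3 := (d1.const_mul ((y : E3) i)).sub ((hasDerivWithinAt_id s (Ici 0)).mul d2)
    have d4 : HasDerivWithinAt ((fun (y : S2) s => (y : E3) i * gradS m P y s - s * dX i P y s) y) _
      (Ici 0) s := d3
    rw [dS, d4.derivWithin (uniqueDiffOn_Ici 0 s hs'.1), hP.dS_dX hU le_rfl i hy hs']
    simp
    ring
  have hdXQ : ∀ i : Fin 3, dX i (fun y s => s ^ 2 * Lfun m P y s) y s
      = s ^ 2 * dX i (Lfun m P) y s := by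
    intro i
    exact ang_const_mul (s ^ 2) (hLr.differentiableAt_slice hU le_rfl hy hs') i
  have hdSQ : dS (fun y s => s ^ 2 * Lfun m P y s) y s
      = 2 * s * Lfun m P y s + s ^ 2 * dS (Lfun m P) y s := by
    have d1 := (hasDerivAt_pow 2 s).hasDerivWithinAt.mul (hLr.hasDerivWithinAt le_rfl hy hs')
    have d2 : HasDerivWithinAt ((fun y s => s ^ 2 * Lfun m P y s) y) _ (Ici 0) s := d1
    rw [dS, d2.derivWithin (uniqueDiffOn_Ici 0 s hs'.1)]
    simp
  have hn := sum_coord_sq y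
  have hdiv := sum_ang_coord y
  have hyA : ∑ i, (y : E3) i * dX i (gradS m P) y s = 0 := sum_coord_mul_ang _ y
  have hyP : ∑ i, (y : E3) i * dX i P y s = 0 := sum_coord_mul_ang _ y
  have hyP' : ∑ i, (y : E3) i * dX i (dS P) y s = 0 := sum_coord_mul_ang _ y
  have hyL : ∑ i, (y : E3) i * dX i (Lfun m P) y s = 0 := sum_coord_mul_ang _ y
  have hΔ := hP.sphereLap_eq hU le_rfl hy hs'
  have hΓ := gradInner_slice_eq (Lfun m P) P y s
  -- The divergence of the numerator of the unit normal, and the derivative of `-g(∇F, ∇F) = s² L`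
  -- along that numerator.
  have hS1 : ∑ i : Fin 3, pd i.succ
      (hat (fun y s => (y : E3) i * gradS m P y s - s * dX i P y s)) (graphPoint P y s)
      = 2 * s * gradS m P y s - s ^ 2 * sphereLap (fun y' => P y' s) y
        - s ^ 2 * dS (gradS m P) y s := by
    simp only [(hk _).pd_hat_succ hU le_rfl hz, hat_graphPoint _ _ _ hs.1, hdXk, hdSk, hΔ]
    simp only [Fin.sum_univ_three] at hn hdiv hyA hyP hyP' ⊢
    linear_combination s * gradS m P y s * hdiv + s * hyA - s ^ 2 * dS (gradS m P) y s * hn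
      + s ^ 2 * hyP + s ^ 3 * hyP'
  have hS2 : ∑ i : Fin 3, ((y : E3) i * gradS m P y s - s * dX i P y s)
      * pd i.succ (hat (fun y s => s ^ 2 * Lfun m P y s)) (graphPoint P y s)
      = -s ^ 4 * gradInner (fun y' => Lfun m P y' s) (fun y' => P y' s) y
        - s ^ 2 * gradS m P y s * (2 * s * Lfun m P y s + s ^ 2 * dS (Lfun m P) y s) := by
    simp only [hQ.pd_hat_succ hU le_rfl hz, hat_graphPoint _ _ _ hs.1, hdXQ, hdSQ, hΓ]
    simp only [Fin.sum_univ_three] at hn hyP hyL ⊢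
    linear_combination s ^ 3 * gradS m P y s * hyL
      - s ^ 2 * (2 * s * Lfun m P y s + s ^ 2 * dS (Lfun m P) y s)
        * (gradS m P y s * hn - s * hyP)
  have hQpos : 0 < hat (fun y s => s ^ 2 * Lfun m P y s) (graphPoint P y s) := by
    rw [hat_graphPoint _ _ _ hs.1]; exact mul_pos (pow_pos hs.1 2) hlpos
  have hmain : 3 * graphMeanCurvature m P y s
      = (2 * s * gradS m P y s - s ^ 2 * sphereLap (fun y' => P y' s) y
          - s ^ 2 * dS (gradS m P) y s) / (s * √(Lfun m P y s))
        - (-s ^ 4 * gradInner (fun y' => Lfun m P y' s) (fun y' => P y' s) y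
          - s ^ 2 * gradS m P y s * (2 * s * Lfun m P y s + s ^ 2 * dS (Lfun m P) y s))
          / (2 * (s * √(Lfun m P y s)) ^ 3) := by
    rw [graphMeanCurvature_eq_divergence hU hP hL hy hs, ← hS1, ← hS2, Finset.sum_div,
      Finset.sum_div, ← Finset.sum_sub_distrib]
    refine Finset.sum_congr rfl fun i _ => ?_
    rw [pd_div_sqrt ((hk i).differentiableAt_hat hU le_rfl hz)
      (hQ.differentiableAt_hat hU le_rfl hz) hQpos]
    simp only [hat_graphPoint _ _ _ hs.1]
    rw [Real.sqrt_mul (sq_nonneg s), Real.sqrt_sq hs.1.le]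
  have hsq := Real.sq_sqrt hlpos.le
  have hw := Real.sqrt_pos.2 hlpos
  rw [hmain]
  have hs0 := hs.1.ne'
  generalize √(Lfun m P y s) = w at hsq hw ⊢
  rw [← hsq]
  field_simp
  ring

end

/-! ### Asymptotic expansions at `s = 0` -/

open PowerSeries in
/-- The function `f` has the asymptotic expansion `a` up to order `k` as `s → 0⁺`. Only the
coefficients of `a` of degree at most `k` matter. -/
def HasExp (k : ℕ) (f : ℝ → ℝ) (a : PowerSeries ℝ) : Prop :=
  (fun s => f s - (trunc (k + 1) a).eval s) =o[𝓝[>] 0] fun s : ℝ => s ^ k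

section
open PowerSeries
variable {k : ℕ} {f g : ℝ → ℝ} {a b : PowerSeries ℝ}

theorem tendsto_eval_zero (p : Polynomial ℝ) :
    Tendsto (fun s => p.eval s) (𝓝[>] 0) (𝓝 (p.eval 0)) :=
  p.continuous.continuousAt.mono_left nhdsWithin_le_nhds

theorem isLittleO_pow_succ_mul_eval (k : ℕ) (p : Polynomial ℝ) :
    (fun s => s ^ (k + 1) * p.eval s) =o[𝓝[>] 0] fun s : ℝ => s ^ k := by
  have h : (fun s : ℝ => s * p.eval s) =o[𝓝[>] 0] fun _ => (1 : ℝ) := by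
    rw [isLittleO_one_iff]
    have h1 := tendsto_eval_zero (Polynomial.X * p)
    simpa using h1
  have h2 := (isBigO_refl (fun s : ℝ => s ^ k) (𝓝[>] 0)).mul_isLittleO h
  simpa [pow_succ, mul_assoc] using h2

theorem isLittleO_eval_of_coeff {p : Polynomial ℝ} (hp : ∀ j ≤ k, p.coeff j = 0) :
    (fun s => p.eval s) =o[𝓝[>] 0] fun s : ℝ => s ^ k := by
  have hdvd : Polynomial.X ^ (k + 1) ∣ p :=
    Polynomial.X_pow_dvd_iff.2 fun d hd => hp d (Nat.lt_succ_iff.1 hd)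
  obtain ⟨q, rfl⟩ := hdvd
  simpa using isLittleO_pow_succ_mul_eval k q

theorem HasExp.congr_coeff (h : HasExp k f a) (hab : ∀ j ≤ k, coeff j a = coeff j b) :
    HasExp k f b := by
  have : trunc (k + 1) a = trunc (k + 1) b := by
    ext j
    rw [coeff_trunc, coeff_trunc]
    split_ifs with hj
    · exact hab j (by omega)
    · rfl
  rw [HasExp, ← this]
  exact h

theorem HasExp.congr (h : HasExp k f a) (hfg : ∀ᶠ s in 𝓝[>] (0 : ℝ), g s = f s) :
    HasExp k g a := by
  refine h.congr' ?_ EventuallyEq.rfl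
  filter_upwards [hfg] with s hs
  rw [hs]

theorem HasExp.add (hf : HasExp k f a) (hg : HasExp k g b) :
    HasExp k (fun s => f s + g s) (a + b) := by
  refine (IsLittleO.add hf hg).congr_left fun s => ?_
  simp only [map_add, Polynomial.eval_add]
  ring

theorem HasExp.const_mul (c : ℝ) (hf : HasExp k f a) : HasExp k (fun s => c * f s) (C c * a) := by
  refine (IsLittleO.const_mul_left hf c).congr_left fun s => ?_
  rw [trunc_C_mul, Polynomial.eval_mul, Polynomial.eval_C]
  ring

theorem HasExp.neg (hf : HasExp k f a) : HasExp k (fun s => -f s) (-a) := by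
  refine (IsLittleO.neg_left hf).congr_left fun s => ?_
  simp only [map_neg, Polynomial.eval_neg]
  ring

theorem HasExp.sub (hf : HasExp k f a) (hg : HasExp k g b) :
    HasExp k (fun s => f s - g s) (a - b) := by
  simpa only [sub_eq_add_neg] using hf.add hg.neg

theorem hasExp_const (k : ℕ) (c : ℝ) : HasExp k (fun _ => c) (C c) := by
  rw [HasExp, trunc_C]
  simp

theorem hasExp_id (k : ℕ) : HasExp k (fun s => s) X := by
  rcases k with _ | k
  · rw [HasExp]
    simp only [zero_add, trunc_one_X, Polynomial.eval_zero, sub_zero, pow_zero, isLittleO_one_iff]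
    exact tendsto_id.mono_left nhdsWithin_le_nhds
  · rw [HasExp, trunc_X]
    simp

theorem HasExp.sum {ι : Type*} {t : Finset ι} {f : ι → ℝ → ℝ} {a : ι → PowerSeries ℝ}
    (h : ∀ i ∈ t, HasExp k (f i) (a i)) :
    HasExp k (fun s => ∑ i ∈ t, f i s) (∑ i ∈ t, a i) := by
  classical
  induction t using Finset.induction_on with
  | empty => simpa using hasExp_const k 0
  | insert i t hi ih =>
    simp only [Finset.sum_insert hi]
    exact (h i (Finset.mem_insert_self i t)).add
      (ih fun j hj => h j (Finset.mem_insert_of_mem hj))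

theorem isBigO_pow_one (k : ℕ) : (fun s : ℝ => s ^ k) =O[𝓝[>] 0] fun _ => (1 : ℝ) := by
  have h := tendsto_eval_zero (Polynomial.X ^ k)
  simp only [Polynomial.eval_pow, Polynomial.eval_X] at h
  exact h.isBigO_one ℝ

theorem HasExp.mul (hf : HasExp k f a) (hg : HasExp k g b) :
    HasExp k (fun s => f s * g s) (a * b) := by
  have hg1 : g =O[𝓝[>] 0] fun _ => (1 : ℝ) := by
    have h1 : (fun s => g s - (trunc (k + 1) b).eval s) =O[𝓝[>] 0] fun _ => (1 : ℝ) :=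
      hg.isBigO.trans (isBigO_pow_one k)
    simpa using h1.add ((tendsto_eval_zero (trunc (k + 1) b)).isBigO_one ℝ)
  have h1 := hf.mul_isBigO hg1
  have h2 := ((tendsto_eval_zero (trunc (k + 1) a)).isBigO_one ℝ).mul_isLittleO hg
  have h3 : (fun s => (trunc (k + 1) a * trunc (k + 1) b - trunc (k + 1) (a * b)).eval s)
      =o[𝓝[>] 0] fun s : ℝ => s ^ k := by
    refine isLittleO_eval_of_coeff fun j hj => ?_
    rw [Polynomial.coeff_sub, coeff_trunc, if_pos (by omega),
      coeff_mul_eq_coeff_trunc_mul_trunc (n := k + 1) a b (by omega), ← Polynomial.coe_mul,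
      Polynomial.coeff_coe, sub_self]
  simp only [mul_one, one_mul] at h1 h2
  refine ((h1.add h2).add h3).congr_left fun s => ?_
  simp only [Polynomial.eval_sub, Polynomial.eval_mul]
  ring

/-- Multiplication by `s` improves the order of an expansion. -/
theorem HasExp.id_mul (hf : HasExp k f a) : HasExp (k + 1) (fun s => s * f s) (X * a) := by
  have h1 : trunc (k + 1 + 1) (X * a) = Polynomial.X * trunc (k + 1) a := by
    ext j
    rw [coeff_trunc]
    rcases j with _ | j
    · simp
    · rw [Polynomial.coeff_X_mul, coeff_succ_X_mul, coeff_trunc]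
      simp
  have h2 := (isBigO_refl (fun s : ℝ => s) (𝓝[>] 0)).mul_isLittleO hf
  rw [HasExp, h1]
  refine (h2.congr_left fun s => ?_).congr_right fun s => ?_
  · rw [Polynomial.eval_mul, Polynomial.eval_X]; ring
  · ring

theorem HasExp.mono {j : ℕ} (hf : HasExp k f a) (hj : j ≤ k) : HasExp j f a := by
  have h1 : (fun s : ℝ => s ^ k) =O[𝓝[>] 0] fun s => s ^ j := by
    obtain ⟨d, rfl⟩ := Nat.exists_eq_add_of_le hj
    have := (isBigO_refl (fun s : ℝ => s ^ j) (𝓝[>] 0)).mul (isBigO_pow_one d)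
    simpa [pow_add] using this
  have h2 : (fun s => (trunc (k + 1) a - trunc (j + 1) a).eval s) =o[𝓝[>] 0]
      fun s : ℝ => s ^ j := by
    refine isLittleO_eval_of_coeff fun i hi => ?_
    rw [Polynomial.coeff_sub, coeff_trunc, coeff_trunc, if_pos (by omega), if_pos (by omega),
      sub_self]
  refine ((IsLittleO.trans_isBigO hf h1).add h2).congr_left fun s => ?_
  simp

theorem HasExp.tendsto (hf : HasExp k f a) : Tendsto f (𝓝[>] 0) (𝓝 (coeff 0 a)) := by
  have h := hf.mono (Nat.zero_le k)
  simp only [HasExp, zero_add, trunc_one_left, Polynomial.eval_C, pow_zero, isLittleO_one_iff] at h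
  exact tendsto_sub_nhds_zero_iff.1 h

theorem HasExp.coeff_eq_zero (h : HasExp k (fun _ => 0) a) : ∀ j ≤ k, coeff j a = 0 := by
  intro j
  induction j using Nat.strong_induction_on with
  | _ j ih =>
    intro hj
    have h1 := h.mono hj
    have h2 : trunc (j + 1) a = Polynomial.monomial j (coeff j a) := by
      ext i
      rw [coeff_trunc, Polynomial.coeff_monomial]
      rcases lt_trichotomy i j with hij | rfl | hij
      · rw [if_pos (by omega), if_neg (by omega), ih i hij (by omega)]
      · simp
      · rw [if_neg (by omega), if_neg (by omega)]
    rw [HasExp, h2] at h1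
    have h3 : (fun s : ℝ => coeff j a * s ^ j) =o[𝓝[>] 0] fun s : ℝ => s ^ j := by
      simpa using h1.neg_left
    by_contra hne
    have h4 := (isLittleO_const_mul_left_iff hne).1 h3
    have h5 := isLittleO_irrefl (l := 𝓝[>] (0 : ℝ)) (f'' := fun s : ℝ => s ^ j) (by
      refine (Eventually.frequently ?_)
      filter_upwards [self_mem_nhdsWithin] with s hs
      exact pow_ne_zero _ (ne_of_gt (mem_Ioi.1 hs)))
    exact h5 h4

/-- Asymptotic expansions are unique. -/
theorem HasExp.coeff_eq (hf : HasExp k f a) (hg : HasExp k f b) {j : ℕ} (hj : j ≤ k) :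
    coeff j a = coeff j b := by
  have h := hf.sub hg
  simp only [sub_self] at h
  have h1 := h.coeff_eq_zero j hj
  rw [map_sub] at h1
  exact sub_eq_zero.1 h1

/-- One-sided iterated derivatives do not depend on the set in which they are taken. -/
theorem iteratedDerivWithin_eq_Ici {A B : Set ℝ} (f : ℝ → ℝ) (hBA : B ⊆ A) (hA : A ⊆ Ici 0)
    (hB : ∀ t ∈ B, B ∈ 𝓝[Ici 0] t) (j : ℕ) :
    ∀ t ∈ B, iteratedDerivWithin j f A t = iteratedDerivWithin j f (Ici 0) t := by
  have hnhds : ∀ t ∈ B, 𝓝[A] t = 𝓝[Ici 0] t := fun t ht =>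
    le_antisymm (nhdsWithin_mono t hA) (nhdsWithin_le_iff.2 (mem_of_superset (hB t ht) hBA))
  induction j with
  | zero => intro t _; simp
  | succ j ih =>
    intro t ht
    rw [iteratedDerivWithin_succ, iteratedDerivWithin_succ]
    have h1 : iteratedDerivWithin j f A =ᶠ[𝓝[A] t] iteratedDerivWithin j f (Ici 0) := by
      rw [hnhds t ht]
      filter_upwards [hB t ht] with u hu using ih u hu
    rw [h1.derivWithin_eq (ih t ht),
      derivWithin_congr_set (nhdsWithin_eq_iff_eventuallyEq.1 (hnhds t ht))]

/-- Taylor's formula. -/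
theorem hasExp_of_contDiffOn {s₀ : ℝ} (hs₀ : 0 < s₀) (hf : ContDiffOn ℝ k f (Ico 0 s₀)) :
    HasExp k f (PowerSeries.mk fun j => iteratedDerivWithin j f (Ici 0) 0 / (j.factorial : ℝ)) := by
  have h := taylor_isLittleO (convex_Ico 0 s₀) (x₀ := 0) ⟨le_rfl, hs₀⟩ hf
  have hle : 𝓝[>] (0 : ℝ) ≤ 𝓝[Ico 0 s₀] 0 := by
    rw [nhdsWithin_Ico_eq ⟨le_rfl, hs₀⟩]
    exact nhdsWithin_mono _ Ioi_subset_Ici_self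
  refine ((h.mono hle).congr_left fun s => ?_).congr_right fun s => by rw [sub_zero]
  rw [taylor_within_apply, trunc_apply]
  congr 1
  rw [Polynomial.eval_finsetSum, Nat.Ico_zero_eq_range]
  refine Finset.sum_congr rfl fun j _ => ?_
  rw [iteratedDerivWithin_eq_Ici f Subset.rfl Ico_subset_Ici_self (fun t ht => by
    rw [← nhdsWithin_Ico_eq ht]; exact self_mem_nhdsWithin) j 0 ⟨le_rfl, hs₀⟩]
  simp
  ring

end

/-! ### The expansions of a graph and of its mean curvature -/

open PowerSeries in
/-- The Taylor series in `s` at `(y, 0)`. -/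
def jet (φ : S2 → ℝ → ℝ) (y : S2) : PowerSeries ℝ :=
  PowerSeries.mk fun j => bdry j φ y / (j.factorial : ℝ)

/-- The Taylor series of `Δφ` in terms of the derivatives of `φ` at `s = 0`. -/
def lapJet (φ : S2 → ℝ → ℝ) (y : S2) : PowerSeries ℝ :=
  PowerSeries.mk fun j => sphereLap (bdry j φ) y / (j.factorial : ℝ)

/-- The Taylor series of `⟨∇φ, ∇ψ⟩` in terms of the derivatives of `φ` and `ψ` at `s = 0`. -/
def gradJet (φ ψ : S2 → ℝ → ℝ) (y : S2) : PowerSeries ℝ :=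
  PowerSeries.mk fun j => ∑ p ∈ Finset.HasAntidiagonal.antidiagonal j,
    gradInner (bdry p.1 φ) (bdry p.2 ψ) y / ((p.1.factorial : ℝ) * (p.2.factorial : ℝ))

/-- The Taylor series of `1 + s² (1 - 2ms) P_s` in terms of that of `P`. -/
def gradSSeries (m : ℝ) (p : PowerSeries ℝ) : PowerSeries ℝ :=
  PowerSeries.C 1 + PowerSeries.X * (PowerSeries.X * ((PowerSeries.C 1
    - PowerSeries.C (2 * m) * PowerSeries.X) * d⁄dX ℝ p))

section
open PowerSeries
variable {m : ℝ} {k : ℕ} {n : ℕ∞ω} {U : Set S2} {s₀ : ℝ} {φ ψ P H : S2 → ℝ → ℝ} {y : S2}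

theorem coeff_jet (j : ℕ) (φ : S2 → ℝ → ℝ) (y : S2) :
    coeff j (jet φ y) = bdry j φ y / (j.factorial : ℝ) := coeff_mk _ _

theorem coeff_lapJet (j : ℕ) (φ : S2 → ℝ → ℝ) (y : S2) :
    coeff j (lapJet φ y) = sphereLap (bdry j φ) y / (j.factorial : ℝ) := coeff_mk _ _

theorem coeff_gradJet (j : ℕ) (φ ψ : S2 → ℝ → ℝ) (y : S2) :
    coeff j (gradJet φ ψ y) = ∑ p ∈ Finset.HasAntidiagonal.antidiagonal j,
      gradInner (bdry p.1 φ) (bdry p.2 ψ) y / ((p.1.factorial : ℝ) * (p.2.factorial : ℝ)) :=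
  coeff_mk _ _

theorem Reg.contDiffOn_slice (h : Reg n U s₀ φ) (hy : y ∈ U) : ContDiffOn ℝ n (φ y) (Ico 0 s₀) := by
  have h1 : ContDiffOn ℝ n (fun s : ℝ => ((y : E3), s)) (Ico 0 s₀) :=
    (contDiff_const.prodMk contDiff_id).contDiffOn
  have h2 := ContDiffOn.comp h h1 fun s hs => Set.mk_mem_prod (coe_mem_cone hy) hs
  simpa [Function.comp_def, lift, radial_coe] using h2

theorem Reg.hasExp (h : Reg k U s₀ φ) (hs₀ : 0 < s₀) (hy : y ∈ U) : HasExp k (φ y) (jet φ y) :=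
  hasExp_of_contDiffOn hs₀ (h.contDiffOn_slice hy)

theorem jet_dS (φ : S2 → ℝ → ℝ) (y : S2) : jet (dS φ) y = d⁄dX ℝ (jet φ y) := by
  ext j
  rw [coeff_jet, coeff_derivative, coeff_jet, bdry_succ, Nat.factorial_succ]
  have : (j.factorial : ℝ) ≠ 0 := by positivity
  have : (j : ℝ) + 1 ≠ 0 := by positivity
  push_cast
  field_simp

theorem Reg.hasExp_dS (hU : IsOpen U) (h : Reg (k + 1 : ℕ) U s₀ φ) (hs₀ : 0 < s₀) (hy : y ∈ U) :
    HasExp k (dS φ y) (d⁄dX ℝ (jet φ y)) := by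
  rw [← jet_dS]
  exact (h.reg_dS hU (m := k) (by push_cast; exact le_rfl)).hasExp hs₀ hy

theorem Reg.hasExp_gradInner (hU : IsOpen U) (h : Reg (k + 1 : ℕ) U s₀ φ)
    (h' : Reg (k + 1 : ℕ) U s₀ ψ) (hs₀ : 0 < s₀) (hy : y ∈ U) :
    HasExp k (fun s => gradInner (fun y' => φ y' s) (fun y' => ψ y' s) y) (gradJet φ ψ y) := by
  have hle : (k : ℕ∞ω) + 1 ≤ ((k + 1 : ℕ) : ℕ∞ω) := by push_cast; exact le_rfl
  simp only [gradInner_slice_eq]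
  refine (HasExp.sum (t := Finset.univ) fun i _ => ((h.reg_dX hU hle i).hasExp hs₀ hy).mul
    ((h'.reg_dX hU hle i).hasExp hs₀ hy)).congr_coeff fun j hj => ?_
  have hb : ∀ i (p : ℕ) (hp : p ≤ j), bdry p (dX i φ) y = ang i (bdry p φ) y := fun i p hp =>
    h.bdry_dX hU hs₀ p (by exact_mod_cast (by omega : p + 1 ≤ k + 1)) i hy
  have hb' : ∀ i (p : ℕ) (hp : p ≤ j), bdry p (dX i ψ) y = ang i (bdry p ψ) y := fun i p hp =>
    h'.bdry_dX hU hs₀ p (by exact_mod_cast (by omega : p + 1 ≤ k + 1)) i hy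
  rw [map_sum, coeff_gradJet]
  simp only [coeff_mul, coeff_jet]
  rw [Finset.sum_comm]
  refine Finset.sum_congr rfl fun p hp => ?_
  rw [gradInner_eq_sum, Finset.sum_div]
  refine Finset.sum_congr rfl fun i _ => ?_
  have hp' := Finset.HasAntidiagonal.mem_antidiagonal.1 hp
  rw [hb i p.1 (by omega), hb' i p.2 (by omega), div_mul_div_comm]

theorem Reg.hasExp_sphereLap (hU : IsOpen U) (h : Reg (k + 2 : ℕ) U s₀ φ) (hs₀ : 0 < s₀)
    (hy : y ∈ U) : HasExp k (fun s => sphereLap (fun y' => φ y' s) y) (lapJet φ y) := by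
  have hle : ((k + 1 : ℕ) : ℕ∞ω) + 1 ≤ ((k + 2 : ℕ) : ℕ∞ω) := by
    exact_mod_cast le_rfl
  have hle' : (k : ℕ∞ω) + 1 ≤ ((k + 1 : ℕ) : ℕ∞ω) := by push_cast; exact le_rfl
  have h1 : HasExp k (fun s => ∑ i, dX i (dX i φ) y s) (lapJet φ y) := by
    refine (HasExp.sum (t := Finset.univ) fun i _ =>
      (((h.reg_dX hU hle i).reg_dX hU hle' i).hasExp hs₀ hy)).congr_coeff fun j hj => ?_
    have hr : Reg 2 U s₀ (dS^[j] φ) := h.reg_iterate_dS hU j (by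
      exact_mod_cast (by omega : 2 + j ≤ k + 2))
    have hsm : ContDiffAt ℝ 2 (fun x => bdry j φ (radial x)) (y : E3) := by
      simp only [bdry_eq]
      exact hr.contDiffAt_slice hU (coe_mem_cone hy) ⟨le_rfl, hs₀⟩
    rw [map_sum, coeff_lapJet, sphereLap_eq_sum hsm, Finset.sum_div]
    refine Finset.sum_congr rfl fun i _ => ?_
    rw [coeff_jet, (h.reg_dX hU hle i).bdry_dX hU hs₀ j (by
      exact_mod_cast (by omega : j + 1 ≤ k + 1)) i hy]
    congr 1
    exact ang_congr hU (fun y' hy' => h.bdry_dX hU hs₀ j (by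
      exact_mod_cast (by omega : j + 1 ≤ k + 2)) i hy') i hy
  refine h1.congr ?_
  filter_upwards [Ioo_mem_nhdsGT hs₀] with s hs
  exact h.sphereLap_eq hU (by exact_mod_cast (by omega : 2 ≤ k + 2)) hy (Ioo_subset_Ico_self hs)

theorem Reg.hasExp_gradS (hU : IsOpen U) (h : Reg (k + 1 : ℕ) U s₀ P) (hs₀ : 0 < s₀) (hy : y ∈ U) :
    HasExp k (gradS m P y) (gradSSeries m (jet P y)) := by
  have h1 := ((hasExp_const k 1).sub ((hasExp_id k).const_mul (2 * m))).mul
    (h.hasExp_dS hU hs₀ hy)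
  have h2 := (hasExp_const k 1).add ((hasExp_id k).mul ((hasExp_id k).mul h1))
  refine h2.congr (Eventually.of_forall fun s => ?_)
  simp only [gradS]
  ring

theorem Reg.hasExp_dS_gradS (hU : IsOpen U) (h : Reg (k + 2 : ℕ) U s₀ P) (hs₀ : 0 < s₀)
    (hy : y ∈ U) :
    HasExp k (dS (gradS m P) y)
      (d⁄dX ℝ (gradSSeries m (jet P y))) := by
  have hA : Reg (k + 1 : ℕ) U s₀ (gradS m P) :=
    h.reg_gradS hU (by exact_mod_cast le_rfl)
  refine (hA.hasExp_dS hU hs₀ hy).congr_coeff fun j hj => ?_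
  rw [coeff_derivative, coeff_derivative,
    (hA.hasExp hs₀ hy).coeff_eq (h.hasExp_gradS (m := m) hU hs₀ hy) (by omega)]

/-- The relation between the Taylor series of `L` and `P`. -/
theorem coeff_jet_Lfun (hU : IsOpen U) (hs₀ : 0 < s₀) (hP : Reg (k + 1 : ℕ) U s₀ P) (hy : y ∈ U)
    {j : ℕ} (hj : j ≤ k) :
    coeff j (jet (Lfun m P) y) = coeff j (-(C 2 * d⁄dX ℝ (jet P y)
      + X * (X * ((C 1 - C (2 * m) * X)
        * (d⁄dX ℝ (jet P y) * d⁄dX ℝ (jet P y))))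
      + gradJet P P y)) := by
  have h0 : Reg k U s₀ (Lfun m P) := hP.reg_Lfun hU (by push_cast; exact le_rfl)
  have hd := hP.hasExp_dS hU hs₀ hy
  have h1 := ((hasExp_const k 1).sub ((hasExp_id k).const_mul (2 * m))).mul (hd.mul hd)
  have h2 := (((hd.const_mul 2).add ((hasExp_id k).mul ((hasExp_id k).mul h1))).add
    (hP.hasExp_gradInner hU hP hs₀ hy)).neg
  refine (h0.hasExp hs₀ hy).coeff_eq (h2.congr (Eventually.of_forall fun s => ?_)) hj
  rw [Lfun]
  simp only [dS]
  ring

theorem Reg.reg_sqrt_Lfun (hU : IsOpen U) (hP : Reg (k + 1 : ℕ) U s₀ P)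
    (hL : ∀ y ∈ U, ∀ s ∈ Ico 0 s₀, 0 < Lfun m P y s) :
    Reg k U s₀ (fun y s => √(Lfun m P y s)) := by
  have h0 : Reg k U s₀ (Lfun m P) := hP.reg_Lfun hU (by push_cast; exact le_rfl)
  exact ContDiffOn.sqrt h0 fun p hp => (hL _ hp.1.2 _ hp.2).ne'

theorem coeff_jet_sqrt_mul_self (hU : IsOpen U) (hs₀ : 0 < s₀) (hP : Reg (k + 1 : ℕ) U s₀ P)
    (hL : ∀ y ∈ U, ∀ s ∈ Ico 0 s₀, 0 < Lfun m P y s) (hy : y ∈ U) {j : ℕ} (hj : j ≤ k) :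
    coeff j (jet (fun y s => √(Lfun m P y s)) y * jet (fun y s => √(Lfun m P y s)) y)
      = coeff j (jet (Lfun m P) y) := by
  have hw := (hP.reg_sqrt_Lfun hU hL).hasExp hs₀ hy
  have h0 : Reg k U s₀ (Lfun m P) := hP.reg_Lfun hU (by push_cast; exact le_rfl)
  refine ((hw.mul hw).congr ?_).coeff_eq (h0.hasExp hs₀ hy) hj
  filter_upwards [Ioo_mem_nhdsGT hs₀] with s hs
  exact (Real.mul_self_sqrt (hL y hy s (Ioo_subset_Ico_self hs)).le).symm

/-- The equation of prescribed mean curvature, as a relation between Taylor series up to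
order `k + 1`. -/
theorem coeff_meanCurvature_equation (hU : IsOpen U) (hs₀ : 0 < s₀)
    (hP : Reg (k + 2 : ℕ) U s₀ P) (hH : Reg (k + 1 : ℕ) U s₀ H)
    (hL : ∀ y ∈ U, ∀ s ∈ Ico 0 s₀, 0 < Lfun m P y s)
    (hmean : ∀ y ∈ U, ∀ s ∈ Ioo 0 s₀, graphMeanCurvature m P y s = H y s) (hy : y ∈ U)
    {j : ℕ} (hj : j ≤ k + 1) :
    coeff j (C 3 * (jet H y * (jet (Lfun m P) y * jet (fun y s => √(Lfun m P y s)) y)))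
      = coeff j (C 3 * (jet (Lfun m P) y * gradSSeries m (jet P y))
        + C (1 / 2) * (X * (d⁄dX ℝ (jet (Lfun m P) y) * gradSSeries m (jet P y)))
        - X * (jet (Lfun m P) y * d⁄dX ℝ (gradSSeries m (jet P y)))
        - X * (jet (Lfun m P) y * lapJet P y)
        + C (1 / 2) * (X * gradJet (Lfun m P) P y)) := by
  have hP1 : Reg (k + 1 + 1 : ℕ) U s₀ P := hP
  have hP2 : Reg (k + 1 : ℕ) U s₀ P := hP.of_le (by exact_mod_cast Nat.le_succ _)
  have hLr : Reg (k + 1 : ℕ) U s₀ (Lfun m P) := hP.reg_Lfun hU (by exact_mod_cast le_rfl)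
  have hl := hLr.hasExp hs₀ hy
  have hl' := hl.mono (Nat.le_succ k)
  have hA := hP1.hasExp_gradS (m := m) hU hs₀ hy
  have hA' := hA.mono (Nat.le_succ k)
  have e1 := ((hH.hasExp hs₀ hy).mul (hl.mul ((hP1.reg_sqrt_Lfun hU hL).hasExp hs₀ hy))).const_mul 3
  have e2 := (((((hl.mul hA).const_mul 3).add
    ((((hLr.hasExp_dS hU hs₀ hy).mul hA').id_mul).const_mul (1 / 2))).sub
    ((hl'.mul (hP.hasExp_dS_gradS (m := m) hU hs₀ hy)).id_mul)).sub
    ((hl'.mul (hP.hasExp_sphereLap hU hs₀ hy)).id_mul)).add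
    (((hLr.hasExp_gradInner hU hP2 hs₀ hy).id_mul).const_mul (1 / 2))
  refine e1.coeff_eq (e2.congr ?_) hj
  filter_upwards [Ioo_mem_nhdsGT hs₀] with s hs
  have h := meanCurvature_equation (m := m) hU
    (hP.of_le (by exact_mod_cast (by omega : 2 ≤ k + 2)))
    (fun y hy s hs => hL y hy s (Ioo_subset_Ico_self hs)) hy hs
  rw [hmean y hy s hs] at h
  rw [← mul_assoc, h]
  ring

end

/-! ### The relations of order at most three at `s = 0` -/

section
open PowerSeries
variable {m : ℝ} {k : ℕ} {n : ℕ∞ω} {U : Set S2} {s₀ : ℝ} {φ ψ P H : S2 → ℝ → ℝ} {y : S2}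

theorem coeff_one_mul_expand (a b : PowerSeries ℝ) :
    coeff 1 (a * b) = coeff 0 a * coeff 1 b + coeff 1 a * coeff 0 b := by
  simp [coeff_mul, Finset.Nat.antidiagonal_succ]

theorem coeff_two_mul_expand (a b : PowerSeries ℝ) :
    coeff 2 (a * b) = coeff 0 a * coeff 2 b + coeff 1 a * coeff 1 b + coeff 2 a * coeff 0 b := by
  simp [coeff_mul, Finset.Nat.antidiagonal_succ]; ring

theorem coeff_three_mul_expand (a b : PowerSeries ℝ) :
    coeff 3 (a * b) = coeff 0 a * coeff 3 b + coeff 1 a * coeff 2 b + coeff 2 a * coeff 1 b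
      + coeff 3 a * coeff 0 b := by
  simp [coeff_mul, Finset.Nat.antidiagonal_succ]; ring

theorem coeff_zero_mul_expand (a b : PowerSeries ℝ) :
    coeff 0 (a * b) = coeff 0 a * coeff 0 b := by
  simp

theorem coeff_zero_gradSSeries (p : PowerSeries ℝ) : coeff 0 (gradSSeries m p) = 1 := by
  simp [gradSSeries]

theorem coeff_one_gradSSeries (p : PowerSeries ℝ) : coeff 1 (gradSSeries m p) = 0 := by
  rw [gradSSeries, map_add, coeff_C, coeff_succ_X_mul, coeff_zero_X_mul]
  simp

theorem coeff_two_gradSSeries (p : PowerSeries ℝ) : coeff 2 (gradSSeries m p) = coeff 1 p := by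
  rw [gradSSeries, map_add, coeff_C, coeff_succ_X_mul, coeff_succ_X_mul, coeff_zero_mul_expand,
    coeff_derivative]
  simp

theorem coeff_three_gradSSeries (p : PowerSeries ℝ) :
    coeff 3 (gradSSeries m p) = 2 * coeff 2 p - 2 * m * coeff 1 p := by
  rw [gradSSeries, map_add, coeff_C, coeff_succ_X_mul, coeff_succ_X_mul, coeff_one_mul_expand,
    coeff_derivative, coeff_derivative]
  simp [coeff_C]
  ring

theorem gradInner_comm (f g : S2 → ℝ) (y : S2) : gradInner f g y = gradInner g f y := by
  simp only [gradInner_eq_sum]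
  exact Finset.sum_congr rfl fun i _ => mul_comm _ _

/-- The relations between the boundary derivatives of `L` and `P`. -/
theorem bdryL_relations (hU : IsOpen U) (hs₀ : 0 < s₀) (hP : Reg 4 U s₀ P) (hy : y ∈ U) :
    bdryL 0 m P y = -(2 * bdry 1 P y + gradInner (bdry 0 P) (bdry 0 P) y) ∧
    bdryL 1 m P y = -(2 * bdry 2 P y + 2 * gradInner (bdry 1 P) (bdry 0 P) y) ∧
    bdryL 2 m P y = -(2 * bdry 3 P y + 2 * bdry 1 P y ^ 2 + 2 * gradInner (bdry 2 P) (bdry 0 P) y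
      + 2 * gradInner (bdry 1 P) (bdry 1 P) y) := by
  have hP' : Reg (3 + 1 : ℕ) U s₀ P := hP.of_le (by norm_num)
  have e0 := coeff_jet_Lfun (m := m) hU hs₀ hP' hy (j := 0) (by norm_num)
  have e1 := coeff_jet_Lfun (m := m) hU hs₀ hP' hy (j := 1) (by norm_num)
  have e2 := coeff_jet_Lfun (m := m) hU hs₀ hP' hy (j := 2) (by norm_num)
  simp only [map_neg, map_add, coeff_C_mul, coeff_zero_X_mul, coeff_succ_X_mul, coeff_derivative,
    coeff_jet, coeff_gradJet, coeff_zero_mul_expand, map_sub, coeff_C, Finset.Nat.antidiagonal_succ]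
    at e0 e1 e2
  simp [Nat.factorial] at e0 e1 e2
  rw [gradInner_comm (bdry 0 P) (bdry 1 P)] at e1
  rw [gradInner_comm (bdry 0 P) (bdry 2 P)] at e2
  refine ⟨?_, ?_, ?_⟩
  · rw [bdryL, e0]; ring
  · rw [bdryL, e1]; ring
  · rw [bdryL]; linarith

theorem coeff_zero_jet (φ : S2 → ℝ → ℝ) (y : S2) : coeff 0 (jet φ y) = φ y 0 := by
  rw [coeff_jet, bdry_zero]; simp

theorem ang_invSqH {H : S2 → ℝ → ℝ}
    (hd : DifferentiableAt ℝ (fun x => bdry 0 H (radial x)) (y : E3)) (h0 : bdry 0 H y ≠ 0)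
    (i : Fin 3) : ang i (invSqH H) y = -2 * (bdry 0 H y ^ 3)⁻¹ * ang i (bdry 0 H) y := by
  have h1 := (hasDerivAt_pow 2 (bdry 0 H (radial (y : E3)))).fun_inv
    (by rw [radial_coe]; exact pow_ne_zero 2 h0)
  have h2 := HasDerivAt.comp_hasFDerivAt (h₂ := fun t : ℝ => (t ^ 2)⁻¹)
    (f := fun x => bdry 0 H (radial x)) (y : E3) h1 hd.hasFDerivAt
  change HasFDerivAt (fun x => invSqH H (radial x)) _ (y : E3) at h2
  rw [ang, h2.fderiv]
  simp [ang, radial_coe]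
  field_simp

theorem gradInner_invSqH {H : S2 → ℝ → ℝ}
    (hd : DifferentiableAt ℝ (fun x => bdry 0 H (radial x)) (y : E3)) (h0 : bdry 0 H y ≠ 0)
    (f : S2 → ℝ) :
    gradInner (invSqH H) f y = -2 * (bdry 0 H y ^ 3)⁻¹ * gradInner (bdry 0 H) f y := by
  rw [gradInner_eq_sum, gradInner_eq_sum, Finset.mul_sum]
  exact Finset.sum_congr rfl fun i _ => by rw [ang_invSqH hd h0]; ring

theorem Reg.differentiableAt_bdry (hU : IsOpen U) (hs₀ : 0 < s₀) (h : Reg (k + 1 : ℕ) U s₀ φ)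
    (hy : y ∈ U) : DifferentiableAt ℝ (fun x => bdry k φ (radial x)) (y : E3) := by
  simp only [bdry_eq]
  exact (h.reg_iterate_dS hU (m := 1) k (by push_cast; rw [add_comm])).differentiableAt_slice hU
    le_rfl hy ⟨le_rfl, hs₀⟩

/-- The equation of prescribed mean curvature at orders one, two and three, at `s = 0`. At order
three `L_sss` drops out, because its coefficient is a multiple of `3 - 3`. -/
theorem boundary_relations (hU : IsOpen U) (hs₀ : 0 < s₀) (hP : Reg 4 U s₀ P) (hH : Reg 4 U s₀ H)
    (hL : ∀ y ∈ U, ∀ s ∈ Ico 0 s₀, 0 < Lfun m P y s)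
    (hmean : ∀ y ∈ U, ∀ s ∈ Ioo 0 s₀, graphMeanCurvature m P y s = H y s)
    (hL0 : ∀ y ∈ U, bdryL 0 m P y = invSqH H y) (hpos : ∀ y ∈ U, 0 < bdry 0 H y) (hy : y ∈ U) :
    (bdryL 1 m P y = -invSqH H y * (sphereLap (bdry 0 P) y
        + (bdry 0 H y)⁻¹ * gradInner (bdry 0 H) (bdry 0 P) y)
      - 3 * (bdry 0 H y ^ 3)⁻¹ * bdry 1 H y) ∧
    (bdry 1 H y = 0 → bdryL 2 m P y =
      -(9 / 2) * bdry 0 H y ^ 2 * bdryL 1 m P y ^ 2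
      - 4 * (bdryL 1 m P y * sphereLap (bdry 0 P) y + bdryL 0 m P y * sphereLap (bdry 1 P) y)
      + 2 * gradInner (bdryL 1 m P) (bdry 0 P) y
      + 2 * gradInner (invSqH H) (bdry 1 P) y
      + 4 * invSqH H y * bdry 1 P y - 6 * (bdry 0 H y ^ 3)⁻¹ * bdry 2 H y) ∧
    (bdry 1 H y = 0 → bdry 2 H y = 0 → Compatibility m P H y) := by
  have hP' : Reg (2 + 2 : ℕ) U s₀ P := hP.of_le (by norm_num)
  have hP'' : Reg (3 + 1 : ℕ) U s₀ P := hP.of_le (by norm_num)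
  have hH' : Reg (2 + 1 : ℕ) U s₀ H := hH.of_le (by norm_num)
  have e1 := coeff_meanCurvature_equation hU hs₀ hP' hH' hL hmean hy (j := 1) (by norm_num)
  have e2 := coeff_meanCurvature_equation hU hs₀ hP' hH' hL hmean hy (j := 2) (by norm_num)
  have e3 := coeff_meanCurvature_equation hU hs₀ hP' hH' hL hmean hy (j := 3) (by norm_num)
  have f1 := coeff_jet_sqrt_mul_self hU hs₀ hP'' hL hy (j := 1) (by norm_num)
  have f2 := coeff_jet_sqrt_mul_self hU hs₀ hP'' hL hy (j := 2) (by norm_num)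
  have f3 := coeff_jet_sqrt_mul_self hU hs₀ hP'' hL hy (j := 3) (by norm_num)
  simp only [map_sub, map_add, coeff_C_mul, coeff_succ_X_mul, coeff_derivative,
    coeff_jet, coeff_gradJet, coeff_lapJet, coeff_zero_mul_expand, coeff_one_mul_expand,
    coeff_two_mul_expand, coeff_three_mul_expand, coeff_zero_gradSSeries, coeff_one_gradSSeries,
    coeff_two_gradSSeries, coeff_three_gradSSeries, Finset.Nat.antidiagonal_succ]
    at e1 e2 e3 f1 f2 f3
  simp [Nat.factorial] at e1 e2 e3 f1 f2 f3
  simp [coeff_one_gradSSeries, coeff_two_gradSSeries, coeff_three_gradSSeries, coeff_jet,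
    Nat.factorial] at e1 e2 e3
  have hg : ∀ b, gradInner (bdry 0 (Lfun m P)) (bdry b P) y = gradInner (invSqH H) (bdry b P) y :=
    fun b => gradInner_congr hU hL0 (fun _ _ => rfl) hy
  have hd : DifferentiableAt ℝ (fun x => bdry 0 H (radial x)) (y : E3) :=
    Reg.differentiableAt_bdry (k := 0) hU hs₀ (hH.of_le (by norm_num)) hy
  have hh := hpos y hy
  have hG := gradInner_invSqH hd hh.ne' (bdry 0 P)
  have hw0 : bdry 0 (fun y s => √(Lfun m P y s)) y = (bdry 0 H y)⁻¹ := by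
    have h1 : Lfun m P y 0 = (bdry 0 H y ^ 2)⁻¹ := by
      have := hL0 y hy
      rwa [bdryL, bdry_zero, invSqH] at this
    rw [bdry_zero (fun y s => √(Lfun m P y s)), h1, Real.sqrt_inv, Real.sqrt_sq hh.le]
  have hl0 : bdry 0 (Lfun m P) y = (bdry 0 H y ^ 2)⁻¹ := hL0 y hy
  simp only [hg, hw0, hl0] at e1 e2 e3 f1 f2 f3
  have hI : invSqH H y = (bdry 0 H y ^ 2)⁻¹ := rfl
  simp only [Compatibility, bdryL, hl0, hI]
  generalize bdry 1 (fun y s => √(Lfun m P y s)) y = w1 at e1 e2 e3 f1 f2 f3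
  generalize bdry 2 (fun y s => √(Lfun m P y s)) y = w2 at e1 e2 e3 f1 f2 f3
  generalize bdry 3 (fun y s => √(Lfun m P y s)) y = w3 at e1 e2 e3 f1 f2 f3
  generalize gradInner (invSqH H) (bdry 0 P) y = G0 at *
  generalize gradInner (invSqH H) (bdry 1 P) y = G1 at *
  generalize gradInner (invSqH H) (bdry 2 P) y = G2 at *
  generalize gradInner (bdry 1 (Lfun m P)) (bdry 0 P) y = g10 at *
  generalize gradInner (bdry 1 (Lfun m P)) (bdry 1 P) y = g11 at *
  generalize gradInner (bdry 2 (Lfun m P)) (bdry 0 P) y = g20 at *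
  generalize gradInner (bdry 0 H) (bdry 0 P) y = Y at *
  generalize sphereLap (bdry 0 P) y = q0 at *
  generalize sphereLap (bdry 1 P) y = q1 at *
  generalize sphereLap (bdry 2 P) y = q2 at *
  generalize bdry 1 (Lfun m P) y = l1 at *
  generalize bdry 2 (Lfun m P) y = l2 at *
  generalize bdry 3 (Lfun m P) y = l3 at *
  generalize bdry 1 P y = p1 at *
  generalize bdry 2 P y = p2 at *
  generalize bdry 1 H y = h1 at *
  generalize bdry 2 H y = h2 at *
  generalize bdry 3 H y = h3 at *
  generalize bdry 0 H y = h at *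
  clear hI hg hw0 hl0 hd hL0 hpos hL hmean
  have hne := hh.ne'
  -- `√L √L = L` gives the derivatives of `√L` in terms of those of `L`.
  have k1 : w1 = h * l1 / 2 := by field_simp at f1; linarith
  subst k1
  have k2 : w2 = h * (l2 - h ^ 2 * l1 ^ 2 / 2) / 2 := by
    field_simp at f2 ⊢; linarith
  subst k2
  have k3 : w3 = h * (l3 - 3 / 2 * h ^ 2 * l1 * (l2 - h ^ 2 * l1 ^ 2 / 2)) / 2 := by
    field_simp at f3 ⊢; linarith
  subst k3
  subst hG
  have r1 : l1 = -(h ^ 2)⁻¹ * (q0 + h⁻¹ * Y) - 3 * (h ^ 3)⁻¹ * h1 := by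
    field_simp at e1 ⊢; linarith
  refine ⟨r1, ?_, ?_⟩
  · rintro rfl
    field_simp at e2 ⊢
    linarith
  · rintro rfl rfl
    -- The formula for `L_s` eliminates `⟨∇H₀, ∇P⟩`.
    have r1' : Y = -(h ^ 3 * l1 + h * q0) := by
      rw [r1]; field_simp; ring
    subst r1'
    field_simp at e3 ⊢
    linarith

end

/-! ### The order of `H - H₀` at `s = 0` -/

section
open PowerSeries
variable {m : ℝ} {k : ℕ} {n : ℕ∞ω} {U : Set S2} {s₀ : ℝ} {φ ψ P H : S2 → ℝ → ℝ} {y : S2}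

theorem Reg.continuousOn (h : Reg n U s₀ φ) :
    ContinuousOn (fun p : S2 × ℝ => φ p.1 p.2) (U ×ˢ Ico 0 s₀) := by
  have h1 : ContinuousOn (fun p : S2 × ℝ => ((p.1 : E3), p.2)) (U ×ˢ Ico 0 s₀) := by fun_prop
  have h2 := (ContDiffOn.continuousOn h).comp h1
    fun p hp => Set.mk_mem_prod (coe_mem_cone hp.1) hp.2
  simpa [Function.comp_def, lift, radial_coe] using h2

/-- If `H - H₀` is of order `s^(k+1)`, then it has the expansion zero up to order `k`. -/
theorem OrderS.bdry_eq_zero (h : OrderS (k + 1) U s₀ (fun y s => H y s - H y 0))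
    (hs₀ : 0 < s₀) (hH : Reg k U s₀ H) (hy : y ∈ U) {j : ℕ} (hj : 1 ≤ j) (hjk : j ≤ k) :
    bdry j H y = 0 := by
  obtain ⟨ψ, hψ, hφ⟩ := h
  have h1 := (hH.hasExp hs₀ hy).sub (hasExp_const k (H y 0))
  have hlim : Tendsto (ψ y) (𝓝[>] 0) (𝓝 (ψ y 0)) := by
    have hc := (hψ (y, 0) ⟨hy, le_rfl, hs₀⟩).comp (f := fun s : ℝ => (y, s)) (s := Ico 0 s₀)
      (x := 0) (by fun_prop) fun s hs => Set.mk_mem_prod hy hs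
    refine Tendsto.mono_left hc ?_
    rw [nhdsWithin_Ico_eq ⟨le_rfl, hs₀⟩]
    exact nhdsWithin_mono _ Ioi_subset_Ici_self
  have h2 : HasExp k (fun s => H y s - H y 0) 0 := by
    have h3 : (fun s : ℝ => s * ψ y s) =o[𝓝[>] 0] fun _ => (1 : ℝ) := by
      rw [isLittleO_one_iff]
      have : Tendsto (fun s : ℝ => s) (𝓝[>] (0 : ℝ)) (𝓝 0) := nhdsWithin_le_nhds
      simpa using this.mul hlim
    have h4 := (isBigO_refl (fun s : ℝ => s ^ k) (𝓝[>] 0)).mul_isLittleO h3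
    refine (h4.congr' ?_ ?_)
    · filter_upwards [Ioo_mem_nhdsGT hs₀] with s hs
      have h6 : H y s - H y 0 = s ^ (k + 1) * ψ y s := hφ y hy s hs
      rw [h6]
      simp
      ring
    · exact Eventually.of_forall fun s => by simp
  have h5 := h1.coeff_eq h2 hjk
  rw [map_sub, coeff_jet, coeff_C, if_neg (by omega), map_zero, sub_zero, div_eq_zero_iff] at h5
  exact h5.resolve_right (by positivity)

/-- Taylor's formula with the remainder in Lagrange's form, all of whose terms but the first
vanish. -/
theorem Reg.exists_taylor_remainder (hH : Reg (k + 1 : ℕ) U s₀ H)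
    (h0 : ∀ y ∈ U, ∀ j, 1 ≤ j → j ≤ k → bdry j H y = 0) (hy : y ∈ U) {s : ℝ} (hs : s ∈ Ioo 0 s₀) :
    ∃ t ∈ Icc 0 s, (H y s - H y 0) / s ^ (k + 1)
      = (dS^[k + 1] H) y t / ((k + 1).factorial : ℝ) := by
  have hc : ContDiffOn ℝ (k + 1) (H y) (Icc 0 s) := by
    refine (ContDiffOn.of_le (hH.contDiffOn_slice hy) (by norm_cast)).mono ?_
    exact Icc_subset_Ico_right hs.2
  obtain ⟨t, ht, h⟩ := taylor_mean_remainder_lagrange_iteratedDeriv hs.1.ne (by rwa [uIcc_of_le hs.1.le])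
  rw [uIoo_of_le hs.1.le] at ht
  refine ⟨t, Ioo_subset_Icc_self ht, ?_⟩
  rw [uIcc_of_le hs.1.le] at h
  have hT : taylorWithinEval (H y) k (Icc 0 s) 0 s = H y 0 := by
    rw [taylor_within_apply, Finset.sum_range_succ', Finset.sum_eq_zero]
    · simp
    · intro j hj
      rw [iteratedDerivWithin_eq_Ici (B := Ico 0 s) _ Ico_subset_Icc_self Icc_subset_Ici_self
        (fun t ht => by rw [← nhdsWithin_Ico_eq ht]; exact self_mem_nhdsWithin) _ 0
        ⟨le_rfl, hs.1⟩]
      have := h0 y hy (j + 1) (by omega) (by have := Finset.mem_range.1 hj; omega)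
      rw [bdry] at this
      rw [this, smul_zero]
  have hD : iteratedDeriv (k + 1) (H y) t = (dS^[k + 1] H) y t := by
    rw [iterate_dS, iteratedDerivWithin_eq_iteratedDeriv (uniqueDiffOn_Ici 0) ?_ ht.1.le]
    exact ((hH.contDiffOn_slice hy) t ⟨ht.1.le, ht.2.trans hs.2⟩).contDiffAt
      (Ico_mem_nhds ht.1 (ht.2.trans hs.2))
  rw [hT, hD, sub_zero] at h
  rw [h]
  have : s ^ (k + 1) ≠ 0 := pow_ne_zero _ hs.1.ne'
  field_simp

/-- If `∂_s^j H` vanishes on `U` at `s = 0` for `1 ≤ j ≤ k`, then `H - H₀` is of order `s^(k+1)`: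
the quotient `(H - H₀) / s^(k+1)` is the value of `∂_s^(k+1) H / (k+1)!` at a point of `[0, s]`, so
that it extends continuously to `s = 0`. -/
theorem orderS_of_bdry_eq_zero (hU : IsOpen U) (hs₀ : 0 < s₀) (hH : Reg (k + 1 : ℕ) U s₀ H)
    (h0 : ∀ y ∈ U, ∀ j, 1 ≤ j → j ≤ k → bdry j H y = 0) :
    OrderS (k + 1) U s₀ (fun y s => H y s - H y 0) := by
  set G : S2 → ℝ → ℝ := fun y t => (dS^[k + 1] H) y t / ((k + 1).factorial : ℝ) with hG
  have hGc : ContinuousOn (fun p : S2 × ℝ => G p.1 p.2) (U ×ˢ Ico 0 s₀) :=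
    (hH.reg_iterate_dS hU (m := 0) (k + 1) (by simp)).continuousOn.div_const _
  let ψ : S2 → ℝ → ℝ := fun y s => if s = 0 then G y 0 else (H y s - H y 0) / s ^ (k + 1)
  have hex : ∀ p : S2 × ℝ, ∃ t : ℝ, p ∈ U ×ˢ Ico 0 s₀ → t ∈ Icc 0 p.2 ∧ ψ p.1 p.2 = G p.1 t := by
    rintro ⟨y, s⟩
    rcases eq_or_ne s 0 with rfl | hne
    · exact ⟨0, fun _ => ⟨by simp, if_pos rfl⟩⟩
    · by_cases hp : (y, s) ∈ U ×ˢ Ico 0 s₀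
      · obtain ⟨t, ht, h⟩ := hH.exists_taylor_remainder h0 hp.1
          ⟨lt_of_le_of_ne hp.2.1 hne.symm, hp.2.2⟩
        exact ⟨t, fun _ => ⟨ht, by simpa [ψ, hne, hG] using h⟩⟩
      · exact ⟨0, fun h => absurd h hp⟩
  -- `τ` is the intermediate point; it tends to zero with `s`.
  choose τ hτ using hex
  refine ⟨ψ, ?_, fun y hy s hs => ?_⟩
  · rintro ⟨y₀, s₁⟩ hp
    rcases eq_or_ne s₁ 0 with rfl | hne
    · have hmem : ∀ᶠ p in 𝓝[U ×ˢ Ico 0 s₀] (y₀, (0 : ℝ)), p ∈ U ×ˢ Ico 0 s₀ := self_mem_nhdsWithin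
      have h1 : Tendsto (fun p : S2 × ℝ => (p.1, τ p)) (𝓝[U ×ˢ Ico 0 s₀] (y₀, (0 : ℝ)))
          (𝓝[U ×ˢ Ico 0 s₀] (y₀, (0 : ℝ))) := by
        have hfst : Tendsto (fun p : S2 × ℝ => p.1) (𝓝[U ×ˢ Ico 0 s₀] (y₀, (0 : ℝ))) (𝓝 y₀) :=
          (continuous_fst.tendsto (y₀, (0 : ℝ))).mono_left nhdsWithin_le_nhds
        have hsnd : Tendsto (fun p : S2 × ℝ => p.2) (𝓝[U ×ˢ Ico 0 s₀] (y₀, (0 : ℝ))) (𝓝 0) :=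
          (continuous_snd.tendsto (y₀, (0 : ℝ))).mono_left nhdsWithin_le_nhds
        refine tendsto_nhdsWithin_iff.2 ⟨?_, ?_⟩
        · rw [nhds_prod_eq]
          refine hfst.prodMk (tendsto_of_tendsto_of_tendsto_of_le_of_le' tendsto_const_nhds hsnd
            ?_ ?_)
          · filter_upwards [hmem] with p hp using (hτ p hp).1.1
          · filter_upwards [hmem] with p hp using (hτ p hp).1.2
        · filter_upwards [hmem] with p hp
          exact ⟨hp.1, (hτ p hp).1.1, lt_of_le_of_lt (hτ p hp).1.2 hp.2.2⟩
      have h2 := Tendsto.comp (hGc (y₀, 0) hp) h1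
      have h3 : ψ y₀ 0 = G y₀ 0 := if_pos rfl
      rw [ContinuousWithinAt]
      change Tendsto _ _ (𝓝 (ψ y₀ 0))
      rw [h3]
      refine h2.congr' ?_
      filter_upwards [hmem] with p hp using (hτ p hp).2.symm
    · have hHc := hH.continuousOn
      have hH0 : ContinuousOn (fun p : S2 × ℝ => H p.1 0) (U ×ˢ Ico 0 s₀) :=
        hHc.comp (f := fun p : S2 × ℝ => (p.1, (0 : ℝ))) (by fun_prop)
          fun p hp => ⟨hp.1, le_rfl, hs₀⟩
      have h1 : ContinuousWithinAt (fun p : S2 × ℝ => (H p.1 p.2 - H p.1 0) / p.2 ^ (k + 1))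
          (U ×ˢ Ico 0 s₀) (y₀, s₁) :=
        ((hHc _ hp).sub (hH0 _ hp)).div (by fun_prop) (pow_ne_zero _ hne)
      refine h1.congr_of_eventuallyEq ?_ (if_neg hne)
      have h2 : ∀ᶠ p : S2 × ℝ in 𝓝 (y₀, s₁), p.2 ≠ 0 :=
        continuous_snd.continuousAt.eventually_ne hne
      filter_upwards [nhdsWithin_le_nhds h2] with p hp using if_neg hp
  · have : s ^ (k + 1) ≠ 0 := pow_ne_zero _ hs.1.ne'
    simp only [ψ, if_neg hs.1.ne']
    field_simp

/-! ### The boundary value of `L` -/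

/-- At `s = 0` the equation of prescribed mean curvature degenerates to `H₀ L^{3/2} = L`. -/
theorem bdryL_zero_alternative (hU : IsOpen U) (hs₀ : 0 < s₀) (hP : Reg 2 U s₀ P)
    (hH : Reg 1 U s₀ H) (hL : ∀ y ∈ U, ∀ s ∈ Ioo 0 s₀, 0 < Lfun m P y s)
    (hmean : ∀ y ∈ U, ∀ s ∈ Ioo 0 s₀, graphMeanCurvature m P y s = H y s) (hy : y ∈ U) :
    bdryL 0 m P y = 0 ∨ (bdry 0 H y ≠ 0 ∧ bdryL 0 m P y = invSqH H y) := by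
  have hP2 : Reg (0 + 2 : ℕ) U s₀ P := hP
  have hP1 : Reg (0 + 1 : ℕ) U s₀ P := hP.of_le (by norm_num)
  have hLr : Reg (0 + 1 : ℕ) U s₀ (Lfun m P) := hP2.reg_Lfun hU (by norm_num)
  have hl := (hLr.hasExp hs₀ hy).mono (Nat.zero_le 1)
  have hA := hP1.hasExp_gradS (m := m) hU hs₀ hy
  have tH := (hH.hasExp (k := 1) hs₀ hy).tendsto
  have tL := hl.tendsto
  have tR := ((((((hl.mul hA).const_mul 3).add
    ((((hLr.hasExp_dS hU hs₀ hy).mul hA).id_mul.mono (Nat.zero_le 1)).const_mul (1 / 2))).sub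
    ((hl.mul (hP2.hasExp_dS_gradS (m := m) hU hs₀ hy)).id_mul.mono (Nat.zero_le 1))).sub
    ((hl.mul (hP2.hasExp_sphereLap hU hs₀ hy)).id_mul.mono (Nat.zero_le 1))).add
    (((hLr.hasExp_gradInner hU hP1 hs₀ hy).id_mul.mono (Nat.zero_le 1)).const_mul (1 / 2))).tendsto
  simp only [map_sub, map_add, coeff_C_mul, coeff_zero_mul_expand, coeff_zero_X_mul,
    coeff_zero_gradSSeries, coeff_zero_jet] at tR
  rw [coeff_zero_jet] at tH tL
  have tW := (Real.continuous_sqrt.tendsto _).comp tL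
  have tE := (tH.const_mul 3).mul (tL.mul tW)
  have he := tendsto_nhds_unique (tE.congr' (by
    filter_upwards [Ioo_mem_nhdsGT hs₀] with s hs
    have h := meanCurvature_equation (m := m) hU hP hL hy hs
    rw [hmean y hy s hs] at h
    rw [Function.comp_apply, h]
    ring)) tR
  -- `L > 0` for `s > 0`, so that `√L` at `s = 0` is a true square root.
  have hn : 0 ≤ Lfun m P y 0 := ge_of_tendsto tL (by
    filter_upwards [Ioo_mem_nhdsGT hs₀] with s hs using (hL y hy s hs).le)
  rw [bdryL, invSqH, bdry_zero, bdry_zero]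
  rcases hn.eq_or_lt with h0 | h0
  · exact Or.inl h0.symm
  · right
    have h1 : H y 0 * √(Lfun m P y 0) = 1 := by
      have h2 : Lfun m P y 0 * (H y 0 * √(Lfun m P y 0)) = Lfun m P y 0 * 1 := by linarith
      exact mul_left_cancel₀ h0.ne' h2
    have h2 : H y 0 ≠ 0 := by rintro h; simp [h] at h1
    refine ⟨h2, eq_inv_of_mul_eq_one_left ?_⟩
    calc Lfun m P y 0 * H y 0 ^ 2 = (H y 0 * √(Lfun m P y 0)) ^ 2 := by
          rw [mul_pow, Real.sq_sqrt hn]; ring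
      _ = 1 := by rw [h1, one_pow]

/-- `H₀ ≥ 0` as a limit of positive values, and `H₀ ≠ 0` where `H₀⁻² > 0`. -/
theorem bdry_zero_pos (hs₀ : 0 < s₀) (hH : Reg 0 U s₀ H)
    (hpos : ∀ y ∈ U, ∀ s ∈ Ioo 0 s₀, 0 < H y s) (hy : y ∈ U) (h : 0 < invSqH H y) :
    0 < bdry 0 H y := by
  have t := (hH.hasExp (k := 0) hs₀ hy).tendsto
  rw [coeff_zero_jet, ← bdry_zero H y] at t
  have hn : 0 ≤ bdry 0 H y := ge_of_tendsto t (by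
    filter_upwards [Ioo_mem_nhdsGT hs₀] with s hs using (hpos y hy s hs).le)
  refine hn.lt_of_ne fun h0 => ?_
  -- Where `H₀ = 0`, the convention `0⁻¹ = 0` gives `invSqH H y = 0`.
  rw [invSqH, ← h0] at h
  simp at h

theorem IsSpacelikeGraph.Lfun_pos (h : IsSpacelikeGraph n m U s₀ P H) (hn : 1 ≤ n)
    (hU : IsOpen U) (h0 : ∀ y ∈ U, 0 < bdryL 0 m P y) :
    ∀ y ∈ U, ∀ s ∈ Ico 0 s₀, 0 < Lfun m P y s := by
  rintro y hy s ⟨hs, hs'⟩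
  rcases hs.eq_or_lt with rfl | hs
  · have := h0 y hy
    rwa [bdryL, bdry_zero] at this
  · exact NullInfinity.Lfun_pos hU (h.regularP.reg.of_le hn) hy ⟨hs, hs'⟩
      (h.spacelike y hy s ⟨hs, hs'⟩)

/-! ### The equivalent forms of the relations -/

/-- The derivative of `|∇P|² = -2 P_s - H₀⁻²` in the direction of `∇P`. -/
theorem gradInner_gradInner_self (hU : IsOpen U) (hs₀ : 0 < s₀) (hP : Reg 4 U s₀ P)
    (hH : Reg 4 U s₀ H) (hL0 : ∀ y ∈ U, bdryL 0 m P y = invSqH H y)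
    (hpos : ∀ y ∈ U, 0 < bdry 0 H y) (hy : y ∈ U) :
    gradInner (fun y' => gradInner (bdry 0 P) (bdry 0 P) y') (bdry 0 P) y
      = -2 * gradInner (bdry 1 P) (bdry 0 P) y
        + 2 * (bdry 0 H y ^ 3)⁻¹ * gradInner (bdry 0 H) (bdry 0 P) y := by
  have hdH : DifferentiableAt ℝ (fun x => bdry 0 H (radial x)) (y : E3) :=
    Reg.differentiableAt_bdry (k := 0) hU hs₀ (hH.of_le (by norm_num)) hy
  have hdP : DifferentiableAt ℝ (fun x => bdry 1 P (radial x)) (y : E3) :=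
    Reg.differentiableAt_bdry (k := 1) hU hs₀ (hP.of_le (by norm_num)) hy
  have hdI : DifferentiableAt ℝ (fun x => invSqH H (radial x)) (y : E3) := by
    have h1 := (hdH.pow 2).inv (by
      simp only [Pi.pow_apply, radial_coe]
      exact pow_ne_zero 2 (hpos y hy).ne')
    exact h1
  have h1 : ∀ y ∈ U, gradInner (bdry 0 P) (bdry 0 P) y = -2 * bdry 1 P y - invSqH H y := by
    intro y hy
    have := (bdryL_relations (m := m) hU hs₀ hP hy).1
    rw [hL0 y hy] at this
    linarith
  rw [gradInner_congr hU h1 (fun _ _ => rfl) hy]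
  have h2 := gradInner_invSqH hdH (hpos y hy).ne' (bdry 0 P)
  have h3 : gradInner (fun y => -2 * bdry 1 P y - invSqH H y) (bdry 0 P) y
      = -2 * gradInner (bdry 1 P) (bdry 0 P) y - gradInner (invSqH H) (bdry 0 P) y := by
    simp only [gradInner_eq_sum, Finset.mul_sum, ← Finset.sum_sub_distrib]
    refine Finset.sum_congr rfl fun i _ => ?_
    rw [ang_sub (hdP.const_mul (-2)) hdI, ang_const_mul _ hdP]
    ring
  rw [h3, h2]
  ring

/-- The properties of the boundary data of a surface of class `C⁴`. -/
theorem boundary_statements (hU : IsOpen U) (hs₀ : 0 < s₀)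
    (h : IsSpacelikeGraph 4 m U s₀ P H)
    (hL0 : ∀ y ∈ U, bdryL 0 m P y = invSqH H y ∧ 0 < bdryL 0 m P y) :
    (∀ y ∈ U, bdry 1 P y =
      -(1 / 2) * (invSqH H y + gradInner (bdry 0 P) (bdry 0 P) y)) ∧
    (OrderS 2 U s₀ (fun y s => H y s - H y 0) ↔ ∀ y ∈ U, FormulaLs m P H y) ∧
    (∀ y ∈ U, (FormulaLs m P H y ↔ FormulaPss P H y)) ∧
    (OrderS 2 U s₀ (fun y s => H y s - H y 0) →
      (OrderS 3 U s₀ (fun y s => H y s - H y 0) ↔ ∀ y ∈ U, FormulaLss m P H y) ∧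
      (∀ y ∈ U, (FormulaLss m P H y ↔ FormulaPsss m P H y))) ∧
    (OrderS 3 U s₀ (fun y s => H y s - H y 0) → ∀ y ∈ U, Compatibility m P H y) := by
  have hP : Reg 4 U s₀ P := h.regularP.reg
  have hH : Reg 4 U s₀ H := h.regularH.reg
  have hLeq : ∀ y ∈ U, bdryL 0 m P y = invSqH H y := fun y hy => (hL0 y hy).1
  have hpos : ∀ y ∈ U, 0 < bdry 0 H y := fun y hy =>
    bdry_zero_pos hs₀ (hH.of_le (by norm_num)) h.positive hy ((hL0 y hy).1 ▸ (hL0 y hy).2)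
  have hL := h.Lfun_pos (by norm_num) hU fun y hy => (hL0 y hy).2
  have hrel := fun y hy => bdryL_relations (m := m) hU hs₀ hP (y := y) hy
  have hR := fun y hy => boundary_relations (y := y) hU hs₀ hP hH hL h.meanCurvature hLeq hpos hy
  have hord2 : OrderS 2 U s₀ (fun y s => H y s - H y 0) ↔ ∀ y ∈ U, bdry 1 H y = 0 := by
    constructor
    · intro ho y hy
      exact ho.bdry_eq_zero (k := 1) hs₀ (hH.of_le (by norm_num)) hy le_rfl le_rfl
    · intro h1
      refine orderS_of_bdry_eq_zero (k := 1) hU hs₀ (hH.of_le (by norm_num)) fun y hy j hj hj' => ?_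
      obtain rfl : j = 1 := by omega
      exact h1 y hy
  have hord3 : OrderS 3 U s₀ (fun y s => H y s - H y 0) ↔
      ∀ y ∈ U, bdry 1 H y = 0 ∧ bdry 2 H y = 0 := by
    constructor
    · intro ho y hy
      exact ⟨ho.bdry_eq_zero (k := 2) hs₀ (hH.of_le (by norm_num)) hy le_rfl (by norm_num),
        ho.bdry_eq_zero (k := 2) hs₀ (hH.of_le (by norm_num)) hy (by norm_num) le_rfl⟩
    · intro h1
      refine orderS_of_bdry_eq_zero (k := 2) hU hs₀ (hH.of_le (by norm_num)) fun y hy j hj hj' => ?_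
      obtain rfl | rfl : j = 1 ∨ j = 2 := by omega
      · exact (h1 y hy).1
      · exact (h1 y hy).2
  have hLs : ∀ y ∈ U, (FormulaLs m P H y ↔ bdry 1 H y = 0) := by
    intro y hy
    have hc : (bdry 0 H y ^ 3)⁻¹ ≠ 0 := inv_ne_zero (pow_ne_zero _ (hpos y hy).ne')
    rw [FormulaLs, (hR y hy).1, sub_eq_self, mul_eq_zero]
    simp [hc]
  have hLss : ∀ y ∈ U, bdry 1 H y = 0 → (FormulaLss m P H y ↔ bdry 2 H y = 0) := by
    intro y hy h1
    have hc : (bdry 0 H y ^ 3)⁻¹ ≠ 0 := inv_ne_zero (pow_ne_zero _ (hpos y hy).ne')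
    rw [FormulaLss, (hR y hy).2.1 h1, sub_eq_self, mul_eq_zero]
    simp [hc]
  refine ⟨?_, ?_, ?_, ?_, ?_⟩
  · intro y hy
    have h1 := (hrel y hy).1
    rw [hLeq y hy] at h1
    linarith
  · rw [hord2]
    exact forall₂_congr fun y hy => (hLs y hy).symm
  · intro y hy
    have h1 := (hrel y hy).2.1
    have h2 := gradInner_gradInner_self hU hs₀ hP hH hLeq hpos hy
    have h3 : invSqH H y * (bdry 0 H y)⁻¹ = (bdry 0 H y ^ 3)⁻¹ := by
      rw [invSqH, ← mul_inv, ← pow_succ]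
    rw [FormulaLs, FormulaPss, h1, h2, ← h3]
    constructor <;> intro h4
    · linear_combination (-1 / 2) * h4
    · linear_combination (-2) * h4
  · intro ho2
    have h1 := hord2.1 ho2
    constructor
    · rw [hord3]
      exact forall₂_congr fun y hy => by rw [hLss y hy (h1 y hy)]; simp [h1 y hy]
    · intro y hy
      have h2 := (hrel y hy).2.2
      rw [FormulaLss, FormulaPsss, h2, hLeq y hy]
      constructor <;> intro h4 <;> linarith
  · intro ho3 y hy
    exact (hR y hy).2.2 (hord3.1 ho3 y hy).1 (hord3.1 ho3 y hy).2

end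

/-! ### Universal expressions for the boundary derivatives -/

/-- Renaming of the symbols of an expression. -/
def DiffExpr.map {ι κ : Type} (r : ι → κ) : DiffExpr ι → DiffExpr κ
  | .const c => .const c
  | .sym i => .sym (r i)
  | .add e₁ e₂ => .add (e₁.map r) (e₂.map r)
  | .mul e₁ e₂ => .mul (e₁.map r) (e₂.map r)
  | .gradInner e₁ e₂ => .gradInner (e₁.map r) (e₂.map r)
  | .lap e => .lap (e.map r)

theorem DiffExpr.eval_map {ι κ : Type} (r : ι → κ) (d : κ → S2 → ℝ) (e : DiffExpr ι) :
    (e.map r).eval d = e.eval (fun i => d (r i)) := by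
  induction e with
  | const c => rfl
  | sym i => rfl
  | add e₁ e₂ h₁ h₂ => simp only [map, eval, h₁, h₂]
  | mul e₁ e₂ h₁ h₂ => simp only [map, eval, h₁, h₂]
  | gradInner e₁ e₂ h₁ h₂ => simp only [map, eval, h₁, h₂]
  | lap e h => simp only [map, eval, h]

/-- The symbols allowed at level `k` are allowed at every higher level. -/
def BdrySym.castLE {k k' : ℕ} (h : k ≤ k') : BdrySym k → BdrySym k'
  | .value => .value
  | .fourth hk => .fourth (hk.trans h)
  | .derH j => .derH (j.castLE h)
  | .invH hk => .invH (hk.trans h)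

theorem bdryData_castLE {k k' : ℕ} (h : k ≤ k') (P H : S2 → ℝ → ℝ) (i : BdrySym k) :
    bdryData k' P H (i.castLE h) = bdryData k P H i := by
  cases i <;> rfl

/-- A surface that is smooth up to `s = 0`, with `L = H₀⁻² > 0` at `s = 0`. -/
structure SmoothData (m : ℝ) (U : Set S2) (s₀ : ℝ) (P H : S2 → ℝ → ℝ) : Prop where
  isOpen : IsOpen U
  pos : 0 < s₀
  graph : IsSpacelikeGraph ∞ m U s₀ P H
  bdryL_eq : ∀ y ∈ U, bdryL 0 m P y = invSqH H y
  bdryL_pos : ∀ y ∈ U, 0 < bdryL 0 m P y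

/-- The function `f P H` on the sphere is given, for all surfaces, by one expression in the symbols
of level `k`. -/
def Expressible (m : ℝ) (k : ℕ) (f : (S2 → ℝ → ℝ) → (S2 → ℝ → ℝ) → S2 → ℝ) : Prop :=
  ∃ e : DiffExpr (BdrySym k), ∀ (U : Set S2) (s₀ : ℝ) (P H : S2 → ℝ → ℝ),
    SmoothData m U s₀ P H → ∀ y ∈ U, f P H y = e.eval (bdryData k P H) y

/-- Each coefficient of degree less than `N` of the power series `a P H y` is given, for all
surfaces, by one expression in the symbols of level `k`. -/
def ExpressibleBelow (m : ℝ) (k N : ℕ)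
    (a : (S2 → ℝ → ℝ) → (S2 → ℝ → ℝ) → S2 → PowerSeries ℝ) : Prop :=
  ∀ j < N, Expressible m k fun P H y => PowerSeries.coeff j (a P H y)

/-- The part of degree less than `k` of a power series. -/
def lowPart (k : ℕ) (a : PowerSeries ℝ) : PowerSeries ℝ :=
  PowerSeries.mk fun j => if j < k then PowerSeries.coeff j a else 0

section
open PowerSeries
variable {m : ℝ} {k k' N : ℕ} {U : Set S2} {s₀ : ℝ} {P H : S2 → ℝ → ℝ} {y : S2}
  {f g : (S2 → ℝ → ℝ) → (S2 → ℝ → ℝ) → S2 → ℝ}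
  {a b : (S2 → ℝ → ℝ) → (S2 → ℝ → ℝ) → S2 → PowerSeries ℝ}

theorem SmoothData.regP (h : SmoothData m U s₀ P H) (k : ℕ) : Reg k U s₀ P :=
  h.graph.regularP.reg.of_le (by exact_mod_cast le_top)

theorem SmoothData.regH (h : SmoothData m U s₀ P H) (k : ℕ) : Reg k U s₀ H :=
  h.graph.regularH.reg.of_le (by exact_mod_cast le_top)

theorem SmoothData.Lfun_pos (h : SmoothData m U s₀ P H) :
    ∀ y ∈ U, ∀ s ∈ Ico 0 s₀, 0 < Lfun m P y s :=
  h.graph.Lfun_pos (by exact_mod_cast le_top) h.isOpen h.bdryL_pos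

theorem SmoothData.bdry_zero_pos (h : SmoothData m U s₀ P H) (hy : y ∈ U) : 0 < bdry 0 H y :=
  NullInfinity.bdry_zero_pos h.pos (h.regH 0) h.graph.positive hy
    (h.bdryL_eq y hy ▸ h.bdryL_pos y hy)

theorem SmoothData.coeff_zero_jet_Lfun (h : SmoothData m U s₀ P H) (hy : y ∈ U) :
    coeff 0 (jet (Lfun m P) y) = (bdry 0 H y)⁻¹ * (bdry 0 H y)⁻¹ := by
  rw [coeff_zero_jet, ← bdry_zero (Lfun m P) y]
  exact (h.bdryL_eq y hy).trans (by rw [invSqH, sq, mul_inv])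

theorem SmoothData.coeff_zero_jet_sqrt (h : SmoothData m U s₀ P H) (hy : y ∈ U) :
    coeff 0 (jet (fun y s => √(Lfun m P y s)) y) = (bdry 0 H y)⁻¹ := by
  have h1 := h.coeff_zero_jet_Lfun hy
  rw [coeff_zero_jet] at h1 ⊢
  rw [h1, Real.sqrt_mul_self (inv_pos.2 (h.bdry_zero_pos hy)).le]

/-! ### Closure properties -/

theorem Expressible.congr (hf : Expressible m k f)
    (h : ∀ U s₀ P H, SmoothData m U s₀ P H → ∀ y ∈ U, g P H y = f P H y) : Expressible m k g := by
  obtain ⟨e, he⟩ := hf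
  exact ⟨e, fun U s₀ P H hd y hy => (h U s₀ P H hd y hy).trans (he U s₀ P H hd y hy)⟩

theorem expressible_const (m : ℝ) (k : ℕ) (c : ℝ) : Expressible m k fun _ _ _ => c :=
  ⟨.const c, fun _ _ _ _ _ _ _ => rfl⟩

theorem expressible_sym (m : ℝ) (i : BdrySym k) : Expressible m k fun P H => bdryData k P H i :=
  ⟨.sym i, fun _ _ _ _ _ _ _ => rfl⟩

theorem Expressible.add (hf : Expressible m k f) (hg : Expressible m k g) :
    Expressible m k fun P H y => f P H y + g P H y := by
  obtain ⟨e, he⟩ := hf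
  obtain ⟨e', he'⟩ := hg
  refine ⟨.add e e', fun U s₀ P H hd y hy => ?_⟩
  simp only [he U s₀ P H hd y hy, he' U s₀ P H hd y hy]
  rfl

theorem Expressible.mul (hf : Expressible m k f) (hg : Expressible m k g) :
    Expressible m k fun P H y => f P H y * g P H y := by
  obtain ⟨e, he⟩ := hf
  obtain ⟨e', he'⟩ := hg
  refine ⟨.mul e e', fun U s₀ P H hd y hy => ?_⟩
  simp only [he U s₀ P H hd y hy, he' U s₀ P H hd y hy]
  rfl

theorem Expressible.gradInner (hf : Expressible m k f) (hg : Expressible m k g) :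
    Expressible m k fun P H y => gradInner (f P H) (g P H) y := by
  obtain ⟨e, he⟩ := hf
  obtain ⟨e', he'⟩ := hg
  exact ⟨.gradInner e e', fun U s₀ P H hd y hy =>
    gradInner_congr hd.isOpen (he U s₀ P H hd) (he' U s₀ P H hd) hy⟩

theorem Expressible.sphereLap (hf : Expressible m k f) :
    Expressible m k fun P H y => sphereLap (f P H) y := by
  obtain ⟨e, he⟩ := hf
  exact ⟨.lap e, fun U s₀ P H hd y hy => sphereLap_congr hd.isOpen (he U s₀ P H hd) hy⟩

theorem Expressible.const_mul (c : ℝ) (hf : Expressible m k f) :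
    Expressible m k fun P H y => c * f P H y :=
  (expressible_const m k c).mul hf

theorem Expressible.sub (hf : Expressible m k f) (hg : Expressible m k g) :
    Expressible m k fun P H y => f P H y - g P H y :=
  (hf.add (hg.const_mul (-1))).congr fun _ _ _ _ _ _ _ => by ring

theorem Expressible.sum {ι : Type*} (t : Finset ι)
    {f : ι → (S2 → ℝ → ℝ) → (S2 → ℝ → ℝ) → S2 → ℝ} (h : ∀ i ∈ t, Expressible m k (f i)) :
    Expressible m k fun P H y => ∑ i ∈ t, f i P H y := by
  classical
  induction t using Finset.induction_on with
  | empty => simpa using expressible_const m k 0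
  | insert i t hi ih =>
    simp only [Finset.sum_insert hi]
    exact (h i (Finset.mem_insert_self i t)).add
      (ih fun j hj => h j (Finset.mem_insert_of_mem hj))

theorem Expressible.mono (hf : Expressible m k f) (hk : k ≤ k') : Expressible m k' f := by
  obtain ⟨e, he⟩ := hf
  refine ⟨e.map (BdrySym.castLE hk), fun U s₀ P H hd y hy => ?_⟩
  rw [DiffExpr.eval_map, he U s₀ P H hd y hy]
  simp only [bdryData_castLE]

theorem ExpressibleBelow.mono (ha : ExpressibleBelow m k N a) {N' : ℕ} (h : N' ≤ N) :
    ExpressibleBelow m k N' a := fun j hj => ha j (hj.trans_le h)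

theorem ExpressibleBelow.add (ha : ExpressibleBelow m k N a) (hb : ExpressibleBelow m k N b) :
    ExpressibleBelow m k N fun P H y => a P H y + b P H y := fun j hj => by
  simpa only [map_add] using (ha j hj).add (hb j hj)

theorem ExpressibleBelow.sub (ha : ExpressibleBelow m k N a) (hb : ExpressibleBelow m k N b) :
    ExpressibleBelow m k N fun P H y => a P H y - b P H y := fun j hj => by
  simpa only [map_sub] using (ha j hj).sub (hb j hj)

theorem ExpressibleBelow.mul (ha : ExpressibleBelow m k N a) (hb : ExpressibleBelow m k N b) :
    ExpressibleBelow m k N fun P H y => a P H y * b P H y := fun j hj => by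
  simp only [coeff_mul]
  refine Expressible.sum _ fun p hp => ?_
  have := Finset.HasAntidiagonal.mem_antidiagonal.1 hp
  exact (ha _ (by omega)).mul (hb _ (by omega))

theorem expressibleBelow_const (m : ℝ) (k N : ℕ) (c : PowerSeries ℝ) :
    ExpressibleBelow m k N fun _ _ _ => c := fun _ _ => expressible_const m k _

theorem ExpressibleBelow.X_mul (ha : ExpressibleBelow m k N a) :
    ExpressibleBelow m k (N + 1) fun P H y => X * a P H y := fun j hj => by
  cases j with
  | zero => simpa only [coeff_zero_X_mul] using expressible_const m k 0
  | succ j => simpa only [coeff_succ_X_mul] using ha j (by omega)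

theorem ExpressibleBelow.derivative (ha : ExpressibleBelow m k (N + 1) a) :
    ExpressibleBelow m k N fun P H y => d⁄dX ℝ (a P H y) := fun j hj => by
  simp only [coeff_derivative]
  exact (ha (j + 1) (by omega)).mul (expressible_const m k _)

theorem ExpressibleBelow.lowPart (ha : ExpressibleBelow m k N a) (N' : ℕ) :
    ExpressibleBelow m k N' fun P H y => lowPart N (a P H y) := fun j _ => by
  simp only [NullInfinity.lowPart, coeff_mk]
  by_cases h : j < N
  · simpa only [if_pos h] using ha j h
  · simpa only [if_neg h] using expressible_const m k 0

/-- The term of a coefficient of a product that has the highest coefficient of the first factor. -/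
theorem coeff_mul_eq_lowPart (k : ℕ) (a b : PowerSeries ℝ) :
    coeff k (a * b) = coeff k (lowPart k a * b) + coeff k a * coeff 0 b := by
  have h1 : ∀ c : PowerSeries ℝ, coeff k (c * b) =
      ∑ i ∈ Finset.range k, coeff i c * coeff (k - i) b + coeff k c * coeff 0 b := by
    intro c
    rw [coeff_mul, Finset.Nat.sum_antidiagonal_eq_sum_range_succ
      (fun i j => coeff i c * coeff j b), Finset.sum_range_succ, Nat.sub_self]
  rw [h1, h1 (lowPart k a)]
  have h2 : coeff k (lowPart k a) = 0 := by simp [lowPart]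
  rw [h2, zero_mul, add_zero]
  congr 1
  refine Finset.sum_congr rfl fun i hi => ?_
  rw [lowPart, coeff_mk, if_pos (Finset.mem_range.1 hi)]

theorem coeff_zero_lowPart (hk : 1 ≤ k) (a : PowerSeries ℝ) : coeff 0 (lowPart k a) = coeff 0 a := by
  rw [lowPart, coeff_mk, if_pos (by omega)]

/-- The terms of a coefficient of a product that have the highest coefficient of a factor. -/
theorem coeff_mul_eq_lowPart_mul_lowPart (hk : 1 ≤ k) (a b : PowerSeries ℝ) :
    coeff k (a * b) = coeff k (lowPart k a * lowPart k b) + coeff 0 a * coeff k b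
      + coeff k a * coeff 0 b := by
  rw [coeff_mul_eq_lowPart, mul_comm (lowPart k a) b, coeff_mul_eq_lowPart, coeff_zero_lowPart hk,
    mul_comm (lowPart k b)]
  ring

/-! ### The recursion for the boundary derivatives -/

theorem expressible_bdry_H {j : ℕ} (hj : j < k) : Expressible m k fun _ H => bdry j H :=
  expressible_sym m (.derH ⟨j, hj⟩)

theorem expressible_inv_H (hk : 1 ≤ k) : Expressible m k fun _ H y => (bdry 0 H y)⁻¹ :=
  expressible_sym m (.invH hk)

theorem expressibleBelow_jet {φ : (S2 → ℝ → ℝ) → (S2 → ℝ → ℝ) → S2 → ℝ → ℝ} :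
    ExpressibleBelow m k N (fun P H => jet (φ P H)) ↔
      ∀ j < N, Expressible m k fun P H => bdry j (φ P H) := by
  refine forall₂_congr fun j _ => ?_
  have hj : (j.factorial : ℝ) ≠ 0 := by positivity
  simp only [coeff_jet]
  constructor
  · intro h
    refine (h.const_mul (j.factorial : ℝ)).congr fun _ _ _ _ _ _ _ => ?_
    field_simp
  · intro h
    refine (h.const_mul (j.factorial : ℝ)⁻¹).congr fun _ _ _ _ _ _ _ => ?_
    field_simp

theorem ExpressibleBelow.lapJet {φ : (S2 → ℝ → ℝ) → (S2 → ℝ → ℝ) → S2 → ℝ → ℝ}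
    (h : ExpressibleBelow m k N fun P H => jet (φ P H)) :
    ExpressibleBelow m k N fun P H => lapJet (φ P H) := fun j hj => by
  simp only [coeff_lapJet, div_eq_inv_mul]
  exact (expressibleBelow_jet.1 h j hj).sphereLap.const_mul _

theorem ExpressibleBelow.gradJet {φ ψ : (S2 → ℝ → ℝ) → (S2 → ℝ → ℝ) → S2 → ℝ → ℝ}
    (h : ExpressibleBelow m k N fun P H => jet (φ P H))
    (h' : ExpressibleBelow m k N fun P H => jet (ψ P H)) :
    ExpressibleBelow m k N fun P H => gradJet (φ P H) (ψ P H) := fun j hj => by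
  simp only [coeff_gradJet, div_eq_inv_mul]
  refine Expressible.sum _ fun p hp => ?_
  have := Finset.HasAntidiagonal.mem_antidiagonal.1 hp
  exact ((expressibleBelow_jet.1 h _ (by omega)).gradInner
    (expressibleBelow_jet.1 h' _ (by omega))).const_mul _

theorem ExpressibleBelow.gradSSeries (ha : ExpressibleBelow m k (N + 1) a) :
    ExpressibleBelow m k (N + 2) fun P H y => gradSSeries m (a P H y) :=
  (expressibleBelow_const m k _ _).add
    ((((expressibleBelow_const m k _ _).mul ha.derivative).X_mul).X_mul)

/-- The part of the Taylor series of `-L` in which only lower derivatives of `P` occur. -/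
theorem expressibleBelow_jet_Lfun_aux (hP : ExpressibleBelow m k (N + 1) fun P _ => jet P) :
    ExpressibleBelow m k (N + 1) fun P _ y =>
      X * (X * ((C 1 - C (2 * m) * X) * (d⁄dX ℝ (jet P y) * d⁄dX ℝ (jet P y)))) + gradJet P P y :=
  (((((expressibleBelow_const m k _ _).mul (hP.derivative.mul hP.derivative)).X_mul).X_mul).mono
    (Nat.le_succ _)).add (hP.gradJet hP)

theorem SmoothData.coeff_jet_Lfun (h : SmoothData m U s₀ P H) (hy : y ∈ U) (j : ℕ) :
    coeff j (jet (Lfun m P) y) = -(2 * (coeff (j + 1) (jet P y) * (j + 1))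
      + coeff j (X * (X * ((C 1 - C (2 * m) * X) * (d⁄dX ℝ (jet P y) * d⁄dX ℝ (jet P y))))
        + gradJet P P y)) := by
  rw [NullInfinity.coeff_jet_Lfun (k := j) h.isOpen h.pos (h.regP _) hy le_rfl, map_neg, add_assoc,
    map_add, coeff_C_mul, coeff_derivative]

theorem expressibleBelow_jet_Lfun (hP : ExpressibleBelow m k (N + 1) fun P _ => jet P) :
    ExpressibleBelow m k N fun P _ => jet (Lfun m P) := fun j hj =>
  ((((hP (j + 1) (by omega)).mul (expressible_const m k ((j : ℝ) + 1))).const_mul 2).add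
    (expressibleBelow_jet_Lfun_aux hP j (by omega))).const_mul (-1) |>.congr
      fun U s₀ P H hd y hy => by
        rw [hd.coeff_jet_Lfun hy]; ring

/-- The recursion for the Taylor series of `√L`. -/
theorem SmoothData.coeff_jet_sqrt (h : SmoothData m U s₀ P H) (hy : y ∈ U) {j : ℕ} (hj : 1 ≤ j) :
    coeff j (jet (fun y s => √(Lfun m P y s)) y) = 1 / 2 * (bdry 0 H y *
      (coeff j (jet (Lfun m P) y) - coeff j (lowPart j (jet (fun y s => √(Lfun m P y s)) y)
        * lowPart j (jet (fun y s => √(Lfun m P y s)) y)))) := by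
  have h1 := coeff_jet_sqrt_mul_self h.isOpen h.pos (h.regP (j + 1)) h.Lfun_pos hy le_rfl
  rw [coeff_mul_eq_lowPart_mul_lowPart hj, h.coeff_zero_jet_sqrt hy] at h1
  have h2 := (h.bdry_zero_pos hy).ne'
  rw [← h1]
  field_simp
  ring

theorem expressibleBelow_jet_sqrt (hk : 1 ≤ k)
    (hL : ExpressibleBelow m k N fun P _ => jet (Lfun m P)) :
    ExpressibleBelow m k N fun P _ => jet fun y s => √(Lfun m P y s) := by
  intro j
  induction j using Nat.strong_induction_on with
  | _ j ih =>
    intro hj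
    rcases Nat.eq_zero_or_pos j with rfl | hj0
    · exact (expressible_inv_H hk).congr fun U s₀ P H hd y hy => hd.coeff_zero_jet_sqrt hy
    · have h1 : ExpressibleBelow m k j fun P _ => jet fun y s => √(Lfun m P y s) :=
        fun i hi => ih i hi (hi.trans hj)
      have h2 := (h1.lowPart (j + 1)).mul (h1.lowPart (j + 1)) j (by omega)
      exact (((expressible_bdry_H (by omega : 0 < k)).mul ((hL j hj).sub h2)).const_mul
        (1 / 2)).congr fun U s₀ P H hd y hy => hd.coeff_jet_sqrt hy hj0

/-- Except at order three, the equation of prescribed mean curvature determines the next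
coefficient of `L`. The indicial factor `3 - k` collects the contributions `3 + 3 / 2` of
`3 H L √L`, `3` of `3 L (1 + s² (1 - 2ms) P_s)` and `k / 2` of the term with `L_s`. -/
theorem SmoothData.indicial_relation (h : SmoothData m U s₀ P H) (hy : y ∈ U) (hk : 1 ≤ k) :
    (3 - (k : ℝ)) / 2 * coeff k (jet (Lfun m P) y) =
      coeff k (C 3 * (lowPart k (jet (Lfun m P) y) * gradSSeries m (jet P y))
        + C (1 / 2) * (X * (lowPart (k - 1) (d⁄dX ℝ (jet (Lfun m P) y)) * gradSSeries m (jet P y)))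
        - X * (jet (Lfun m P) y * d⁄dX ℝ (gradSSeries m (jet P y)))
        - X * (jet (Lfun m P) y * lapJet P y)
        + C (1 / 2) * (X * gradJet (Lfun m P) P y)
        - C 3 * (jet H y * lowPart k (jet (Lfun m P) y * jet (fun y s => √(Lfun m P y s)) y)))
      - 3 * bdry 0 H y * coeff k (lowPart k (jet (Lfun m P) y)
        * lowPart k (jet (fun y s => √(Lfun m P y s)) y))
      + 3 / 2 * coeff k (lowPart k (jet (fun y s => √(Lfun m P y s)) y)
        * lowPart k (jet (fun y s => √(Lfun m P y s)) y)) := by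
  obtain ⟨i, rfl⟩ : ∃ i, k = i + 1 := ⟨k - 1, by omega⟩
  have h1 := coeff_meanCurvature_equation (k := i) h.isOpen h.pos (h.regP _) (h.regH _) h.Lfun_pos
    h.graph.meanCurvature hy le_rfl
  have hw := h.coeff_jet_sqrt hy hk
  have hw0 := h.coeff_zero_jet_sqrt hy
  have hl0 := h.coeff_zero_jet_Lfun hy
  have hh0 : coeff 0 (jet H y) = bdry 0 H y := by rw [coeff_zero_jet, bdry_zero]
  have hne := (h.bdry_zero_pos hy).ne'
  simp only [map_sub, map_add, coeff_C_mul, coeff_succ_X_mul, Nat.add_sub_cancel] at h1 ⊢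
  rw [mul_comm (jet H y), coeff_mul_eq_lowPart (i + 1) (jet (Lfun m P) y * _) (jet H y),
    coeff_mul_eq_lowPart_mul_lowPart hk (jet (Lfun m P) y),
    coeff_mul_eq_lowPart (i + 1) (jet (Lfun m P) y) (gradSSeries m (jet P y)),
    coeff_mul_eq_lowPart i (d⁄dX ℝ (jet (Lfun m P) y)), coeff_zero_gradSSeries, coeff_derivative,
    hw0, hl0, hh0, hw] at h1
  rw [mul_comm (jet H y)]
  push_cast
  generalize coeff (i + 1) (lowPart (i + 1) (jet (fun y s => √(Lfun m P y s)) y)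
        * lowPart (i + 1) (jet (fun y s => √(Lfun m P y s)) y)) = q at *
  generalize coeff (i + 1) (jet (Lfun m P) y) = l at *
  have h2 : (bdry 0 H y)⁻¹ * (bdry 0 H y)⁻¹ * (1 / 2 * (bdry 0 H y * (l - q))) * bdry 0 H y
      = 1 / 2 * (l - q) := by field_simp
  have h3 : l * (bdry 0 H y)⁻¹ * bdry 0 H y = l := by field_simp
  linear_combination h1 - 3 * h2 - 3 * h3

/-- The step of the recursion: the mean curvature equation at order `k` determines the coefficient
of `s^k` in `L`, and this coefficient determines `∂_s^(k+1) P`. -/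
theorem expressible_bdry_succ (hk : 1 ≤ k) (hk3 : k ≠ 3)
    (hP : ExpressibleBelow m (k + 1) (k + 1) fun P _ => jet P) :
    Expressible m (k + 1) fun P _ => bdry (k + 1) P := by
  have hH : ExpressibleBelow m (k + 1) (k + 1) fun _ H => jet H :=
    expressibleBelow_jet.2 fun j hj => expressible_bdry_H hj
  have hL := expressibleBelow_jet_Lfun hP
  have hW := expressibleBelow_jet_sqrt (by omega) hL
  have hc := fun c N => expressibleBelow_const m (k + 1) N c
  have hS := (hP.gradSSeries)
  have hS1 := hS.mono (Nat.le_succ (k + 1))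
  have hD := (hP.gradSSeries.derivative).mono (Nat.le_succ k)
  have hL' : ExpressibleBelow m (k + 1) (k - 1) fun P _ y => d⁄dX ℝ (jet (Lfun m P) y) :=
    ExpressibleBelow.derivative (hL.mono (by omega))
  have e1 : ExpressibleBelow m (k + 1) (k + 1) _ := ((((((hc (C 3) _).mul
    ((hL.lowPart _).mul hS1)).add
    ((hc (C (1 / 2)) _).mul (((hL'.lowPart _).mul (hS1.mono (Nat.le_succ k))).X_mul))).sub
    ((hL.mul hD).X_mul)).sub
    ((hL.mul (hP.lapJet.mono (Nat.le_succ k))).X_mul)).add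
    ((hc (C (1 / 2)) _).mul ((hL.gradJet (hP.mono (Nat.le_succ k))).X_mul))).sub
    ((hc (C 3) _).mul (hH.mul ((hL.mul hW).lowPart _)))
  have e2 := (hL.lowPart (k + 1)).mul (hW.lowPart (k + 1)) k (by omega)
  have e3 := (hW.lowPart (k + 1)).mul (hW.lowPart (k + 1)) k (by omega)
  have hk' : (3 - (k : ℝ)) ≠ 0 := by
    intro h0
    exact hk3 (by exact_mod_cast (sub_eq_zero.1 h0).symm)
  have e4 : Expressible m (k + 1) fun P _ y => coeff k (jet (Lfun m P) y) := by
    refine (((((e1 k (by omega)).sub (((expressible_bdry_H (by omega : 0 < k + 1)).const_mul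
      3).mul e2)).add (e3.const_mul (3 / 2)))).const_mul (2 / (3 - (k : ℝ)))).congr
      fun U s₀ P H hd y hy => ?_
    rw [← hd.indicial_relation hy hk]
    field_simp
  have e5 := (e4.add (expressibleBelow_jet_Lfun_aux hP k (by omega))).const_mul
    (-((k + 1).factorial : ℝ) / (2 * (k + 1)))
  refine e5.congr fun U s₀ P H hd y hy => ?_
  rw [hd.coeff_jet_Lfun hy, coeff_jet]
  have h1 : ((k + 1).factorial : ℝ) ≠ 0 := by positivity
  have h2 : (k : ℝ) + 1 ≠ 0 := by positivity
  field_simp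
  ring

theorem expressible_bdry_P (m : ℝ) (k : ℕ) : Expressible m k fun P _ => bdry k P := by
  induction k using Nat.strong_induction_on with
  | _ k ih =>
    rcases k with _ | k
    · exact expressible_sym m .value
    · rcases Nat.eq_zero_or_pos k with rfl | hk
      -- `P_s` is given by `L = H₀⁻²` at `s = 0`.
      · have h0 := (ih 0 (by omega)).mono (Nat.zero_le 1)
        have hi := expressible_inv_H (m := m) (k := 1) le_rfl
        refine (((hi.mul hi).add (h0.gradInner h0)).const_mul (-(1 / 2))).congr
          fun U s₀ P H hd y hy => ?_
        have h1 := hd.coeff_jet_Lfun hy 0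
        rw [hd.coeff_zero_jet_Lfun hy] at h1
        rw [h1, zero_add, map_add, coeff_zero_X_mul, coeff_gradJet, coeff_jet]
        simp
      -- At `k = 3` the indicial factor vanishes, and `P_ssss` is a symbol.
      · by_cases hk3 : k = 3
        · subst hk3
          exact expressible_sym m (.fourth le_rfl)
        · exact expressible_bdry_succ hk hk3
            (expressibleBelow_jet.2 fun j hj => (ih j hj).mono hj.le)

end

end NullInfinity

end

theorem theorem3p2 (m : ℝ) (hm : 0 ≤ m) :
    -- `P` and `H` of class `C^4` up to `s = 0`
    (∀ (U : Set S2) (s₀ : ℝ) (P H : S2 → ℝ → ℝ),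
      IsOpen U → 0 < s₀ → 2 * m * s₀ ≤ 1 → IsSpacelikeGraph 4 m U s₀ P H →
      -- (a)
      (∀ y ∈ U, bdryL 0 m P y = 0 ∨ (bdry 0 H y ≠ 0 ∧ bdryL 0 m P y = invSqH H y)) ∧
      ((∀ y ∈ U, bdryL 0 m P y = invSqH H y ∧ 0 < bdryL 0 m P y) →
        -- (b)(i)
        (∀ y ∈ U, bdry 1 P y =
          -(1 / 2) * (invSqH H y + gradInner (bdry 0 P) (bdry 0 P) y)) ∧
        -- (b)(ii)
        (OrderS 2 U s₀ (fun y s => H y s - H y 0) ↔ ∀ y ∈ U, FormulaLs m P H y) ∧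
        (∀ y ∈ U, (FormulaLs m P H y ↔ FormulaPss P H y)) ∧
        -- (b)(iii)
        (OrderS 2 U s₀ (fun y s => H y s - H y 0) →
          (OrderS 3 U s₀ (fun y s => H y s - H y 0) ↔ ∀ y ∈ U, FormulaLss m P H y) ∧
          (∀ y ∈ U, (FormulaLss m P H y ↔ FormulaPsss m P H y))) ∧
        -- (c)
        (OrderS 3 U s₀ (fun y s => H y s - H y 0) → ∀ y ∈ U, Compatibility m P H y))) ∧
    -- (d) `P` and `H` smooth up to `s = 0`
    (∀ k : ℕ, ∃ e : DiffExpr (BdrySym k),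
      ∀ (U : Set S2) (s₀ : ℝ) (P H : S2 → ℝ → ℝ),
        IsOpen U → 0 < s₀ → 2 * m * s₀ ≤ 1 → IsSpacelikeGraph ∞ m U s₀ P H →
        (∀ y ∈ U, bdryL 0 m P y = invSqH H y ∧ 0 < bdryL 0 m P y) →
        ∀ y ∈ U, bdry k P y = e.eval (bdryData k P H) y) := by
  refine ⟨fun U s₀ P H hU hs₀ _ h => ⟨fun y hy => ?_, boundary_statements hU hs₀ h⟩, fun k => ?_⟩
  · have hP : Reg 4 U s₀ P := h.regularP.reg
    have hH : Reg 4 U s₀ H := h.regularH.reg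
    exact bdryL_zero_alternative hU hs₀ (hP.of_le (by norm_num)) (hH.of_le (by norm_num))
      (fun y hy s hs => Lfun_pos hU (hP.of_le (by norm_num)) hy hs (h.spacelike y hy s hs))
      h.meanCurvature hy
  · obtain ⟨e, he⟩ := expressible_bdry_P m k
    exact ⟨e, fun U s₀ P H hU hs₀ _ h hL y hy => he U s₀ P H
      ⟨hU, hs₀, h, fun y hy => (hL y hy).1, fun y hy => (hL y hy).2⟩ y hy⟩
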